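/- Let $d\ge 2$, let $A,\gamma,\mu,\lambda$ be real numbers with $A>0$, $\gamma>1$, $\mu>0$ and $\lambda+2\mu>0$, and let $\rho:\mathbb R^d\to[0,\infty)$ and $v:\mathbb R^d\to\mathbb R^d$ be $C^\infty$ functions that solve the stationary barotropic compressible Navier–Stokes system $$\nabla\cdot(\rho v)=0,\qquad \nabla\cdot(\rho v\otimes v)=-\nabla P+\mu\Delta v+(\mu+\lambda)\nabla(\nabla\cdot v),\qquad P=A\rho^{\gamma}$$ on $\mathbb R^d$. Assume that (i) if $d\ge 4$: $\rho\in L^\infty(\mathbb R^d)$ and $v\in\dot H^1(\mathbb R^d)$; (ii) if $d=3$: $\rho\in L^\infty(\mathbb R^3)$, $\nabla v\in L^2(\mathbb R^3)$ and $v\in L^{9/2}(\mathbb R^3)$; (iii) if $d=2$: $\rho\in L^\infty(\mathbb R^2)$, $\nabla v\in L^2(\mathbb R^2)$ and $v\in L^{6}(\mathbb R^2)$. Here $\dot H^1(\mathbb R^d)$, $d\ge 4$, is the completion of $C_c^\infty(\mathbb R^d)$ under the norm $\|\nabla f\|_{L^2(\mathbb R^d)}$, regarded as a space of functions: it consists of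 the $L^1_{\mathrm{loc}}$-limits of sequences in $C_c^\infty$ that are Cauchy in this norm (for vector fields, componentwise). Then $v\equiv 0$ and $\rho$ is constant on $\mathbb R^d$. -/

import Mathlib

open MeasureTheory Filter Topology
open scoped ContDiff Gradient Laplacian ENNReal

noncomputable section

namespace CompressibleNS

/-- The Euclidean space `ℝ^d`. -/
abbrev Space (d : ℕ) : Type := EuclideanSpace ℝ (Fin d)

/-- The partial derivative `∂ⱼ f` of a scalar function at `x`. -/
def partialDeriv {d : ℕ} (j : Fin d) (f : Space d → ℝ) (x : Space d) : ℝ :=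
  fderiv ℝ f x (EuclideanSpace.single j 1)

/-- The divergence `∇ · u = ∑ⱼ ∂ⱼ uⱼ` of a vector field. -/
def divergence {d : ℕ} (u : Space d → Space d) (x : Space d) : ℝ :=
  ∑ j, partialDeriv j (fun y => u y j) x

/-- The divergence of a matrix field, the vector with components `(∇ · T)ᵢ = ∑ⱼ ∂ⱼ Tᵢⱼ`. -/
def matrixDivergence {d : ℕ} (T : Space d → Matrix (Fin d) (Fin d) ℝ) (x : Space d) :
    Space d :=
  WithLp.toLp 2 fun i => ∑ j, partialDeriv j (fun y => T y i j) x

/-- The stationary barotropic compressible Navier-Stokes system on `ℝ^d`, with pressure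
`P = A ρ ^ γ` and viscosity coefficients `mu`, `lam`, satisfied at every point. -/
structure IsStationarySolution {d : ℕ} (A γ mu lam : ℝ)
    (ρ : Space d → ℝ) (v : Space d → Space d) : Prop where
  /-- `∇ · (ρ v) = 0` -/
  continuity : ∀ x, divergence (fun y => ρ y • v y) x = 0
  /-- `∇ · (ρ v ⊗ v) = - ∇ P + μ Δ v + (μ + λ) ∇ (∇ · v)` -/
  momentum : ∀ x,
    matrixDivergence (fun y => ρ y • Matrix.vecMulVec (v y) (v y)) x =
      -(∇ (fun y => A * ρ y ^ γ) x) + mu • Δ v x + (mu + lam) • ∇ (divergence v) x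

/-- Membership of a vector field in the homogeneous Sobolev space `Ḣ¹(ℝ^d)`, the completion of
`C_c^∞` under the norm `‖∇ f‖_{L²}`. In dimension `d ≥ 3` (the only case where it is used), by the
Sobolev inequality, a sequence in `C_c^∞` that is Cauchy for this norm converges in `L¹_loc`, and
the completion is the space of functions that arise as such limits. -/
def MemHomogeneousH1 {d : ℕ} (v : Space d → Space d) : Prop :=
  ∃ φ : ℕ → Space d → Space d,
    (∀ n, ContDiff ℝ ∞ (φ n) ∧ HasCompactSupport (φ n)) ∧
    (∀ ε : ℝ≥0∞, 0 < ε → ∃ N, ∀ m ≥ N, ∀ n ≥ N,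
      eLpNorm (fun x => fderiv ℝ (φ m) x - fderiv ℝ (φ n) x) 2 volume < ε) ∧
    (∀ K : Set (Space d), IsCompact K →
      Tendsto (fun n => ∫⁻ x in K, ‖φ n x - v x‖ₑ) atTop (𝓝 0))

end CompressibleNS

end

/-! The proof is an energy estimate at infinity. The momentum equation is tested with `φ v`, where
`φ` cuts off between the radii `R` and `2R`. Viscosity produces the integral of `μ|∇v|² + (μ+λ)(div
v)²`. Since `∫(div v)² ≤ ∫|∇v|²` and `λ + 2μ > 0`, this controls `∫|∇v|²`, so it suffices that the
terms carrying `∇φ` tend to zero. The convective one is at most a constant times `R⁻¹∫|v|³` over the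
annulus, the viscous one `R⁻¹∫|∇v||v|`; Hölder handles both when `v ∈ Lᵖ` with `p > 4` and `d(1 -
3/p) ≤ 1`. The exponents `6` for `d = 2` and `9/2` for `d = 3` give equality.

The pressure is the real difficulty, because `P` is only bounded. By the continuity equation `v·∇P =
γ/(γ-1) div(Pv)`, and since `div(ρv) = 0` one may replace `P` by `P - cρ` with any constant `c`. Let
`m` be an average of `P` at scale `R` around the origin, `m = A t^γ`, and take `c = A t^(γ-1)`. Then
`|P - cρ| ≤ |P - m|`, because `t^(γ-1) s` lies between `s^γ` and `t^γ`. Only the oscillation of `P`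
remains, and the momentum equation controls it, being of the form `∇P = f + div T`.

The oscillation is estimated in `exists_setLIntegral_mul_sub_mollify_le`. With a kernel `η` such
that `y η(y) = -∇Φ(y)`, the difference between `P` and its average at scale `R` is a first-order
average of `f` plus second derivatives of a truncated Newtonian potential of `T`. The Laplacian of
that potential is the average minus the function, so `‖∂ᵢ∂ⱼu‖₂ ≤ ‖Δu‖₂` gives an `L²` bound uniform
in `R`, with no singular integrals. For `d = 2, 3` the convection is put into `T` as `-ρ v⊗v`.

For `d ≥ 4`, Sobolev gives `v ∈ Lᵖ` with `p = 2d/(d-2)`. The convection is kept as `f = -ρ v·∇v ∈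
L^{d/(d-1)}`, which must be paired with an element of `L^d`; in general `v` is not one, nor is
`|v|³` integrable. The test field is therefore `φ v (1+ε|v|²)⁻²`. For fixed `ε` all boundary terms
vanish as `R → ∞`. The derivative of the weight leaves an error that tends to zero with `ε` by
dominated convergence.

Once `∇v = 0`, the velocity is constant with an integrable power, hence zero. Then `∇P = 0`, and `ρ`
is constant. -/

noncomputable section

namespace CompressibleNS

/-! ### Partial derivatives and integration by parts -/

section

variable {d : ℕ}

theorem partialDeriv_congr {j : Fin d} {f g : Space d → ℝ} {x : Space d} (h : f =ᶠ[𝓝 x] g) :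
    partialDeriv j f x = partialDeriv j g x := by
  simp only [partialDeriv, h.fderiv_eq]

theorem partialDeriv_add {j : Fin d} {f g : Space d → ℝ} {x : Space d}
    (hf : DifferentiableAt ℝ f x) (hg : DifferentiableAt ℝ g x) :
    partialDeriv j (fun y => f y + g y) x = partialDeriv j f x + partialDeriv j g x := by
  simp [partialDeriv, fderiv_fun_add hf hg]

theorem partialDeriv_sub {j : Fin d} {f g : Space d → ℝ} {x : Space d}
    (hf : DifferentiableAt ℝ f x) (hg : DifferentiableAt ℝ g x) :
    partialDeriv j (fun y => f y - g y) x = partialDeriv j f x - partialDeriv j g x := by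
  simp [partialDeriv, fderiv_fun_sub hf hg]

theorem partialDeriv_mul {j : Fin d} {f g : Space d → ℝ} {x : Space d}
    (hf : DifferentiableAt ℝ f x) (hg : DifferentiableAt ℝ g x) :
    partialDeriv j (fun y => f y * g y) x =
      f x * partialDeriv j g x + g x * partialDeriv j f x := by
  simp [partialDeriv, fderiv_fun_mul hf hg]

theorem partialDeriv_const_mul {j : Fin d} {f : Space d → ℝ} {x : Space d} (c : ℝ)
    (hf : DifferentiableAt ℝ f x) :
    partialDeriv j (fun y => c * f y) x = c * partialDeriv j f x := by
  simp [partialDeriv, fderiv_const_mul hf c]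

theorem partialDeriv_sum {ι : Type*} (s : Finset ι) {j : Fin d} {f : ι → Space d → ℝ}
    {x : Space d} (hf : ∀ i ∈ s, DifferentiableAt ℝ (f i) x) :
    partialDeriv j (fun y => ∑ i ∈ s, f i y) x = ∑ i ∈ s, partialDeriv j (f i) x := by
  simp [partialDeriv, fderiv_fun_sum hf]

theorem partialDeriv_comp {j : Fin d} {h : ℝ → ℝ} {h' : ℝ} {f : Space d → ℝ} {x : Space d}
    (hh : HasDerivAt h h' (f x)) (hf : DifferentiableAt ℝ f x) :
    partialDeriv j (fun y => h (f y)) x = h' * partialDeriv j f x := by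
  have := (hh.comp_hasFDerivAt x hf.hasFDerivAt).fderiv
  simp only [Function.comp_def] at this
  simp [partialDeriv, this]

theorem fderiv_eq_sum_partialDeriv (f : Space d → ℝ) (x y : Space d) :
    fderiv ℝ f x y = ∑ i, y i * partialDeriv i f x := by
  have : y = ∑ i, y i • EuclideanSpace.single i (1 : ℝ) := by
    ext k; simp [Finset.sum_apply, Pi.single_apply]
  conv_lhs => rw [this]
  simp [partialDeriv]

theorem contDiff_partialDeriv {f : Space d → ℝ} (hf : ContDiff ℝ ∞ f) (j : Fin d) :
    ContDiff ℝ ∞ (partialDeriv j f) :=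
  (hf.fderiv_right (m := ∞) (by simp)).clm_apply contDiff_const

theorem continuous_partialDeriv {f : Space d → ℝ} (hf : ContDiff ℝ 1 f) (j : Fin d) :
    Continuous (partialDeriv j f) :=
  (hf.continuous_fderiv (by simp)).clm_apply continuous_const

theorem hasCompactSupport_partialDeriv {f : Space d → ℝ} (hf : HasCompactSupport f) (j : Fin d) :
    HasCompactSupport (partialDeriv j f) :=
  hf.fderiv_apply (𝕜 := ℝ) _

theorem partialDeriv_comm {f : Space d → ℝ} (hf : ContDiff ℝ ∞ f) (i j : Fin d) (x : Space d) :
    partialDeriv i (partialDeriv j f) x = partialDeriv j (partialDeriv i f) x := by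
  have h1 : DifferentiableAt ℝ (fderiv ℝ f) x :=
    ((hf.fderiv_right (m := ∞) (by simp)).differentiable (by simp)) x
  have h2 := (hf.contDiffAt (x := x)).isSymmSndFDerivAt
    (by simpa using (mod_cast le_top : ((2 : ℕ∞) : WithTop ℕ∞) ≤ ((⊤ : ℕ∞) : WithTop ℕ∞)))
  have key : ∀ i j : Fin d, partialDeriv i (partialDeriv j f) x =
      fderiv ℝ (fderiv ℝ f) x (EuclideanSpace.single i 1) (EuclideanSpace.single j 1) := by
    intro i j
    change fderiv ℝ (fun y => fderiv ℝ f y (EuclideanSpace.single j 1)) x _ = _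
    rw [fderiv_clm_apply h1 (differentiableAt_const _)]
    simp
  rw [key, key, h2.eq]

theorem abs_partialDeriv_le (f : Space d → ℝ) (j : Fin d) (x : Space d) :
    |partialDeriv j f x| ≤ ‖fderiv ℝ f x‖ := by
  have := (fderiv ℝ f x).le_opNorm (EuclideanSpace.single j 1)
  simpa [partialDeriv] using this

theorem partialDeriv_comp_affine {f : Space d → ℝ} {j : Fin d} (a : Space d) (c : ℝ) {y : Space d}
    (hf : DifferentiableAt ℝ f (a + c • y)) :
    partialDeriv j (fun z => f (a + c • z)) y = c * partialDeriv j f (a + c • y) := by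
  have h1 : HasFDerivAt (fun z : Space d => a + c • z) (c • ContinuousLinearMap.id ℝ (Space d)) y :=
    ((hasFDerivAt_id y).const_smul c).const_add a
  have := (hf.hasFDerivAt.comp y h1).fderiv
  simp only [Function.comp_def] at this
  simp [partialDeriv, this]

theorem integral_mul_partialDeriv {f g : Space d → ℝ} (hf : ContDiff ℝ 1 f) (hg : ContDiff ℝ 1 g)
    (hc : HasCompactSupport f ∨ HasCompactSupport g) (j : Fin d) :
    ∫ x, f x * partialDeriv j g x = -∫ x, partialDeriv j f x * g x := by
  apply integral_mul_fderiv_eq_neg_fderiv_mul_of_integrable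
  · apply Continuous.integrable_of_hasCompactSupport
    · exact (continuous_partialDeriv hf j).mul hg.continuous
    · exact hc.elim (fun h => (hasCompactSupport_partialDeriv h j).mul_right) (fun h => h.mul_left)
  · apply Continuous.integrable_of_hasCompactSupport
    · exact hf.continuous.mul (continuous_partialDeriv hg j)
    · exact hc.elim (fun h => h.mul_right) (fun h => (hasCompactSupport_partialDeriv h j).mul_left)
  · apply Continuous.integrable_of_hasCompactSupport
    · exact hf.continuous.mul hg.continuous
    · exact hc.elim (fun h => h.mul_right) (fun h => h.mul_left)
  · exact fun x _ => hf.differentiable (by simp) x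
  · exact fun x _ => hg.differentiable (by simp) x

/-- `‖∂ᵢ∂ⱼ u‖₂ ≤ ‖Δ u‖₂` for test functions. -/
theorem integral_sq_partialDeriv_partialDeriv_le {u : Space d → ℝ} (hu : ContDiff ℝ ∞ u)
    (hc : HasCompactSupport u) (i j : Fin d) :
    ∫ x, (partialDeriv i (partialDeriv j u) x) ^ 2 ≤
      ∫ x, (∑ k, partialDeriv k (partialDeriv k u) x) ^ 2 := by
  have hD := fun k => contDiff_partialDeriv hu k
  have hDD := fun k l => contDiff_partialDeriv (hD k) l
  have hcD := fun k => hasCompactSupport_partialDeriv hc k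
  have hcDD := fun k l => hasCompactSupport_partialDeriv (hcD k) l
  have one : (1 : WithTop ℕ∞) ≤ ((⊤ : ℕ∞) : WithTop ℕ∞) := by simp
  -- Two integrations by parts, with the order of differentiation exchanged. Summed over `k` and
  -- `l`, the right-hand sides give `∫(Δu)²`, and a single nonnegative square is at most the sum.
  have key : ∀ k l, ∫ x, (partialDeriv k (partialDeriv l u) x) ^ 2 =
      ∫ x, partialDeriv k (partialDeriv k u) x * partialDeriv l (partialDeriv l u) x := by
    intro k l
    have e1 : ∀ x, (partialDeriv k (partialDeriv l u) x) ^ 2 =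
        partialDeriv l (partialDeriv k u) x * partialDeriv k (partialDeriv l u) x := by
      intro x; rw [partialDeriv_comm hu l k, sq]
    simp_rw [e1]
    have a1 := integral_mul_partialDeriv (f := partialDeriv l (partialDeriv k u))
      (g := partialDeriv l u) ((hDD k l).of_le one) ((hD l).of_le one) (Or.inr (hcD l)) k
    have a2 := integral_mul_partialDeriv (f := partialDeriv l u)
      (g := partialDeriv k (partialDeriv k u)) ((hD l).of_le one)
      ((hDD k k).of_le one) (Or.inl (hcD l)) l
    rw [a1]
    have e2 : ∀ x, partialDeriv k (partialDeriv l (partialDeriv k u)) x * partialDeriv l u x =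
        partialDeriv l u x * partialDeriv l (partialDeriv k (partialDeriv k u)) x := by
      intro x; rw [partialDeriv_comm (hD k) k l, mul_comm]
    simp_rw [e2]
    rw [a2, neg_neg]
    simp_rw [mul_comm]
  have hint : ∀ k l, Integrable (fun x => partialDeriv k (partialDeriv k u) x *
      partialDeriv l (partialDeriv l u) x) := fun k l =>
    ((hDD k k).continuous.mul (hDD l l).continuous).integrable_of_hasCompactSupport
      (hcDD k k).mul_right
  have e3 : ∫ x, (∑ k, partialDeriv k (partialDeriv k u) x) ^ 2 =
      ∑ k, ∑ l, ∫ x, (partialDeriv k (partialDeriv l u) x) ^ 2 := by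
    simp_rw [key, sq, Finset.sum_mul_sum]
    rw [integral_finsetSum _ (fun k _ => integrable_finsetSum _ (fun l _ => hint k l))]
    exact Finset.sum_congr rfl fun k _ => integral_finsetSum _ (fun l _ => hint k l)
  rw [e3]
  have nn : ∀ k l, 0 ≤ ∫ x, (partialDeriv k (partialDeriv l u) x) ^ 2 :=
    fun k l => integral_nonneg fun x => sq_nonneg _
  calc _ ≤ ∑ l, ∫ x, (partialDeriv i (partialDeriv l u) x) ^ 2 :=
        Finset.single_le_sum (f := fun l => ∫ x, (partialDeriv i (partialDeriv l u) x) ^ 2)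
          (fun l _ => nn i l) (Finset.mem_univ j)
    _ ≤ _ := Finset.single_le_sum
          (f := fun k => ∑ l, ∫ x, (partialDeriv k (partialDeriv l u) x) ^ 2)
          (fun k _ => Finset.sum_nonneg fun l _ => nn k l) (Finset.mem_univ i)

end

/-! ### A radial kernel with a potential, and averages of translates -/

section

variable {d : ℕ}

/-- A smooth probability density `η` supported in the unit ball, together with a smooth potential
`Φ` supported in the unit ball such that `y η(y) = -∇Φ(y)`. -/
structure IsRadialKernel (η Φ : Space d → ℝ) : Prop where
  contDiff : ContDiff ℝ ∞ η
  contDiff_potential : ContDiff ℝ ∞ Φ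
  eq_zero : ∀ y, 1 < ‖y‖ → η y = 0
  potential_eq_zero : ∀ y, 1 < ‖y‖ → Φ y = 0
  nonneg : ∀ y, 0 ≤ η y
  integral_eq_one : ∫ y, η y = 1
  coord_mul : ∀ y i, y i * η y = -partialDeriv i Φ y

theorem hasCompactSupport_of_eq_zero {F : Type*} [Zero F] {f : Space d → F} (r : ℝ)
    (h : ∀ y, r < ‖y‖ → f y = 0) : HasCompactSupport f :=
  HasCompactSupport.intro (isCompact_closedBall (0 : Space d) r) fun y hy => h y (by simpa using hy)

theorem IsRadialKernel.hasCompactSupport {η Φ : Space d → ℝ} (h : IsRadialKernel η Φ) :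
    HasCompactSupport η := hasCompactSupport_of_eq_zero 1 h.eq_zero

theorem IsRadialKernel.hasCompactSupport_potential {η Φ : Space d → ℝ} (h : IsRadialKernel η Φ) :
    HasCompactSupport Φ := hasCompactSupport_of_eq_zero 1 h.potential_eq_zero

/-- For a decreasing profile `k` vanishing on `[1, ∞)`, the chain rule gives `∇(k(|y|²)/2) =
k'(|y|²) y`. So `-k'(|y|²)` is a nonnegative density with the required potential; dividing both by
its mass normalises it. -/
theorem exists_isRadialKernel (hd : 0 < d) : ∃ η Φ : Space d → ℝ, IsRadialKernel η Φ := by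
  set k : ℝ → ℝ := fun s => expNegInvGlue (1 - s) with hk
  have hks : ContDiff ℝ ∞ k := expNegInvGlue.contDiff.comp (contDiff_const.sub contDiff_id)
  have hk' : ContDiff ℝ ∞ (deriv k) := by
    exact ContDiff.iterate_deriv 1 hks
  have hanti : Antitone k := fun a b h => expNegInvGlue.monotone (by linarith)
  have hk0 : ∀ s, 1 < s → deriv k s = 0 := by
    intro s hs
    have : k =ᶠ[𝓝 s] fun _ => 0 := by
      filter_upwards [lt_mem_nhds hs] with t ht
      exact expNegInvGlue.zero_of_nonpos (by linarith)
    rw [this.deriv_eq]; simp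
  set η₀ : Space d → ℝ := fun y => -deriv k (‖y‖ ^ 2) with hη₀
  have hη₀s : ContDiff ℝ ∞ η₀ := (hk'.comp (contDiff_norm_sq ℝ)).neg
  have hη₀n : ∀ y, 0 ≤ η₀ y := fun y => by
    have := hanti.deriv_nonpos (x := ‖y‖ ^ 2)
    simp only [hη₀]; linarith
  have hη₀z : ∀ y, 1 < ‖y‖ → η₀ y = 0 := fun y hy => by
    simp [hη₀, hk0 _ (show 1 < ‖y‖ ^ 2 by nlinarith)]
  -- The mean value theorem supplies a point with `k'(s) = -k(0) ≠ 0`. Hence the unnormalised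
  -- density is nonzero at a vector of length `√s`, and its mass is positive.
  obtain ⟨s, hs, hs'⟩ : ∃ s ∈ Set.Ioo (0 : ℝ) 1, deriv k s = (k 1 - k 0) / (1 - 0) :=
    exists_deriv_eq_slope k (by norm_num) hks.continuous.continuousOn
      (hks.differentiable (by simp)).differentiableOn
  have hk1 : k 1 = 0 := by simp [hk]
  have hk00 : 0 < k 0 := by simpa [hk] using expNegInvGlue.pos_of_pos one_pos
  have hpos : 0 < ∫ y, η₀ y := by
    refine hη₀s.continuous.integral_pos_of_hasCompactSupport_nonneg_nonzero
      (hasCompactSupport_of_eq_zero 1 hη₀z) hη₀n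
      (x := EuclideanSpace.single ⟨0, hd⟩ (Real.sqrt s)) ?_
    have : ‖(EuclideanSpace.single ⟨0, hd⟩ (Real.sqrt s) : Space d)‖ ^ 2 = s := by
      rw [PiLp.norm_single, Real.norm_eq_abs, sq_abs, Real.sq_sqrt hs.1.le]
    simp only [hη₀, this, hs', hk1]
    simp; exact hk00.ne'
  set c := ∫ y, η₀ y
  have hΦs : ContDiff ℝ ∞ (fun y : Space d => c⁻¹ * (2⁻¹ * k (‖y‖ ^ 2))) :=
    contDiff_const.mul (contDiff_const.mul (hks.comp (contDiff_norm_sq ℝ)))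
  refine ⟨fun y => c⁻¹ * η₀ y, fun y => c⁻¹ * (2⁻¹ * k (‖y‖ ^ 2)), contDiff_const.mul hη₀s, hΦs,
    fun y hy => by simp [hη₀z y hy], fun y hy => ?_, fun y => mul_nonneg (by positivity) (hη₀n y),
    ?_, fun y i => ?_⟩
  · have : k (‖y‖ ^ 2) = 0 := expNegInvGlue.zero_of_nonpos (by nlinarith)
    simp [this]
  · rw [integral_const_mul, inv_mul_cancel₀ hpos.ne']
  · have h1 : HasFDerivAt (fun y : Space d => ‖y‖ ^ 2) (2 • innerSL ℝ y) y :=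
      (hasStrictFDerivAt_norm_sq y).hasFDerivAt
    have h2 := (hks.differentiable (by simp) (‖y‖ ^ 2)).hasDerivAt
    have hkd : DifferentiableAt ℝ (fun y : Space d => k (‖y‖ ^ 2)) y :=
      (hks.comp (contDiff_norm_sq ℝ)).differentiable (by simp) y
    rw [partialDeriv_const_mul _ (hkd.const_mul _), partialDeriv_const_mul _ hkd,
      partialDeriv_comp h2 h1.differentiableAt]
    simp [partialDeriv, h1.fderiv, hη₀, EuclideanSpace.inner_single_right]
    ring

section TranslationAverage

variable {Ω : Type*} [MeasurableSpace Ω] {F : Type} [NormedAddCommGroup F] [NormedSpace ℝ F]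

/-- The weighted average `x ↦ ∫ w(p) f(x - τ(p)) dν(p)` of translates of `f`. -/
def translAvg (ν : Measure Ω) (w : Ω → ℝ) (τ : Ω → Space d) (f : Space d → F) (x : Space d) : F :=
  ∫ p, w p • f (x - τ p) ∂ν

variable {ν : Measure Ω} {w : Ω → ℝ} {τ : Ω → Space d}

theorem hasCompactSupport_translAvg {r : ℝ} (hr : ∀ᵐ p ∂ν, ‖τ p‖ ≤ r) {f : Space d → F}
    (hc : HasCompactSupport f) : HasCompactSupport (translAvg ν w τ f) := by
  obtain ⟨s, hs⟩ := hc.isCompact.isBounded.exists_norm_le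
  refine hasCompactSupport_of_eq_zero (s + r) fun y hy => ?_
  refine integral_eq_zero_of_ae (hr.mono fun p hp => ?_)
  have : w p • f (y - τ p) = 0 := by
    rw [image_eq_zero_of_notMem_tsupport (f := f), smul_zero]
    intro hmem
    have h1 := hs _ hmem
    have h2 := norm_sub_norm_le y (τ p)
    linarith
  simpa using this

variable [IsFiniteMeasure ν]

theorem integrable_translAvg (hw : Measurable w) {C : ℝ} (hC : ∀ᵐ p ∂ν, |w p| ≤ C) (hτ : Measurable τ)
    {f : Space d → F} (hf : Continuous f) (hc : HasCompactSupport f) (x : Space d) :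
    Integrable (fun p => w p • f (x - τ p)) ν := by
  obtain ⟨B, hB⟩ := hc.exists_bound_of_continuous hf
  refine Integrable.of_bound (C := C * B) ?_ (hC.mono fun p hp => ?_)
  · exact hw.aestronglyMeasurable.smul
      (hf.stronglyMeasurable.comp_measurable (measurable_const.sub hτ)).aestronglyMeasurable
  · rw [norm_smul]
    exact mul_le_mul hp (hB _) (norm_nonneg _) ((abs_nonneg _).trans hp)

theorem hasFDerivAt_translAvg (hw : Measurable w) {C : ℝ} (hC : ∀ᵐ p ∂ν, |w p| ≤ C)
    (hτ : Measurable τ) {f : Space d → F} (hf : ContDiff ℝ 1 f) (hc : HasCompactSupport f)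
    (x : Space d) :
    HasFDerivAt (translAvg ν w τ f) (translAvg ν w τ (fderiv ℝ f) x) x := by
  have hf' : Continuous (fderiv ℝ f) := hf.continuous_fderiv (by simp)
  have hc' : HasCompactSupport (fderiv ℝ f) := hc.fderiv ℝ
  obtain ⟨B, hB⟩ := hc'.exists_bound_of_continuous hf'
  refine hasFDerivAt_integral_of_dominated_of_fderiv_le (s := Set.univ)
    (F' := fun x p => w p • fderiv ℝ f (x - τ p)) (bound := fun _ => C * B) univ_mem
    (Eventually.of_forall fun y => (integrable_translAvg hw hC hτ hf.continuous hc y).1)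
    (integrable_translAvg hw hC hτ hf.continuous hc x)
    (integrable_translAvg hw hC hτ hf' hc' x).1 (hC.mono fun p hp y _ => ?_)
    (integrable_const _) (Eventually.of_forall fun p y _ => ?_)
  · rw [norm_smul]
    exact mul_le_mul hp (hB _) (norm_nonneg _) ((abs_nonneg _).trans hp)
  · have h1 : HasFDerivAt (fun z : Space d => z - τ p) (ContinuousLinearMap.id ℝ (Space d)) y :=
      (hasFDerivAt_id y).sub_const (τ p)
    have h2 := ((hf.differentiable (by simp) (y - τ p)).hasFDerivAt.comp y h1).const_smul (w p)
    simpa [Function.comp_def, Pi.smul_def] using h2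

/-- The derivative of an average is the average of the derivative, so the induction passes from `f`
to `fderiv ℝ f`; this changes the target space, which is therefore quantified inside the induction.
The extra derivative in the hypothesis lets the base case deduce continuity from differentiability.
-/
theorem contDiff_translAvg_nat (hw : Measurable w) {C : ℝ} (hC : ∀ᵐ p ∂ν, |w p| ≤ C)
    (hτ : Measurable τ) (n : ℕ) : ∀ {F : Type} [NormedAddCommGroup F] [NormedSpace ℝ F]
    {f : Space d → F}, ContDiff ℝ (n + 1 : ℕ) f → HasCompactSupport f →
      ContDiff ℝ n (translAvg ν w τ f) := by
  induction n with
  | zero =>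
    intro F _ _ f hf hc
    have : Differentiable ℝ (translAvg ν w τ f) := fun x =>
      (hasFDerivAt_translAvg hw hC hτ (by simpa using hf) hc x).differentiableAt
    exact contDiff_zero.2 this.continuous
  | succ n ih =>
    intro F _ _ f hf hc
    push_cast
    rw [contDiff_succ_iff_hasFDerivAt]
    refine ⟨translAvg ν w τ (fderiv ℝ f), ih ?_ (hc.fderiv ℝ), fun x =>
      hasFDerivAt_translAvg hw hC hτ (hf.of_le (by norm_cast; omega)) hc x⟩
    exact hf.fderiv_right (by norm_cast)

theorem contDiff_translAvg (hw : Measurable w) {C : ℝ} (hC : ∀ᵐ p ∂ν, |w p| ≤ C)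
    (hτ : Measurable τ) {f : Space d → F} (hf : ContDiff ℝ ∞ f) (hc : HasCompactSupport f) :
    ContDiff ℝ ∞ (translAvg ν w τ f) :=
  contDiff_infty.2 fun n => contDiff_translAvg_nat hw hC hτ n (contDiff_infty.1 hf _) hc

theorem partialDeriv_translAvg (hw : Measurable w) {C : ℝ} (hC : ∀ᵐ p ∂ν, |w p| ≤ C)
    (hτ : Measurable τ) {f : Space d → ℝ} (hf : ContDiff ℝ 1 f) (hc : HasCompactSupport f)
    (j : Fin d) (x : Space d) :
    partialDeriv j (translAvg ν w τ f) x = translAvg ν w τ (partialDeriv j f) x := by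
  rw [partialDeriv, (hasFDerivAt_translAvg hw hC hτ hf hc x).fderiv, translAvg,
    ContinuousLinearMap.integral_apply]
  · rfl
  · exact integrable_translAvg hw hC hτ (hf.continuous_fderiv (by simp)) (hc.fderiv ℝ) x

end TranslationAverage

end

/-! ### The truncated Newtonian potential and its `L²` bound -/

section

variable {d : ℕ}

/-- Lebesgue measure on the cylinder `(0, R] × B̄(0, 1)`. -/
def cylMeasure (d : ℕ) (R : ℝ) : Measure (ℝ × Space d) :=
  (volume.restrict (Set.Ioc 0 R)).prod (volume.restrict (Metric.closedBall 0 1))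

instance (R : ℝ) : IsFiniteMeasure (volume.restrict (Metric.closedBall (0 : Space d) R)) :=
  ⟨by simpa using measure_closedBall_lt_top⟩

instance (R : ℝ) : IsFiniteMeasure (cylMeasure d R) := by
  unfold cylMeasure; infer_instance

theorem integrable_cylMeasure {F : Type*} [NormedAddCommGroup F] {G : ℝ × Space d → F}
    (hG : Continuous G) (R : ℝ) : Integrable G (cylMeasure d R) := by
  rw [cylMeasure, Measure.prod_restrict]
  have : IntegrableOn G (Set.Icc 0 R ×ˢ Metric.closedBall 0 1)
      ((volume : Measure ℝ).prod (volume : Measure (Space d))) :=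
    hG.continuousOn.integrableOn_compact (isCompact_Icc.prod (isCompact_closedBall _ _))
  exact this.mono_set (Set.prod_mono Set.Ioc_subset_Icc_self subset_rfl)

theorem ae_cylMeasure (R : ℝ) :
    ∀ᵐ p ∂(cylMeasure d R), 0 ≤ p.1 ∧ p.1 ≤ R ∧ ‖p.2‖ ≤ 1 := by
  rw [cylMeasure, Measure.prod_restrict]
  filter_upwards [ae_restrict_mem (measurableSet_Ioc.prod measurableSet_closedBall)] with p hp
  exact ⟨hp.1.1.le, hp.1.2, by simpa using hp.2⟩

theorem setIntegral_closedBall {F : Type*} [NormedAddCommGroup F] [NormedSpace ℝ F]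
    {f : Space d → F} (hf : ∀ y, 1 < ‖y‖ → f y = 0) :
    ∫ y in Metric.closedBall 0 1, f y = ∫ y, f y :=
  setIntegral_eq_integral_of_forall_compl_eq_zero fun y hy => hf y (by simpa using hy)

theorem hasCompactSupport_sq {f : Space d → ℝ} (hc : HasCompactSupport f) :
    HasCompactSupport fun x => f x ^ 2 :=
  hc.comp_left (g := fun t : ℝ => t ^ 2) (by simp)

/-- The average `∫ η(y) f(x - R y) dy` of `f` at scale `R`. -/
def mollify (η : Space d → ℝ) (R : ℝ) (f : Space d → ℝ) (x : Space d) : ℝ :=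
  ∫ y, η y * f (x - R • y)

/-- The truncated Newtonian potential `∫₀ᴿ ∫ s Φ(y) f(x - s y) dy ds`. -/
def truncPotential (Φ : Space d → ℝ) (R : ℝ) (f : Space d → ℝ) (x : Space d) : ℝ :=
  translAvg (cylMeasure d R) (fun p => p.1 * Φ p.2) (fun p => p.1 • p.2) f x

theorem sub_eq_integral_partialDeriv {f : Space d → ℝ} (hf : ContDiff ℝ 1 f) (x y : Space d)
    {R : ℝ} (hR : 0 ≤ R) :
    f x - f (x - R • y) = ∫ s in Set.Ioc 0 R, ∑ i, y i * partialDeriv i f (x - s • y) := by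
  have h1 : ∀ s : ℝ, HasDerivAt (fun s : ℝ => -f (x - s • y))
      (∑ i, y i * partialDeriv i f (x - s • y)) s := by
    intro s
    have a1 : HasDerivAt (fun s : ℝ => x - s • y) (-y) s := by
      simpa using ((hasDerivAt_id s).smul_const y).const_sub x
    have a2 := ((hf.differentiable (by simp) (x - s • y)).hasFDerivAt.comp_hasDerivAt s a1).neg
    rw [map_neg, neg_neg, fderiv_eq_sum_partialDeriv] at a2
    exact a2
  have hc : Continuous fun s : ℝ => ∑ i, y i * partialDeriv i f (x - s • y) :=
    continuous_finsetSum _ fun i _ => continuous_const.mul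
      ((continuous_partialDeriv hf i).comp (by fun_prop))
  rw [← intervalIntegral.integral_of_le hR,
    intervalIntegral.integral_eq_sub_of_hasDerivAt (fun s _ => h1 s) (hc.intervalIntegrable _ _)]
  simp; ring

variable {η Φ : Space d → ℝ}

theorem IsRadialKernel.continuous (h : IsRadialKernel η Φ) : Continuous η := h.contDiff.continuous

theorem IsRadialKernel.continuous_potential (h : IsRadialKernel η Φ) : Continuous Φ :=
  h.contDiff_potential.continuous

/-- The fundamental theorem of calculus along the segment from `x` to `x - R y`, averaged against
`η`, which has mass one. -/
theorem sub_mollify_eq (h : IsRadialKernel η Φ) {f : Space d → ℝ} (hf : ContDiff ℝ 1 f)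
    (x : Space d) {R : ℝ} (hR : 0 ≤ R) :
    f x - mollify η R f x = ∫ p, η p.2 * ∑ i, p.2 i * partialDeriv i f (x - p.1 • p.2)
      ∂(cylMeasure d R) := by
  have hd := fun i => continuous_partialDeriv hf i
  have hη := h.continuous
  have hint := integrable_cylMeasure (G := fun p : ℝ × Space d =>
    η p.2 * ∑ i, p.2 i * partialDeriv i f (x - p.1 • p.2)) (by fun_prop) R
  rw [cylMeasure] at hint ⊢
  rw [integral_prod_symm _ hint]
  simp_rw [integral_const_mul, ← sub_eq_integral_partialDeriv hf x _ hR]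
  rw [setIntegral_closedBall (fun y hy => by simp [h.eq_zero y hy])]
  simp_rw [mul_sub]
  have hfc := hf.continuous
  rw [integral_sub, integral_mul_const, h.integral_eq_one, one_mul, mollify]
  · exact (hη.mul continuous_const).integrable_of_hasCompactSupport h.hasCompactSupport.mul_right
  · exact Continuous.integrable_of_hasCompactSupport (by fun_prop) h.hasCompactSupport.mul_right

/-- The relation `y η = -∇Φ` enters here. The factor `s` in the potential absorbs the chain rule for
`y ↦ g(x - s y)`, so the derivative can be moved from `g` to `Φ` by parts. -/
theorem truncPotential_partialDeriv (h : IsRadialKernel η Φ) {g : Space d → ℝ}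
    (hg : ContDiff ℝ 1 g) (i : Fin d) (x : Space d) (R : ℝ) :
    truncPotential Φ R (partialDeriv i g) x =
      -∫ p, η p.2 * (p.2 i * g (x - p.1 • p.2)) ∂(cylMeasure d R) := by
  have hd := continuous_partialDeriv hg i
  have hη := h.continuous
  have hΦ := h.continuous_potential
  have hgc := hg.continuous
  have hint1 := integrable_cylMeasure (G := fun p : ℝ × Space d =>
    (p.1 * Φ p.2) • partialDeriv i g (x - p.1 • p.2)) (by fun_prop) R
  have hint2 := integrable_cylMeasure (G := fun p : ℝ × Space d =>
    η p.2 * (p.2 i * g (x - p.1 • p.2))) (by fun_prop) R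
  rw [truncPotential, translAvg]
  rw [cylMeasure] at hint1 hint2 ⊢
  rw [integral_prod _ hint1, integral_prod _ hint2, ← integral_neg]
  congr 1
  ext s
  simp only
  rw [setIntegral_closedBall (fun y hy => by simp [h.potential_eq_zero y hy]),
    setIntegral_closedBall (fun y hy => by simp [h.eq_zero y hy])]
  have hgs : ContDiff ℝ 1 (fun y : Space d => g (x + (-s) • y)) := by fun_prop
  have := integral_mul_partialDeriv (h.contDiff_potential.of_le (by simp)) hgs
    (Or.inl h.hasCompactSupport_potential) i
  have e : ∀ y, partialDeriv i (fun y : Space d => g (x + (-s) • y)) y =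
      -s * partialDeriv i g (x - s • y) := fun y => by
    rw [partialDeriv_comp_affine x (-s) (hg.differentiable (by simp) _)]
    simp [sub_eq_add_neg]
  simp_rw [e] at this
  calc _ = -∫ y, Φ y * (-s * partialDeriv i g (x - s • y)) := by
        rw [← integral_neg]; congr 1; ext y; simp; ring
    _ = _ := by
        rw [this, neg_neg, ← integral_neg]; congr 1; ext y
        have := h.coord_mul y i
        rw [show partialDeriv i Φ y = -(y i * η y) by linarith]
        simp [sub_eq_add_neg]; ring

theorem mollify_eq_translAvg (h : IsRadialKernel η Φ) (R : ℝ) (f : Space d → ℝ) :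
    mollify η R f = translAvg (volume.restrict (Metric.closedBall 0 1)) η (fun y => R • y) f := by
  ext x
  rw [translAvg, setIntegral_closedBall (fun y hy => by simp [h.eq_zero y hy])]
  simp [mollify]

theorem IsRadialKernel.exists_bound (h : IsRadialKernel η Φ) : ∃ C, ∀ y, |η y| ≤ C :=
  h.hasCompactSupport.exists_bound_of_continuous h.continuous

theorem contDiff_mollify (h : IsRadialKernel η Φ) (R : ℝ) {f : Space d → ℝ}
    (hf : ContDiff ℝ ∞ f) (hc : HasCompactSupport f) : ContDiff ℝ ∞ (mollify η R f) := by
  obtain ⟨C, hC⟩ := h.exists_bound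
  rw [mollify_eq_translAvg h]
  exact contDiff_translAvg h.continuous.measurable (Eventually.of_forall hC) (by fun_prop) hf hc

theorem hasCompactSupport_mollify (h : IsRadialKernel η Φ) (R : ℝ) {f : Space d → ℝ}
    (hc : HasCompactSupport f) : HasCompactSupport (mollify η R f) := by
  rw [mollify_eq_translAvg h]
  refine hasCompactSupport_translAvg (r := |R|) ?_ hc
  filter_upwards [ae_restrict_mem measurableSet_closedBall] with y hy
  rw [norm_smul, Real.norm_eq_abs]
  exact mul_le_of_le_one_right (abs_nonneg _) (by simpa using hy)

/-- Jensen for the probability density `η`, then Fubini and translation invariance. -/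
theorem integral_sq_mollify_le (h : IsRadialKernel η Φ) (R : ℝ) {f : Space d → ℝ}
    (hf : ContDiff ℝ ∞ f) (hc : HasCompactSupport f) :
    ∫ x, mollify η R f x ^ 2 ≤ ∫ x, f x ^ 2 := by
  have hη := h.continuous
  have hfc := hf.continuous
  have hMc := (contDiff_mollify h R hf hc).continuous
  have hMs := hasCompactSupport_mollify h R hc
  have hi : ∀ (g : Space d → ℝ), Continuous g → Integrable fun y => η y * g y := fun g hg =>
    (hη.mul hg).integrable_of_hasCompactSupport h.hasCompactSupport.mul_right
  -- The variance of `f(x - R y)` under `η dy` is nonnegative.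
  have jensen : ∀ x, mollify η R f x ^ 2 ≤ ∫ y, η y * f (x - R • y) ^ 2 := by
    intro x
    set m := mollify η R f x with hm
    have h1 : 0 ≤ ∫ y, η y * (f (x - R • y) - m) ^ 2 :=
      integral_nonneg fun y => mul_nonneg (h.nonneg y) (sq_nonneg _)
    have h2 : ∫ y, η y * (f (x - R • y) - m) ^ 2 =
        ∫ y, (η y * f (x - R • y) ^ 2 - (2 * m) * (η y * f (x - R • y)) + m ^ 2 * η y) := by
      congr 1; ext y; ring
    rw [h2, integral_add, integral_sub, integral_const_mul, integral_const_mul,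
      h.integral_eq_one, ← mollify, ← hm] at h1
    · nlinarith
    · exact hi (fun y => f (x - R • y) ^ 2) (by fun_prop)
    · exact (hi (fun y => f (x - R • y)) (by fun_prop)).const_mul _
    · exact (hi (fun y => f (x - R • y) ^ 2) (by fun_prop)).sub
        ((hi (fun y => f (x - R • y)) (by fun_prop)).const_mul _)
    · exact (by simpa using hi (fun _ => 1) continuous_const : Integrable η).const_mul _
  have hf2 : Continuous fun x => f x ^ 2 := by fun_prop
  have hf2c : HasCompactSupport fun x => f x ^ 2 := hasCompactSupport_sq hc
  have hmeas : AEStronglyMeasurable (fun p : Space d × Space d => η p.2 * f (p.1 - R • p.2) ^ 2)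
      (volume.prod volume) := by
    exact Continuous.aestronglyMeasurable (by fun_prop)
  have hsub : ∀ y, ∫ x, η y * f (x - R • y) ^ 2 = η y * ∫ x, f x ^ 2 := fun y => by
    rw [integral_const_mul, integral_sub_right_eq_self (fun x => f x ^ 2)]
  have hprod : Integrable (fun p : Space d × Space d => η p.2 * f (p.1 - R • p.2) ^ 2)
      (volume.prod volume) := by
    rw [integrable_prod_iff' hmeas]
    refine ⟨Eventually.of_forall fun y => ((hf2.integrable_of_hasCompactSupport hf2c).comp_sub_right
      (R • y)).const_mul (η y), ?_⟩
    have : ∀ y, ∫ x, ‖η y * f (x - R • y) ^ 2‖ = η y * ∫ x, f x ^ 2 := fun y => by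
      rw [← hsub]
      refine integral_congr_ae (Eventually.of_forall fun x => ?_)
      exact Real.norm_of_nonneg (mul_nonneg (h.nonneg y) (sq_nonneg _))
    simp_rw [this]
    exact hi (fun _ => ∫ x, f x ^ 2) continuous_const
  calc ∫ x, mollify η R f x ^ 2 ≤ ∫ x, ∫ y, η y * f (x - R • y) ^ 2 := by
        refine integral_mono ?_ hprod.integral_prod_left jensen
        refine Continuous.integrable_of_hasCompactSupport (by fun_prop) ?_
        exact hasCompactSupport_sq hMs
    _ = ∫ y, ∫ x, η y * f (x - R • y) ^ 2 := integral_integral_swap hprod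
    _ = _ := by simp_rw [hsub, integral_mul_const, h.integral_eq_one, one_mul]

/-- The elementary substitute for a Calderón–Zygmund estimate. Derivatives commute with averages of
translates, so the function in question is a second derivative of `u = truncPotential Φ R f`. It is
bounded in `L²` by `Δu`, the average of `f` minus `f`. The constant `4` does not depend on `R`. -/
theorem integral_sq_truncPotential_le (h : IsRadialKernel η Φ) {R : ℝ} (hR : 0 ≤ R)
    {f : Space d → ℝ} (hf : ContDiff ℝ ∞ f) (hc : HasCompactSupport f) (i j : Fin d) :
    Continuous (truncPotential Φ R (partialDeriv i (partialDeriv j f))) ∧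
    HasCompactSupport (truncPotential Φ R (partialDeriv i (partialDeriv j f))) ∧
    ∫ x, truncPotential Φ R (partialDeriv i (partialDeriv j f)) x ^ 2 ≤ 4 * ∫ x, f x ^ 2 := by
  obtain ⟨C, hC⟩ := h.hasCompactSupport_potential.exists_bound_of_continuous h.continuous_potential
  have hΦ := h.continuous_potential
  have hw : Measurable fun p : ℝ × Space d => p.1 * Φ p.2 :=
    Continuous.measurable (by fun_prop)
  have hwC : ∀ᵐ p ∂(cylMeasure d R), |p.1 * Φ p.2| ≤ R * C := by
    filter_upwards [ae_cylMeasure R] with p hp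
    rw [abs_mul, abs_of_nonneg hp.1]
    exact mul_le_mul hp.2.1 (hC _) (abs_nonneg _) hR
  have hτ : Measurable fun p : ℝ × Space d => p.1 • p.2 := Continuous.measurable (by fun_prop)
  have hτr : ∀ᵐ p ∂(cylMeasure d R), ‖p.1 • p.2‖ ≤ R := by
    filter_upwards [ae_cylMeasure R] with p hp
    rw [norm_smul, Real.norm_of_nonneg hp.1]
    nlinarith [norm_nonneg p.2]
  have one : (1 : WithTop ℕ∞) ≤ ((⊤ : ℕ∞) : WithTop ℕ∞) := by simp
  have hD := fun k => contDiff_partialDeriv hf k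
  have hDD := fun k l => contDiff_partialDeriv (hD k) l
  have hcD := fun k => hasCompactSupport_partialDeriv hc k
  have hcDD := fun k l => hasCompactSupport_partialDeriv (hcD k) l
  have hus : ContDiff ℝ ∞ (truncPotential Φ R f) := contDiff_translAvg hw hwC hτ hf hc
  have huc : HasCompactSupport (truncPotential Φ R f) := hasCompactSupport_translAvg hτr hc
  have hu1 : ∀ k, partialDeriv k (truncPotential Φ R f) = truncPotential Φ R (partialDeriv k f) :=
    fun k => funext fun x => partialDeriv_translAvg hw hwC hτ (hf.of_le one) hc k x
  have hu2 : ∀ k l, partialDeriv k (partialDeriv l (truncPotential Φ R f)) =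
      truncPotential Φ R (partialDeriv k (partialDeriv l f)) := fun k l => by
    rw [hu1]
    exact funext fun x => partialDeriv_translAvg hw hwC hτ ((hD l).of_le one) (hcD l) k x
  -- Summing `truncPotential_partialDeriv` over `g = ∂ₖf` produces minus the cylinder integral of `η
  -- y·∇f`, which `sub_mollify_eq` identifies.
  have hlap : ∀ x, ∑ k, partialDeriv k (partialDeriv k (truncPotential Φ R f)) x =
      mollify η R f x - f x := by
    intro x
    have hη := h.continuous
    have hDc := fun k => (hD k).continuous
    simp_rw [hu2, fun k => truncPotential_partialDeriv h ((hD k).of_le one) k x R]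
    rw [Finset.sum_neg_distrib, ← integral_finsetSum, ← neg_sub (f x),
      sub_mollify_eq h (hf.of_le one) x hR]
    · simp_rw [Finset.mul_sum]
    · intro k _
      exact integrable_cylMeasure (G := fun p : ℝ × Space d =>
        η p.2 * (p.2 k * partialDeriv k f (x - p.1 • p.2))) (by fun_prop) R
  have hMc := (contDiff_mollify h R hf hc).continuous
  have hMs := hasCompactSupport_mollify h R hc
  have hfc := hf.continuous
  have i1 : Integrable fun x => mollify η R f x ^ 2 := by
    refine Continuous.integrable_of_hasCompactSupport (by fun_prop) ?_
    exact hasCompactSupport_sq hMs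
  have i2 : Integrable fun x => f x ^ 2 := by
    refine Continuous.integrable_of_hasCompactSupport (by fun_prop) ?_
    exact hasCompactSupport_sq hc
  rw [← hu2]
  refine ⟨(contDiff_partialDeriv (contDiff_partialDeriv hus j) i).continuous,
    hasCompactSupport_partialDeriv (hasCompactSupport_partialDeriv huc j) i, ?_⟩
  calc _ ≤ ∫ x, (mollify η R f x - f x) ^ 2 := by
        simpa only [hlap] using integral_sq_partialDeriv_partialDeriv_le hus huc i j
    _ ≤ ∫ x, (2 * mollify η R f x ^ 2 + 2 * f x ^ 2) := by
        refine integral_mono ?_ ((i1.const_mul 2).add (i2.const_mul 2)) fun x => ?_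
        · refine Continuous.integrable_of_hasCompactSupport (by fun_prop) ?_
          exact hasCompactSupport_sq (hMs.sub hc)
        · simp only; nlinarith [sq_nonneg (mollify η R f x + f x)]
    _ ≤ _ := by
        rw [integral_add (i1.const_mul 2) (i2.const_mul 2), integral_const_mul, integral_const_mul]
        linarith [integral_sq_mollify_le h R hf hc]

end

/-! ### Hölder estimates on balls, and averages around different centres -/

section

variable {d : ℕ}

/-- The points `a - R y` stay in the ball of radius `3R`, and `R⁻ᵈ` is the Jacobian of the
substitution. -/
theorem setLIntegral_sub_smul_le {F : Space d → ℝ≥0∞} (hF : Measurable F) {R : ℝ} (hR : 0 < R)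
    {a : Space d} (ha : ‖a‖ ≤ 2 * R) :
    ∫⁻ y in Metric.closedBall 0 1, F (a - R • y) ≤
      (ENNReal.ofReal (R ^ d))⁻¹ * ∫⁻ z in Metric.closedBall 0 (3 * R), F z := by
  set G := (Metric.closedBall (0 : Space d) (3 * R)).indicator F with hG
  have hGm : Measurable G := hF.indicator measurableSet_closedBall
  have h1 : ∫⁻ y in Metric.closedBall 0 1, F (a - R • y) ≤ ∫⁻ y, G (a - R • y) := by
    rw [← lintegral_indicator measurableSet_closedBall]
    refine lintegral_mono fun y => ?_
    refine Set.indicator_le (g := fun y => G (a - R • y)) (fun y hy => ?_) y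
    rw [hG, Set.indicator_of_mem]
    rw [mem_closedBall_zero_iff] at hy ⊢
    calc ‖a - R • y‖ ≤ ‖a‖ + ‖R • y‖ := norm_sub_le _ _
      _ ≤ 2 * R + R * 1 := by
        rw [norm_smul, Real.norm_of_nonneg hR.le]; gcongr
      _ = 3 * R := by ring
  have h2 : ∫⁻ y, G (a - R • y) = (ENNReal.ofReal (R ^ d))⁻¹ * ∫⁻ z, G z := by
    have : ∫⁻ y : Space d, G (a - R • y) =
        ∫⁻ z, G (a - z) ∂(Measure.map (fun y : Space d => R • y) volume) := by
      rw [lintegral_map (f := fun z => G (a - z)) (hGm.comp (by fun_prop)) (by fun_prop)]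
    rw [this, Measure.map_addHaar_smul _ hR.ne', lintegral_smul_measure,
      lintegral_sub_left_eq_self]
    rw [finrank_euclideanSpace_fin, abs_of_pos (by positivity),
      ENNReal.ofReal_inv_of_pos (by positivity), smul_eq_mul]
  rw [h2, hG, lintegral_indicator measurableSet_closedBall] at h1
  exact h1

theorem lintegral_enorm_sq_eq {f : Space d → ℝ} (hf : Continuous f) (hc : HasCompactSupport f) :
    ∫⁻ x, ‖f x‖ₑ ^ (2 : ℝ) = ENNReal.ofReal (∫ x, f x ^ 2) := by
  rw [ofReal_integral_eq_lintegral_ofReal]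
  · refine lintegral_congr fun x => ?_
    rw [← ofReal_norm, ENNReal.ofReal_rpow_of_nonneg (norm_nonneg _) (by norm_num)]
    norm_num
  · exact Continuous.integrable_of_hasCompactSupport (by fun_prop) (hasCompactSupport_sq hc)
  · exact Eventually.of_forall fun x => sq_nonneg _

/-- Product of two integrals over subsets of finite measure, by Hölder. -/
theorem setLIntegral_mul_setLIntegral_le {p q : ℝ} (hpq : p.HolderConjugate q)
    {A B : Set (Space d)} {V : ℝ≥0∞} (hA : volume A ≤ V) (hB : volume B ≤ V)
    {g f : Space d → ℝ≥0∞} (hg : Measurable g) (hf : Measurable f) :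
    (∫⁻ x in A, g x) * ∫⁻ x in B, f x ≤
      V * ((∫⁻ x in A, g x ^ p) ^ (1 / p) * (∫⁻ x in B, f x ^ q) ^ (1 / q)) := by
  have h1 := ENNReal.lintegral_mul_le_Lp_mul_Lq (volume.restrict A) hpq hg.aemeasurable
    (aemeasurable_const (b := (1 : ℝ≥0∞)))
  have h2 := ENNReal.lintegral_mul_le_Lp_mul_Lq (volume.restrict B) hpq.symm hf.aemeasurable
    (aemeasurable_const (b := (1 : ℝ≥0∞)))
  simp only [Pi.mul_apply, mul_one, ENNReal.one_rpow, lintegral_const, one_mul,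
    Measure.restrict_apply_univ] at h1 h2
  have hp := hpq.pos
  have hq := hpq.symm.pos
  calc _ ≤ ((∫⁻ x in A, g x ^ p) ^ (1 / p) * V ^ (1 / q)) *
        ((∫⁻ x in B, f x ^ q) ^ (1 / q) * V ^ (1 / p)) := by
        refine mul_le_mul' (h1.trans ?_) (h2.trans ?_)
        · gcongr
        · gcongr
    _ = V ^ (1 / q + 1 / p) * ((∫⁻ x in A, g x ^ p) ^ (1 / p) *
          (∫⁻ x in B, f x ^ q) ^ (1 / q)) := by
        rw [ENNReal.rpow_add_of_nonneg _ _ (by positivity) (by positivity)]; ring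
    _ = _ := by
        rw [show 1 / q + 1 / p = 1 by simpa [add_comm] using hpq.inv_add_inv_eq_one, ENNReal.rpow_one]

/-- Pairing with an average of translates over the cylinder, by Hölder. -/
theorem setLIntegral_mul_lintegral_cylMeasure_le {p q : ℝ} (hpq : p.HolderConjugate q)
    {R : ℝ} (hR : 0 < R) {g f : Space d → ℝ≥0∞} (hg : Measurable g) (hf : Measurable f) :
    ∫⁻ x in Metric.closedBall 0 (2 * R), g x * ∫⁻ c, f (x - c.1 • c.2) ∂(cylMeasure d R) ≤
      cylMeasure d R Set.univ * ((∫⁻ x in Metric.closedBall 0 (2 * R), g x ^ p) ^ (1 / p) *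
        (∫⁻ x in Metric.closedBall 0 (3 * R), f x ^ q) ^ (1 / q)) := by
  have hm : Measurable fun z : Space d × (ℝ × Space d) => f (z.1 - z.2.1 • z.2.2) :=
    hf.comp (by fun_prop)
  have hgm : Measurable fun z : Space d × (ℝ × Space d) => g z.1 * f (z.1 - z.2.1 • z.2.2) :=
    (hg.comp measurable_fst).mul hm
  calc _ = ∫⁻ x in Metric.closedBall 0 (2 * R),
        ∫⁻ c, g x * f (x - c.1 • c.2) ∂(cylMeasure d R) := by
        refine lintegral_congr fun x => ?_
        rw [lintegral_const_mul]
        exact hm.comp (measurable_const.prodMk measurable_id)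
    _ = ∫⁻ c, (∫⁻ x in Metric.closedBall 0 (2 * R), g x * f (x - c.1 • c.2)) ∂(cylMeasure d R) :=
        lintegral_lintegral_swap hgm.aemeasurable
    _ ≤ ∫⁻ _, ((∫⁻ x in Metric.closedBall 0 (2 * R), g x ^ p) ^ (1 / p) *
        (∫⁻ x in Metric.closedBall 0 (3 * R), f x ^ q) ^ (1 / q)) ∂(cylMeasure d R) := by
        refine lintegral_mono_ae ?_
        filter_upwards [ae_cylMeasure R] with c hc
        have hfc : Measurable fun x => f (x - c.1 • c.2) := hf.comp (by fun_prop)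
        refine (ENNReal.lintegral_mul_le_Lp_mul_Lq _ hpq hg.aemeasurable hfc.aemeasurable).trans ?_
        have hq := hpq.symm.pos
        refine mul_le_mul' le_rfl (ENNReal.rpow_le_rpow ?_ (by positivity))
        rw [← lintegral_indicator measurableSet_closedBall,
          ← lintegral_indicator (μ := volume) (s := Metric.closedBall 0 (3 * R))
            measurableSet_closedBall]
        refine le_of_le_of_eq (lintegral_mono fun x => ?_)
          (lintegral_sub_right_eq_self (μ := volume) _ (c.1 • c.2))
        refine Set.indicator_le (g := fun x => (Metric.closedBall (0 : Space d) (3 * R)).indicator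
          (fun a => f a ^ q) (x - c.1 • c.2)) (fun x hx => ?_) x
        rw [Set.indicator_of_mem]
        rw [mem_closedBall_zero_iff] at hx ⊢
        calc ‖x - c.1 • c.2‖ ≤ ‖x‖ + ‖c.1 • c.2‖ := norm_sub_le _ _
          _ ≤ 2 * R + R * 1 := by
            rw [norm_smul, Real.norm_of_nonneg hc.1]
            exact add_le_add hx (mul_le_mul hc.2.1 hc.2.2 (norm_nonneg _) hR.le)
          _ = 3 * R := by ring
    _ = _ := by rw [lintegral_const, mul_comm]

theorem cylMeasure_univ (R : ℝ) : cylMeasure d R Set.univ =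
    ENNReal.ofReal R * volume (Metric.closedBall (0 : Space d) 1) := by
  rw [cylMeasure, ← Set.univ_prod_univ, Measure.prod_prod]; simp

/-- Localises the stress. The potential at `|x| ≤ 2R` only sees points of norm at most `3R`; the
value `1` on a larger open ball makes the derivatives of `χT` and `T` agree there as well. -/
theorem exists_cutoff {R : ℝ} (hR : 0 < R) : ∃ χ : Space d → ℝ, ContDiff ℝ ∞ χ ∧
    HasCompactSupport χ ∧ (∀ x, ‖x‖ < 4 * R → χ x = 1) ∧ (∀ x, 6 * R ≤ ‖x‖ → χ x = 0) ∧
    ∀ x, |χ x| ≤ 1 := by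
  let b : ContDiffBump (0 : Space d) := ⟨4 * R, 6 * R, by positivity, by linarith⟩
  refine ⟨b, b.contDiff, b.hasCompactSupport, fun x hx => b.one_of_mem_closedBall ?_,
    fun x hx => b.zero_of_le_dist ?_, fun x => ?_⟩
  · simpa [b] using hx.le
  · simpa [b] using hx
  · rw [abs_of_nonneg b.nonneg]; exact b.le_one

variable {η Φ : Space d → ℝ}

theorem IsRadialKernel.exists_bound_deriv (h : IsRadialKernel η Φ) :
    ∃ K : ℝ, 0 ≤ K ∧ (∀ y, |η y| ≤ K) ∧ ∀ j y, |partialDeriv j η y| ≤ K := by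
  obtain ⟨C, hC⟩ := h.exists_bound
  obtain ⟨D, hD⟩ := (h.hasCompactSupport.fderiv (𝕜 := ℝ)).exists_bound_of_continuous
    (h.contDiff.continuous_fderiv (by simp))
  refine ⟨max C D, ((abs_nonneg _).trans (hC 0)).trans (le_max_left _ _),
    fun y => (hC y).trans (le_max_left _ _), fun j y =>
    (abs_partialDeriv_le _ _ _).trans ((hD y).trans (le_max_right _ _))⟩

theorem partialDeriv_eq_zero_of_one_lt (h : IsRadialKernel η Φ) (j : Fin d) (y : Space d)
    (hy : 1 < ‖y‖) : partialDeriv j η y = 0 := by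
  have : η =ᶠ[𝓝 y] fun _ => 0 := by
    filter_upwards [(isOpen_lt continuous_const continuous_norm).mem_nhds hy] with z hz
    exact h.eq_zero z hz
  rw [partialDeriv_congr this]; simp [partialDeriv]

/-- The difference of the averages of `P` around `x` and around `0`. -/
theorem mollify_sub_mollify_zero_eq (h : IsRadialKernel η Φ) {P : Space d → ℝ}
    (hP : ContDiff ℝ 1 P) (x : Space d) (R : ℝ) :
    mollify η R P x - mollify η R P 0 =
      ∫ c, η c.2 * ∑ i, x i * partialDeriv i P (x - R • c.2 - c.1 • x) ∂(cylMeasure d 1) := by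
  have hd := fun i => continuous_partialDeriv hP i
  have hη := h.continuous
  have hPc := hP.continuous
  have hint := integrable_cylMeasure (G := fun c : ℝ × Space d =>
    η c.2 * ∑ i, x i * partialDeriv i P (x - R • c.2 - c.1 • x)) (by fun_prop) 1
  rw [cylMeasure] at hint ⊢
  rw [integral_prod_symm _ hint]
  simp_rw [integral_const_mul, ← fun y => sub_eq_integral_partialDeriv hP (x - R • y) x zero_le_one]
  rw [setIntegral_closedBall (fun y hy => by simp [h.eq_zero y hy])]
  simp_rw [mul_sub]
  rw [integral_sub, mollify, mollify]
  · congr 2; ext y; simp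
  · exact Continuous.integrable_of_hasCompactSupport (by fun_prop) h.hasCompactSupport.mul_right
  · exact Continuous.integrable_of_hasCompactSupport (by fun_prop) h.hasCompactSupport.mul_right

/-- Integration by parts in `y`: differentiating `y ↦ T(x - R y - s x)` costs a factor `-R`. The
resulting `R⁻¹` compensates the factor `xᵢ`, of size `2R`, in `mollify_sub_mollify_zero_eq`. -/
theorem integral_kernel_mul_partialDeriv (h : IsRadialKernel η Φ) {T : Space d → ℝ}
    (hT : ContDiff ℝ 1 T) (x : Space d) {R : ℝ} (hR : 0 < R) (j : Fin d) :
    ∫ c, η c.2 * partialDeriv j T (x - R • c.2 - c.1 • x) ∂(cylMeasure d 1) =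
      R⁻¹ * ∫ c, partialDeriv j η c.2 * T (x - R • c.2 - c.1 • x) ∂(cylMeasure d 1) := by
  have hd := continuous_partialDeriv hT j
  have hη := h.continuous
  have hη1 : ContDiff ℝ 1 η := h.contDiff.of_le (by simp)
  have hdη := continuous_partialDeriv hη1 j
  have hTc := hT.continuous
  have hint1 := integrable_cylMeasure (G := fun c : ℝ × Space d =>
    η c.2 * partialDeriv j T (x - R • c.2 - c.1 • x)) (by fun_prop) 1
  have hint2 := integrable_cylMeasure (G := fun c : ℝ × Space d =>
    partialDeriv j η c.2 * T (x - R • c.2 - c.1 • x)) (by fun_prop) 1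
  rw [cylMeasure] at hint1 hint2 ⊢
  rw [integral_prod _ hint1, integral_prod _ hint2, ← integral_const_mul]
  congr 1
  ext s
  simp only
  rw [setIntegral_closedBall (fun y hy => by simp [h.eq_zero y hy]),
    setIntegral_closedBall (fun y hy => by simp [partialDeriv_eq_zero_of_one_lt h j y hy])]
  have hTs : ContDiff ℝ 1 (fun y : Space d => T ((x - s • x) + (-R) • y)) := by fun_prop
  have := integral_mul_partialDeriv hη1 hTs (Or.inl h.hasCompactSupport) j
  have e0 : ∀ y, x - R • y - s • x = (x - s • x) + (-R) • y := fun y => by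
    rw [neg_smul]; abel
  have e : ∀ y, partialDeriv j (fun y : Space d => T ((x - s • x) + (-R) • y)) y =
      -R * partialDeriv j T ((x - s • x) + (-R) • y) := fun y =>
    partialDeriv_comp_affine _ _ (hT.differentiable (by simp) _)
  simp_rw [e] at this
  simp_rw [e0]
  have h3 : ∫ y, η y * (-R * partialDeriv j T ((x - s • x) + (-R) • y)) =
      -R * ∫ y, η y * partialDeriv j T ((x - s • x) + (-R) • y) := by
    rw [← integral_const_mul]; congr 1; ext y; ring
  rw [h3] at this
  rw [eq_comm, inv_mul_eq_iff_eq_mul₀ hR.ne']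
  linarith

end

/-! ### Representation of the oscillation when the gradient is `f + div T` -/

section

variable {d : ℕ} {η Φ : Space d → ℝ}

/-- Since `x - R y - s x = (1-s)x - R y` with `|(1-s)x| ≤ 2R`, each slice falls under
`setLIntegral_sub_smul_le`. -/
theorem lintegral_cylMeasure_one_le {F : Space d → ℝ≥0∞} (hF : Measurable F) {R : ℝ} (hR : 0 < R)
    {x : Space d} (hx : ‖x‖ ≤ 2 * R) :
    ∫⁻ c, F (x - R • c.2 - c.1 • x) ∂(cylMeasure d 1) ≤
      (ENNReal.ofReal (R ^ d))⁻¹ * ∫⁻ z in Metric.closedBall 0 (3 * R), F z := by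
  have hm : Measurable fun c : ℝ × Space d => F (x - R • c.2 - c.1 • x) := hF.comp (by fun_prop)
  rw [cylMeasure, lintegral_prod _ hm.aemeasurable]
  calc _ ≤ ∫⁻ _ in Set.Ioc (0 : ℝ) 1,
        ((ENNReal.ofReal (R ^ d))⁻¹ * ∫⁻ z in Metric.closedBall 0 (3 * R), F z) := by
        refine setLIntegral_mono' measurableSet_Ioc fun s hs => ?_
        have h1 : ∀ y, x - R • y - s • x = (1 - s) • x - R • y := fun y => by
          rw [sub_smul, one_smul]; abel
        simp_rw [h1]
        refine setLIntegral_sub_smul_le hF hR ?_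
        rw [norm_smul, Real.norm_of_nonneg (by linarith [hs.2])]
        nlinarith [hs.1, norm_nonneg x]
    _ = _ := by simp

/-- The force is left as a first-order average. The divergence part is rewritten as second
derivatives of the potential of `χT`, so that the `L²` bound applies without any derivative falling
on `T`. -/
theorem sub_mollify_eq_sum (h : IsRadialKernel η Φ) {R : ℝ} (hR : 0 < R) {P : Space d → ℝ}
    (hP : ContDiff ℝ 1 P) {f : Fin d → Space d → ℝ} (hf : ∀ i, Continuous (f i))
    {T : Fin d → Fin d → Space d → ℝ} (hT : ∀ i j, ContDiff ℝ ∞ (T i j))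
    (hgrad : ∀ i x, partialDeriv i P x = f i x + ∑ j, partialDeriv j (T i j) x)
    {χ : Space d → ℝ} (hχ : ContDiff ℝ ∞ χ) (hχ1 : ∀ x, ‖x‖ < 4 * R → χ x = 1)
    {x : Space d} (hx : ‖x‖ ≤ 2 * R) :
    P x - mollify η R P x =
      ∑ i, ∫ c, η c.2 * (c.2 i * f i (x - c.1 • c.2)) ∂(cylMeasure d R) -
      ∑ i, ∑ j, truncPotential Φ R (partialDeriv i (partialDeriv j fun z => χ z * T i j z)) x := by
  have hη := h.continuous
  have one : (1 : WithTop ℕ∞) ≤ ((⊤ : ℕ∞) : WithTop ℕ∞) := by simp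
  have hTc := fun i j k => (contDiff_partialDeriv (hT i j) k).continuous
  have hχT := fun i j => hχ.mul (hT i j)
  have key : ∀ i j, truncPotential Φ R (partialDeriv i (partialDeriv j fun z => χ z * T i j z)) x =
      -∫ c, η c.2 * (c.2 i * partialDeriv j (T i j) (x - c.1 • c.2)) ∂(cylMeasure d R) := by
    intro i j
    rw [truncPotential_partialDeriv h ((contDiff_partialDeriv (hχT i j) j).of_le one)]
    congr 1
    refine integral_congr_ae ?_
    filter_upwards [ae_cylMeasure R] with c hc
    have hlt : ‖x - c.1 • c.2‖ < 4 * R := by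
      calc ‖x - c.1 • c.2‖ ≤ ‖x‖ + ‖c.1 • c.2‖ := norm_sub_le _ _
        _ ≤ 2 * R + R * 1 := by
          rw [norm_smul, Real.norm_of_nonneg hc.1]
          exact add_le_add hx (mul_le_mul hc.2.1 hc.2.2 (norm_nonneg _) hR.le)
        _ < 4 * R := by linarith
    rw [partialDeriv_congr (g := T i j)]
    filter_upwards [(isOpen_lt continuous_norm continuous_const).mem_nhds hlt] with z hz
    rw [hχ1 z hz, one_mul]
  simp_rw [key, Finset.sum_neg_distrib, sub_neg_eq_add]
  rw [sub_mollify_eq h hP x hR.le]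
  have i1 : ∀ i, Integrable (fun c : ℝ × Space d => η c.2 * (c.2 i * f i (x - c.1 • c.2)))
      (cylMeasure d R) := fun i => by
    have := hf i
    exact integrable_cylMeasure (by fun_prop) R
  have i2 : ∀ i j, Integrable (fun c : ℝ × Space d =>
      η c.2 * (c.2 i * partialDeriv j (T i j) (x - c.1 • c.2))) (cylMeasure d R) := fun i j => by
    have := hTc i j j
    exact integrable_cylMeasure (by fun_prop) R
  simp_rw [← fun i => integral_finsetSum _ (fun j (_ : j ∈ Finset.univ) => i2 i j)]
  rw [← integral_finsetSum _ (fun i _ => i1 i),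
    ← integral_finsetSum _ (fun i _ => integrable_finsetSum _ (fun j _ => i2 i j)),
    ← integral_add (integrable_finsetSum _ (fun i _ => i1 i))
      (integrable_finsetSum _ (fun i _ => integrable_finsetSum _ (fun j _ => i2 i j)))]
  congr 1; ext c
  simp_rw [hgrad, Finset.mul_sum, ← Finset.sum_add_distrib, mul_add, Finset.mul_sum]

/-- Both averages are taken at the fixed scale `R`, so here the derivative of `T` can simply be
moved to the kernel. -/
theorem mollify_sub_mollify_zero_eq_sum (h : IsRadialKernel η Φ) {R : ℝ} (hR : 0 < R)
    {P : Space d → ℝ} (hP : ContDiff ℝ 1 P) {f : Fin d → Space d → ℝ} (hf : ∀ i, Continuous (f i))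
    {T : Fin d → Fin d → Space d → ℝ} (hT : ∀ i j, ContDiff ℝ ∞ (T i j))
    (hgrad : ∀ i x, partialDeriv i P x = f i x + ∑ j, partialDeriv j (T i j) x) (x : Space d) :
    mollify η R P x - mollify η R P 0 =
      ∑ i, x i * ∫ c, η c.2 * f i (x - R • c.2 - c.1 • x) ∂(cylMeasure d 1) +
      ∑ i, ∑ j, x i * (R⁻¹ *
        ∫ c, partialDeriv j η c.2 * T i j (x - R • c.2 - c.1 • x) ∂(cylMeasure d 1)) := by
  have hη := h.continuous
  have one : (1 : WithTop ℕ∞) ≤ ((⊤ : ℕ∞) : WithTop ℕ∞) := by simp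
  have hTc := fun i j k => (contDiff_partialDeriv (hT i j) k).continuous
  simp_rw [← fun i j => integral_kernel_mul_partialDeriv h ((hT i j).of_le one) x hR j]
  rw [mollify_sub_mollify_zero_eq h hP]
  have i1 : ∀ i, Integrable (fun c : ℝ × Space d => x i * (η c.2 * f i (x - R • c.2 - c.1 • x)))
      (cylMeasure d 1) := fun i => by
    have := hf i
    exact integrable_cylMeasure (by fun_prop) 1
  have i2 : ∀ i j, Integrable (fun c : ℝ × Space d =>
      x i * (η c.2 * partialDeriv j (T i j) (x - R • c.2 - c.1 • x))) (cylMeasure d 1) :=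
    fun i j => by
      have := hTc i j j
      exact integrable_cylMeasure (by fun_prop) 1
  simp_rw [← integral_const_mul]
  simp_rw [← fun i => integral_finsetSum _ (fun j (_ : j ∈ Finset.univ) => i2 i j)]
  rw [← integral_finsetSum _ (fun i _ => i1 i),
    ← integral_finsetSum _ (fun i _ => integrable_finsetSum _ (fun j _ => i2 i j)),
    ← integral_add (integrable_finsetSum _ (fun i _ => i1 i))
      (integrable_finsetSum _ (fun i _ => integrable_finsetSum _ (fun j _ => i2 i j)))]
  congr 1; ext c
  simp_rw [hgrad, Finset.mul_sum, ← Finset.sum_add_distrib, mul_add, Finset.mul_sum]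
  refine Finset.sum_congr rfl fun i _ => ?_
  congr 1
  · ring
  · exact Finset.sum_congr rfl fun j _ => by ring

theorem enorm_le_ofReal {a K : ℝ} (h : |a| ≤ K) : ‖a‖ₑ ≤ ENNReal.ofReal K := by
  rw [Real.enorm_eq_ofReal_abs]; exact ENNReal.ofReal_le_ofReal h

theorem abs_coord_le (x : Space d) (i : Fin d) : |x i| ≤ ‖x‖ := by
  simpa using PiLp.norm_apply_le x i

/-- Triangle inequality through the average around `x`. The last two sums do not depend on `x`; the
factor `2` in the last one is `2R · R⁻¹`. -/
theorem enorm_sub_mollify_zero_le (h : IsRadialKernel η Φ) {K : ℝ} (hK : ∀ y, |η y| ≤ K)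
    (hK' : ∀ j y, |partialDeriv j η y| ≤ K) {R : ℝ} (hR : 0 < R)
    {P : Space d → ℝ} (hP : ContDiff ℝ 1 P) {f : Fin d → Space d → ℝ} (hf : ∀ i, Continuous (f i))
    {T : Fin d → Fin d → Space d → ℝ} (hT : ∀ i j, ContDiff ℝ ∞ (T i j))
    (hgrad : ∀ i x, partialDeriv i P x = f i x + ∑ j, partialDeriv j (T i j) x)
    {χ : Space d → ℝ} (hχ : ContDiff ℝ ∞ χ) (hχ1 : ∀ x, ‖x‖ < 4 * R → χ x = 1)
    {x : Space d} (hx : ‖x‖ ≤ 2 * R) :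
    ‖P x - mollify η R P 0‖ₑ ≤
      ∑ i, ENNReal.ofReal K * ∫⁻ c, ‖f i (x - c.1 • c.2)‖ₑ ∂(cylMeasure d R) +
      ∑ i, ∑ j, ‖truncPotential Φ R
        (partialDeriv i (partialDeriv j fun z => χ z * T i j z)) x‖ₑ +
      (∑ i, ENNReal.ofReal (2 * R) * (ENNReal.ofReal K * ((ENNReal.ofReal (R ^ d))⁻¹ *
        ∫⁻ z in Metric.closedBall 0 (3 * R), ‖f i z‖ₑ)) +
      ∑ i, ∑ j, 2 * (ENNReal.ofReal K * ((ENNReal.ofReal (R ^ d))⁻¹ *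
        ∫⁻ z in Metric.closedBall 0 (3 * R), ‖T i j z‖ₑ))) := by
  have e : P x - mollify η R P 0 =
      (P x - mollify η R P x) + (mollify η R P x - mollify η R P 0) := by ring
  rw [e, sub_mollify_eq_sum h hR hP hf hT hgrad hχ hχ1 hx,
    mollify_sub_mollify_zero_eq_sum h hR hP hf hT hgrad x]
  have hxi : ∀ i, ‖x i‖ₑ ≤ ENNReal.ofReal (2 * R) := fun i =>
    enorm_le_ofReal ((abs_coord_le x i).trans hx)
  refine (enorm_add_le _ _).trans (add_le_add (enorm_sub_le.trans (add_le_add ?_ ?_))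
    ((enorm_add_le _ _).trans (add_le_add ?_ ?_)))
  · refine (enorm_sum_le _ _).trans (Finset.sum_le_sum fun i _ => ?_)
    refine (enorm_integral_le_lintegral_enorm _).trans ?_
    have := (hf i).measurable
    rw [← lintegral_const_mul _ (Measurable.enorm (by fun_prop))]
    refine lintegral_mono_ae ?_
    filter_upwards [ae_cylMeasure R] with c hc
    rw [enorm_mul, enorm_mul]
    have h1 : ‖c.2 i‖ₑ ≤ 1 := by
      simpa using enorm_le_ofReal ((abs_coord_le c.2 i).trans hc.2.2)
    exact mul_le_mul' (enorm_le_ofReal (hK _)) (mul_le_of_le_one_left' h1)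
  · exact (enorm_sum_le _ _).trans (Finset.sum_le_sum fun i _ => enorm_sum_le _ _)
  · refine (enorm_sum_le _ _).trans (Finset.sum_le_sum fun i _ => ?_)
    rw [enorm_mul]
    have := (hf i).measurable
    refine mul_le_mul' (hxi i) ((enorm_integral_le_lintegral_enorm _).trans ?_)
    refine le_trans ?_ (mul_le_mul' le_rfl
      (lintegral_cylMeasure_one_le (F := fun z => ‖f i z‖ₑ) (by fun_prop) hR hx))
    rw [← lintegral_const_mul _ (Measurable.enorm (by fun_prop))]
    refine lintegral_mono fun c => ?_
    rw [enorm_mul]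
    exact mul_le_mul' (enorm_le_ofReal (hK _)) le_rfl
  · refine (enorm_sum_le _ _).trans (Finset.sum_le_sum fun i _ =>
      (enorm_sum_le _ _).trans (Finset.sum_le_sum fun j _ => ?_))
    rw [enorm_mul, enorm_mul, ← mul_assoc]
    have := (hT i j).continuous.measurable
    refine mul_le_mul' ?_ ((enorm_integral_le_lintegral_enorm _).trans ?_)
    · calc ‖x i‖ₑ * ‖R⁻¹‖ₑ ≤ ENNReal.ofReal (2 * R) * ENNReal.ofReal R⁻¹ :=
            mul_le_mul' (hxi i) (enorm_le_ofReal (abs_of_pos (inv_pos.2 hR)).le)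
        _ = 2 := by
          rw [← ENNReal.ofReal_mul (by positivity), mul_assoc, mul_inv_cancel₀ hR.ne']; simp
    refine le_trans ?_ (mul_le_mul' le_rfl
      (lintegral_cylMeasure_one_le (F := fun z => ‖T i j z‖ₑ) (by fun_prop) hR hx))
    rw [← lintegral_const_mul _ (Measurable.enorm (by fun_prop))]
    refine lintegral_mono fun c => ?_
    rw [enorm_mul]
    exact mul_le_mul' (enorm_le_ofReal (hK' _ _)) le_rfl

end

/-! ### The oscillation estimate paired with a weight -/

section

variable {d : ℕ} {η Φ : Space d → ℝ}

/-- The `Lʳ` norm on the set `s` of a function with values in `[0, ∞]`. -/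
def setNorm (r : ℝ) (s : Set (Space d)) (F : Space d → ℝ≥0∞) : ℝ≥0∞ :=
  (∫⁻ x in s, F x ^ r) ^ (1 / r)

/-- The `L²` bound of the potential applied to `χT`, which is dominated by `T` and vanishes outside
the ball of radius `6R`; the factor `2` is `√4`. -/
theorem setNorm_truncPotential_le (h : IsRadialKernel η Φ) {R : ℝ} (hR : 0 < R)
    {χ T : Space d → ℝ} (hχ : ContDiff ℝ ∞ χ) (hc : HasCompactSupport χ)
    (hχ0 : ∀ x, 6 * R ≤ ‖x‖ → χ x = 0) (hχb : ∀ x, |χ x| ≤ 1) (hT : ContDiff ℝ ∞ T) (i j : Fin d)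
    (s : Set (Space d)) :
    setNorm 2 s (fun x => ‖truncPotential Φ R
      (partialDeriv i (partialDeriv j fun z => χ z * T z)) x‖ₑ) ≤
      2 * setNorm 2 (Metric.closedBall 0 (6 * R)) fun x => ‖T x‖ₑ := by
  have hs : HasCompactSupport fun z => χ z * T z := hc.mul_right
  obtain ⟨h1, h2, h3⟩ := integral_sq_truncPotential_le h hR.le (hχ.mul hT) hs i j
  have hcont : Continuous fun z => χ z * T z := (hχ.mul hT).continuous
  calc _ ≤ (∫⁻ x, ‖truncPotential Φ R
      (partialDeriv i (partialDeriv j fun z => χ z * T z)) x‖ₑ ^ (2 : ℝ)) ^ (1 / (2 : ℝ)) :=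
        ENNReal.rpow_le_rpow (setLIntegral_le_lintegral _ _) (by norm_num)
    _ ≤ (4 * ∫⁻ x, ‖χ x * T x‖ₑ ^ (2 : ℝ)) ^ (1 / (2 : ℝ)) := by
        refine ENNReal.rpow_le_rpow ?_ (by norm_num)
        rw [lintegral_enorm_sq_eq h1 h2, lintegral_enorm_sq_eq hcont hs,
          show (4 : ℝ≥0∞) = ENNReal.ofReal 4 by simp, ← ENNReal.ofReal_mul (by norm_num)]
        exact ENNReal.ofReal_le_ofReal h3
    _ ≤ (4 * ∫⁻ x in Metric.closedBall 0 (6 * R), ‖T x‖ₑ ^ (2 : ℝ)) ^ (1 / (2 : ℝ)) := by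
        refine ENNReal.rpow_le_rpow (mul_le_mul' le_rfl ?_) (by norm_num)
        rw [← lintegral_indicator measurableSet_closedBall]
        refine lintegral_mono fun x => ?_
        by_cases hx : ‖x‖ ≤ 6 * R
        · rw [Set.indicator_of_mem (by simpa using hx), enorm_mul]
          refine ENNReal.rpow_le_rpow (mul_le_of_le_one_left' ?_) (by norm_num)
          simpa using enorm_le_ofReal (hχb x)
        · simp [hχ0 x (not_le.1 hx).le]
    _ = _ := by
        rw [ENNReal.mul_rpow_of_nonneg _ _ (by norm_num), setNorm]
        congr 1
        rw [show (4 : ℝ≥0∞) = 2 ^ (2 : ℝ) by norm_num, ← ENNReal.rpow_mul]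
        norm_num

theorem setLIntegral_mul_le_setNorm {p q : ℝ} (hpq : p.HolderConjugate q) {s : Set (Space d)}
    {g f : Space d → ℝ≥0∞} (hg : Measurable g) (hf : Measurable f) :
    ∫⁻ x in s, g x * f x ≤ setNorm p s g * setNorm q s f :=
  ENNReal.lintegral_mul_le_Lp_mul_Lq _ hpq hg.aemeasurable hf.aemeasurable

theorem measurable_lintegral_cylMeasure {f : Space d → ℝ≥0∞} (hf : Measurable f) (R : ℝ) :
    Measurable fun x => ∫⁻ c, f (x - c.1 • c.2) ∂(cylMeasure d R) := by
  have hm : Measurable fun z : Space d × (ℝ × Space d) => f (z.1 - z.2.1 • z.2.2) :=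
    hf.comp (by fun_prop)
  exact hm.lintegral_prod_right'

theorem volume_closedBall_three_mul (R : ℝ) (hR : 0 < R) :
    (ENNReal.ofReal (R ^ d))⁻¹ * volume (Metric.closedBall (0 : Space d) (3 * R)) =
      3 ^ d * volume (Metric.closedBall (0 : Space d) 1) := by
  rw [Measure.addHaar_closedBall _ _ (by positivity : 0 ≤ 3 * R),
    Measure.addHaar_closedBall _ _ zero_le_one, finrank_euclideanSpace_fin, mul_pow, mul_comm (3 ^ d),
    ENNReal.ofReal_mul (by positivity), ← mul_assoc, ← mul_assoc, ENNReal.inv_mul_cancel]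
  · simp [ENNReal.ofReal_pow]
  · simpa using pow_pos hR d
  · simp

theorem sum_add_sum_le {ι : Type*} [Fintype ι] (u : ι → ℝ≥0∞) (w : ι → ι → ℝ≥0∞)
    (r a c : ℝ≥0∞) :
    ∑ i, a * (r * u i) + ∑ i, ∑ j, 2 * w i j +
      (∑ i, c * (r * u i) + ∑ i, ∑ j, c * w i j) ≤
      (a + 2 + c) * (r * ∑ i, u i + ∑ i, ∑ j, w i j) := by
  simp only [← Finset.mul_sum]
  calc _ = (a + c) * (r * ∑ i, u i) + (2 + c) * ∑ i, ∑ j, w i j := by ring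
    _ ≤ (a + 2 + c) * (r * ∑ i, u i) + (a + 2 + c) * ∑ i, ∑ j, w i j := by
      refine add_le_add (mul_le_mul' (add_le_add le_self_add le_rfl) le_rfl)
        (mul_le_mul' (add_le_add le_add_self le_rfl) le_rfl)
    _ = _ := by ring

/-- Local control of the oscillation of a function `P` whose gradient is `f + div T`, paired with
a nonnegative function `g`. -/
theorem exists_setLIntegral_mul_sub_mollify_le (h : IsRadialKernel η Φ) {p q : ℝ}
    (hpq : p.HolderConjugate q) :
    ∃ C : ℝ≥0∞, C ≠ ⊤ ∧ ∀ R : ℝ, 0 < R → ∀ P : Space d → ℝ, ContDiff ℝ 1 P →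
      ∀ f : Fin d → Space d → ℝ, (∀ i, Continuous (f i)) →
      ∀ T : Fin d → Fin d → Space d → ℝ, (∀ i j, ContDiff ℝ ∞ (T i j)) →
      (∀ i x, partialDeriv i P x = f i x + ∑ j, partialDeriv j (T i j) x) →
      ∀ g : Space d → ℝ≥0∞, Measurable g →
      ∫⁻ x in Metric.closedBall 0 (2 * R), g x * ‖P x - mollify η R P 0‖ₑ ≤
        C * (ENNReal.ofReal R * ∑ i, setNorm p (Metric.closedBall 0 (2 * R)) g *
            setNorm q (Metric.closedBall 0 (3 * R)) (fun x => ‖f i x‖ₑ) +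
          ∑ i, ∑ j, setNorm 2 (Metric.closedBall 0 (2 * R)) g *
            setNorm 2 (Metric.closedBall 0 (6 * R)) (fun x => ‖T i j x‖ₑ)) := by
  obtain ⟨K, hK0, hK, hK'⟩ := h.exists_bound_deriv
  set β := volume (Metric.closedBall (0 : Space d) 1) with hβ
  have hβt : β ≠ ⊤ := measure_closedBall_lt_top.ne
  set k := ENNReal.ofReal K with hk
  -- The three summands come from the average of `f` over the cylinder (of mass `Rβ`), from the `L²`
  -- bound of the potential, and from the terms independent of `x`.
  refine ⟨k * β + 2 + 2 * (k * (3 ^ d * β)), by finiteness, ?_⟩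
  intro R hR P hP f hf T hT hgrad g hg
  obtain ⟨χ, hχ, hχc, hχ1, hχ0, hχb⟩ := exists_cutoff (d := d) hR
  set A := Metric.closedBall (0 : Space d) (2 * R) with hA
  set B := Metric.closedBall (0 : Space d) (3 * R) with hB
  set D := Metric.closedBall (0 : Space d) (6 * R) with hD
  have hfm : ∀ i, Measurable fun x => ‖f i x‖ₑ := fun i => (hf i).measurable.enorm
  have hTm : ∀ i j, Measurable fun x => ‖T i j x‖ₑ := fun i j => (hT i j).continuous.measurable.enorm
  have hUm : ∀ i j, Measurable fun x => ‖truncPotential Φ R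
      (partialDeriv i (partialDeriv j fun z => χ z * T i j z)) x‖ₑ := fun i j =>
    (integral_sq_truncPotential_le h hR.le (hχ.mul (hT i j))
      hχc.mul_right i j).1.measurable.enorm
  have hV : volume A ≤ volume B := measure_mono (Metric.closedBall_subset_closedBall (by linarith))
  have hball : (ENNReal.ofReal (R ^ d))⁻¹ * volume B = 3 ^ d * β :=
    volume_closedBall_three_mul R hR
  -- For the terms independent of `x`, Hölder on both balls produces exactly one volume of order
  -- `Rᵈ`, which cancels `R⁻ᵈ`.
  have hlow : ∀ {a b : ℝ}, a.HolderConjugate b → ∀ {F : Space d → ℝ≥0∞}, Measurable F →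
      (∫⁻ x in A, g x) * (k * ((ENNReal.ofReal (R ^ d))⁻¹ * ∫⁻ z in B, F z)) ≤
        k * (3 ^ d * β) * (setNorm a A g * setNorm b B F) := by
    intro a b hab F hF
    calc _ = k * ((ENNReal.ofReal (R ^ d))⁻¹ * ((∫⁻ x in A, g x) * ∫⁻ z in B, F z)) := by ring
      _ ≤ k * ((ENNReal.ofReal (R ^ d))⁻¹ * (volume B * (setNorm a A g * setNorm b B F))) := by
        exact mul_le_mul' le_rfl (mul_le_mul' le_rfl
          (setLIntegral_mul_setLIntegral_le hab hV le_rfl hg hF))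
      _ = _ := by rw [← hball]; ring
  have htwo : (2 : ℝ).HolderConjugate 2 := .two_two
  have hm1 : ∀ i, Measurable fun x => g x * (k * ∫⁻ c, ‖f i (x - c.1 • c.2)‖ₑ ∂(cylMeasure d R)) :=
    fun i => hg.mul ((measurable_lintegral_cylMeasure (hfm i) R).const_mul k)
  have hm2 : ∀ i j, Measurable fun x => g x * ‖truncPotential Φ R
      (partialDeriv i (partialDeriv j fun z => χ z * T i j z)) x‖ₑ := fun i j => hg.mul (hUm i j)
  set κ := (∑ i, ENNReal.ofReal (2 * R) * (k * ((ENNReal.ofReal (R ^ d))⁻¹ *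
        ∫⁻ z in B, ‖f i z‖ₑ)) + ∑ i, ∑ j, 2 * (k * ((ENNReal.ofReal (R ^ d))⁻¹ *
        ∫⁻ z in B, ‖T i j z‖ₑ))) with hκ
  calc ∫⁻ x in A, g x * ‖P x - mollify η R P 0‖ₑ
      ≤ ∫⁻ x in A, (∑ i, g x * (k * ∫⁻ c, ‖f i (x - c.1 • c.2)‖ₑ ∂(cylMeasure d R)) +
          ∑ i, ∑ j, g x * ‖truncPotential Φ R
            (partialDeriv i (partialDeriv j fun z => χ z * T i j z)) x‖ₑ + g x * κ) := by
        refine setLIntegral_mono' measurableSet_closedBall fun x hx => ?_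
        have := enorm_sub_mollify_zero_le h hK hK' hR hP hf hT hgrad hχ hχ1
          (x := x) (by simpa [hA] using hx)
        refine (mul_le_mul' le_rfl this).trans_eq ?_
        simp only [mul_add, Finset.mul_sum, hκ, hk, hB]
    _ = ∑ i, (∫⁻ x in A, g x * (k * ∫⁻ c, ‖f i (x - c.1 • c.2)‖ₑ ∂(cylMeasure d R))) +
          ∑ i, ∑ j, (∫⁻ x in A, g x * ‖truncPotential Φ R
            (partialDeriv i (partialDeriv j fun z => χ z * T i j z)) x‖ₑ) +
          (∫⁻ x in A, g x) * κ := by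
        rw [lintegral_add_right _ (hg.mul_const κ), lintegral_add_right _
          (Finset.measurable_fun_sum _ fun i _ => Finset.measurable_fun_sum _ fun j _ => hm2 i j),
          lintegral_finsetSum _ (fun i _ => hm1 i), lintegral_finsetSum _
          (fun i _ => Finset.measurable_fun_sum _ fun j _ => hm2 i j), lintegral_mul_const _ hg]
        simp_rw [fun i => lintegral_finsetSum (μ := volume.restrict A) Finset.univ
          (fun j _ => hm2 i j)]
    _ ≤ ∑ i, k * β * (ENNReal.ofReal R * (setNorm p A g * setNorm q B fun x => ‖f i x‖ₑ)) +
          ∑ i, ∑ j, 2 * (setNorm 2 A g * setNorm 2 D fun x => ‖T i j x‖ₑ) +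
          (∑ i, 2 * (k * (3 ^ d * β)) *
            (ENNReal.ofReal R * (setNorm p A g * setNorm q B fun x => ‖f i x‖ₑ)) +
          ∑ i, ∑ j, 2 * (k * (3 ^ d * β)) * (setNorm 2 A g * setNorm 2 D fun x => ‖T i j x‖ₑ)) := by
        refine add_le_add (add_le_add ?_ ?_) ?_
        · refine Finset.sum_le_sum fun i _ => ?_
          calc _ = k * ∫⁻ x in A, g x * ∫⁻ c, ‖f i (x - c.1 • c.2)‖ₑ ∂(cylMeasure d R) := by
                rw [← lintegral_const_mul (f := fun x => g x * ∫⁻ c, ‖f i (x - c.1 • c.2)‖ₑ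
                  ∂(cylMeasure d R)) _ (hg.mul (measurable_lintegral_cylMeasure (hfm i) R))]
                exact lintegral_congr fun x => by ring
            _ ≤ k * (cylMeasure d R Set.univ * (setNorm p A g * setNorm q B fun x => ‖f i x‖ₑ)) :=
                mul_le_mul' le_rfl
                  (setLIntegral_mul_lintegral_cylMeasure_le hpq hR hg (hfm i))
            _ = _ := by rw [cylMeasure_univ]; ring
        · refine Finset.sum_le_sum fun i _ => Finset.sum_le_sum fun j _ => ?_
          calc _ ≤ setNorm 2 A g * setNorm 2 A (fun x => ‖truncPotential Φ R
              (partialDeriv i (partialDeriv j fun z => χ z * T i j z)) x‖ₑ) :=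
                setLIntegral_mul_le_setNorm htwo hg (hUm i j)
            _ ≤ setNorm 2 A g * (2 * setNorm 2 D fun x => ‖T i j x‖ₑ) :=
                mul_le_mul' le_rfl
                  (setNorm_truncPotential_le h hR hχ hχc hχ0 hχb (hT i j) i j A)
            _ = _ := by ring
        · rw [hκ, mul_add, Finset.mul_sum, Finset.mul_sum]
          simp_rw [Finset.mul_sum]
          refine add_le_add (Finset.sum_le_sum fun i _ => ?_)
            (Finset.sum_le_sum fun i _ => Finset.sum_le_sum fun j _ => ?_)
          · calc _ = ENNReal.ofReal (2 * R) * ((∫⁻ x in A, g x) *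
                  (k * ((ENNReal.ofReal (R ^ d))⁻¹ * ∫⁻ z in B, ‖f i z‖ₑ))) := by ring
              _ ≤ ENNReal.ofReal (2 * R) *
                  (k * (3 ^ d * β) * (setNorm p A g * setNorm q B fun x => ‖f i x‖ₑ)) :=
                mul_le_mul' le_rfl (hlow hpq (hfm i))
              _ = _ := by
                rw [ENNReal.ofReal_mul zero_le_two, ENNReal.ofReal_ofNat]; ring
          · calc _ = 2 * ((∫⁻ x in A, g x) *
                  (k * ((ENNReal.ofReal (R ^ d))⁻¹ * ∫⁻ z in B, ‖T i j z‖ₑ))) := by ring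
              _ ≤ 2 * (k * (3 ^ d * β) * (setNorm 2 A g * setNorm 2 B fun x => ‖T i j x‖ₑ)) :=
                mul_le_mul' le_rfl (hlow htwo (hTm i j))
              _ ≤ 2 * (k * (3 ^ d * β) * (setNorm 2 A g * setNorm 2 D fun x => ‖T i j x‖ₑ)) := by
                gcongr
                exact ENNReal.rpow_le_rpow (lintegral_mono_set
                  (Metric.closedBall_subset_closedBall (by linarith))) (by norm_num)
              _ = _ := by ring
    _ ≤ _ := sum_add_sum_le _ _ _ _ _

end

/-! ### The system in components and the weighted convective and pressure terms -/

section

variable {d : ℕ}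

/-- The stationary system in components: `u i` are the components of the velocity, `ρ` is the
density and `P` the pressure. -/
structure IsComponentSolution (γ mu lam : ℝ) (ρ P : Space d → ℝ) (u : Fin d → Space d → ℝ) :
    Prop where
  contDiff_density : ContDiff ℝ ∞ ρ
  contDiff_pressure : ContDiff ℝ 1 P
  contDiff_velocity : ∀ i, ContDiff ℝ ∞ (u i)
  continuity : ∀ x, ∑ j, (ρ x * partialDeriv j (u j) x + u j x * partialDeriv j ρ x) = 0
  pressure : ∀ x, ∑ j, u j x * partialDeriv j P x = -(γ * (P x * ∑ j, partialDeriv j (u j) x))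
  momentum : ∀ i x, ρ x * ∑ j, u j x * partialDeriv j (u i) x = -partialDeriv i P x +
    mu * ∑ j, partialDeriv j (partialDeriv j (u i)) x +
    (mu + lam) * partialDeriv i (fun y => ∑ j, partialDeriv j (u j) y) x

theorem integral_sum_partialDeriv_mul {w : Fin d → Space d → ℝ} {φ : Space d → ℝ}
    (hw : ∀ j, ContDiff ℝ 1 (w j)) (hφ : ContDiff ℝ 1 φ) (hc : HasCompactSupport φ) :
    ∫ x, (∑ j, partialDeriv j (w j) x) * φ x = -∫ x, ∑ j, w j x * partialDeriv j φ x := by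
  simp_rw [Finset.sum_mul]
  rw [integral_finsetSum, integral_finsetSum, ← Finset.sum_neg_distrib]
  · refine Finset.sum_congr rfl fun j _ => ?_
    rw [integral_mul_partialDeriv (hw j) hφ (Or.inr hc), neg_neg]
  · exact fun j _ => ((hw j).continuous.mul (continuous_partialDeriv hφ j)).integrable_of_hasCompactSupport
      (hasCompactSupport_partialDeriv hc j).mul_left
  · exact fun j _ => ((continuous_partialDeriv (hw j) j).mul hφ.continuous).integrable_of_hasCompactSupport
      hc.mul_left

section Truncation

variable (u : Fin d → Space d → ℝ) (ε : ℝ)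

/-- The squared speed `|v|²`. -/
def sqSpeed (x : Space d) : ℝ := ∑ i, u i x ^ 2

/-- The weight `(1 + ε |v|²)⁻²`. -/
def speedWeight (x : Space d) : ℝ := ((1 + ε * sqSpeed u x) ^ 2)⁻¹

/-- The primitive `|v|² / (1 + ε |v|²)` of the weight. -/
def speedPrimitive (x : Space d) : ℝ := sqSpeed u x * (1 + ε * sqSpeed u x)⁻¹

variable {u ε}

theorem sqSpeed_nonneg (x : Space d) : 0 ≤ sqSpeed u x := Finset.sum_nonneg fun _ _ => sq_nonneg _

theorem contDiff_sqSpeed (hu : ∀ i, ContDiff ℝ ∞ (u i)) : ContDiff ℝ ∞ (sqSpeed u) :=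
  ContDiff.sum fun i _ => (hu i).pow 2

theorem one_add_sqSpeed_pos (hε : 0 ≤ ε) (x : Space d) : 0 < 1 + ε * sqSpeed u x := by
  have := mul_nonneg hε (sqSpeed_nonneg (u := u) x); linarith

theorem contDiff_speedWeight (hu : ∀ i, ContDiff ℝ ∞ (u i)) (hε : 0 ≤ ε) :
    ContDiff ℝ ∞ (speedWeight u ε) :=
  ((contDiff_const.add (contDiff_const.mul (contDiff_sqSpeed hu))).pow 2).inv fun x =>
    (pow_pos (one_add_sqSpeed_pos hε x) 2).ne'

theorem contDiff_speedPrimitive (hu : ∀ i, ContDiff ℝ ∞ (u i)) (hε : 0 ≤ ε) :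
    ContDiff ℝ ∞ (speedPrimitive u ε) :=
  (contDiff_sqSpeed hu).mul ((contDiff_const.add (contDiff_const.mul (contDiff_sqSpeed hu))).inv
    fun x => (one_add_sqSpeed_pos hε x).ne')

theorem partialDeriv_sqSpeed (hu : ∀ i, ContDiff ℝ ∞ (u i)) (j : Fin d) (x : Space d) :
    partialDeriv j (sqSpeed u) x = 2 * ∑ i, u i x * partialDeriv j (u i) x := by
  have hd := fun i => (hu i).differentiable (by simp) x
  have h1 : ∀ i, partialDeriv j (fun y => u i y ^ 2) x = 2 * (u i x * partialDeriv j (u i) x) := by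
    intro i
    rw [partialDeriv_comp (h := fun t => t ^ 2) (by simpa using hasDerivAt_pow 2 (u i x)) (hd i)]
    ring
  change partialDeriv j (fun y => ∑ i, u i y ^ 2) x = _
  rw [partialDeriv_sum _ fun i _ => (hd i).fun_pow 2, Finset.mul_sum]
  exact Finset.sum_congr rfl fun i _ => h1 i

theorem partialDeriv_speedPrimitive (hu : ∀ i, ContDiff ℝ ∞ (u i)) (hε : 0 ≤ ε) (j : Fin d)
    (x : Space d) :
    partialDeriv j (speedPrimitive u ε) x = speedWeight u ε x * partialDeriv j (sqSpeed u) x := by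
  have hpos := one_add_sqSpeed_pos (u := u) hε x
  refine partialDeriv_comp (h := fun s => s * (1 + ε * s)⁻¹) ?_
    ((contDiff_sqSpeed hu).differentiable (by simp) x)
  have h1 : HasDerivAt (fun s : ℝ => 1 + ε * s) ε (sqSpeed u x) := by
    simpa using ((hasDerivAt_id _).const_mul ε).const_add 1
  refine ((hasDerivAt_id (sqSpeed u x)).mul (h1.inv hpos.ne')).congr_deriv ?_
  simp only [speedWeight, id, Pi.inv_apply]; field_simp; ring

theorem partialDeriv_speedWeight (hu : ∀ i, ContDiff ℝ ∞ (u i)) (hε : 0 ≤ ε) (j : Fin d)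
    (x : Space d) :
    partialDeriv j (speedWeight u ε) x =
      -(2 * ε * ((1 + ε * sqSpeed u x) ^ 3)⁻¹) * partialDeriv j (sqSpeed u) x := by
  have hpos := one_add_sqSpeed_pos (u := u) hε x
  refine partialDeriv_comp (h := fun s => ((1 + ε * s) ^ 2)⁻¹) ?_
    ((contDiff_sqSpeed hu).differentiable (by simp) x)
  have h1 : HasDerivAt (fun s : ℝ => 1 + ε * s) ε (sqSpeed u x) := by
    simpa using ((hasDerivAt_id _).const_mul ε).const_add 1
  refine ((h1.pow 2).inv (pow_pos hpos 2).ne').congr_deriv ?_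
  simp only [Pi.pow_apply]; field_simp; ring

end Truncation

variable {γ mu lam : ℝ} {ρ P : Space d → ℝ} {u : Fin d → Space d → ℝ}

namespace IsComponentSolution

/-- Writing `Θ` for the primitive of the weight `θ`, one has `θ ρ v·(v·∇v) = ½ ρ v·∇Θ(|v|²) = ½
div(Θ ρ v)`, because `ρv` is divergence-free. The derivative then falls on `φ` alone, never on the
weight. -/
theorem integral_convection (h : IsComponentSolution γ mu lam ρ P u) {ε : ℝ} (hε : 0 ≤ ε)
    {φ : Space d → ℝ} (hφ : ContDiff ℝ ∞ φ) (hc : HasCompactSupport φ) :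
    ∫ x, (∑ i, (ρ x * ∑ j, u j x * partialDeriv j (u i) x) * u i x) * (speedWeight u ε x * φ x) =
      -∫ x, 2⁻¹ * (ρ x * speedPrimitive u ε x * ∑ j, u j x * partialDeriv j φ x) := by
  have one : (1 : WithTop ℕ∞) ≤ ((⊤ : ℕ∞) : WithTop ℕ∞) := by simp
  have hS := contDiff_speedPrimitive h.contDiff_velocity hε
  have hw : ∀ j, ContDiff ℝ ∞ fun x => speedPrimitive u ε x * (ρ x * u j x) := fun j =>
    hS.mul (h.contDiff_density.mul (h.contDiff_velocity j))
  have key := integral_sum_partialDeriv_mul (fun j => (hw j).of_le one) (hφ.of_le one) hc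
  have hdiv : ∀ x, ∑ j, partialDeriv j (fun x => speedPrimitive u ε x * (ρ x * u j x)) x =
      2 * (speedWeight u ε x * ∑ i, (ρ x * ∑ j, u j x * partialDeriv j (u i) x) * u i x) := by
    intro x
    have dρ := h.contDiff_density.differentiable (by simp) x
    have du := fun j => (h.contDiff_velocity j).differentiable (by simp) x
    have dS := hS.differentiable (by simp) x
    have e1 : ∀ j, partialDeriv j (fun x => speedPrimitive u ε x * (ρ x * u j x)) x =
        speedPrimitive u ε x * (ρ x * partialDeriv j (u j) x + u j x * partialDeriv j ρ x) +
        2 * speedWeight u ε x * (∑ i, ρ x * (u j x * partialDeriv j (u i) x) * u i x) := by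
      intro j
      rw [partialDeriv_mul dS (dρ.fun_mul (du j)), partialDeriv_mul dρ (du j),
        partialDeriv_speedPrimitive h.contDiff_velocity hε,
        partialDeriv_sqSpeed h.contDiff_velocity]
      have : ∑ i, ρ x * (u j x * partialDeriv j (u i) x) * u i x =
          ρ x * u j x * ∑ i, u i x * partialDeriv j (u i) x := by
        rw [Finset.mul_sum]; exact Finset.sum_congr rfl fun i _ => by ring
      rw [this]; ring
    simp_rw [e1]
    rw [Finset.sum_add_distrib, ← Finset.mul_sum, h.continuity x, ← Finset.mul_sum,
      Finset.sum_comm]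
    simp_rw [← Finset.sum_mul, ← Finset.mul_sum]
    ring
  calc _ = 2⁻¹ * ∫ x, (∑ j, partialDeriv j (fun x => speedPrimitive u ε x * (ρ x * u j x)) x) *
        φ x := by
        rw [← integral_const_mul]; congr 1; ext x; rw [hdiv]; ring
    _ = _ := by
        rw [key, mul_neg, ← integral_const_mul]; congr 2; ext x
        simp_rw [Finset.mul_sum]
        exact Finset.sum_congr rfl fun i _ => by ring

/-- From `v·∇P = -γ P div v` follows `v·∇P = γ/(γ-1) div(Pv)`. As `ρv` is divergence-free, `cρ` is
subtracted at no cost; a suitable `c` later replaces `P` by its oscillation. -/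
theorem integral_pressure (h : IsComponentSolution γ mu lam ρ P u) (hγ : 1 < γ) (c : ℝ)
    {Ψ : Space d → ℝ} (hΨ : ContDiff ℝ ∞ Ψ) (hc : HasCompactSupport Ψ) :
    ∫ x, (∑ i, partialDeriv i P x * u i x) * Ψ x =
      -∫ x, γ / (γ - 1) * ((P x - c * ρ x) * ∑ j, u j x * partialDeriv j Ψ x) := by
  have one : (1 : WithTop ℕ∞) ≤ ((⊤ : ℕ∞) : WithTop ℕ∞) := by simp
  have hρ1 : ContDiff ℝ 1 ρ := h.contDiff_density.of_le one
  have hq : ContDiff ℝ 1 fun x => P x - c * ρ x := h.contDiff_pressure.sub (contDiff_const.mul hρ1)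
  have hw : ∀ j, ContDiff ℝ 1 fun x => (P x - c * ρ x) * u j x := fun j =>
    hq.mul ((h.contDiff_velocity j).of_le one)
  have key := integral_sum_partialDeriv_mul hw (hΨ.of_le one) hc
  have hγ' : γ - 1 ≠ 0 := by linarith
  have hdiv : ∀ x, ∑ i, partialDeriv i P x * u i x =
      γ / (γ - 1) * ∑ j, partialDeriv j (fun x => (P x - c * ρ x) * u j x) x := by
    intro x
    have dρ := h.contDiff_density.differentiable (by simp) x
    have dP := h.contDiff_pressure.differentiable (by simp) x
    have du := fun j => (h.contDiff_velocity j).differentiable (by simp) x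
    have e1 : ∀ j, partialDeriv j (fun x => (P x - c * ρ x) * u j x) x =
        P x * partialDeriv j (u j) x + u j x * partialDeriv j P x -
          c * (ρ x * partialDeriv j (u j) x + u j x * partialDeriv j ρ x) := by
      intro j
      rw [partialDeriv_mul (dP.fun_sub (dρ.const_mul c)) (du j), partialDeriv_sub dP (dρ.const_mul c),
        partialDeriv_const_mul c dρ]
      ring
    have hp := h.pressure x
    simp_rw [e1]
    rw [Finset.sum_sub_distrib, ← Finset.mul_sum (a := c), h.continuity x, Finset.sum_add_distrib,
      ← Finset.mul_sum, Finset.sum_congr rfl fun i _ => mul_comm (partialDeriv i P x) (u i x), hp]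
    field_simp
    ring
  calc _ = γ / (γ - 1) * ∫ x, (∑ j, partialDeriv j (fun x => (P x - c * ρ x) * u j x) x) * Ψ x := by
        rw [← integral_const_mul]; congr 1; ext x; rw [hdiv]; ring
    _ = _ := by
        rw [key, mul_neg, ← integral_const_mul]; congr 2; ext x
        simp_rw [Finset.mul_sum]
        exact Finset.sum_congr rfl fun i _ => by ring

end IsComponentSolution

theorem integral_laplacian_mul {u : Fin d → Space d → ℝ} (hu : ∀ i, ContDiff ℝ ∞ (u i))
    {Ψ : Space d → ℝ} (hΨ : ContDiff ℝ ∞ Ψ) (hc : HasCompactSupport Ψ) :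
    ∫ x, (∑ i, (∑ j, partialDeriv j (partialDeriv j (u i)) x) * u i x) * Ψ x =
      -∫ x, ((∑ i, ∑ j, partialDeriv j (u i) x ^ 2) * Ψ x +
        ∑ i, ∑ j, partialDeriv j (u i) x * u i x * partialDeriv j Ψ x) := by
  have one : (1 : WithTop ℕ∞) ≤ ((⊤ : ℕ∞) : WithTop ℕ∞) := by simp
  have hD := fun i j => contDiff_partialDeriv (hu i) j
  have hDD := fun i j => contDiff_partialDeriv (hD i j) j
  have hdΨ := fun j => contDiff_partialDeriv hΨ j
  have hcd := fun j => hasCompactSupport_partialDeriv hc j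
  have key := fun i => integral_sum_partialDeriv_mul (fun j => (hD i j).of_le one)
    (((hu i).mul hΨ).of_le one) hc.mul_left
  have e1 : ∀ i j x, partialDeriv j (fun y => u i y * Ψ y) x =
      u i x * partialDeriv j Ψ x + Ψ x * partialDeriv j (u i) x := fun i j x =>
    partialDeriv_mul ((hu i).differentiable (by simp) x) (hΨ.differentiable (by simp) x)
  have e2 : ∀ x, (∑ i, (∑ j, partialDeriv j (partialDeriv j (u i)) x) * u i x) * Ψ x =
      ∑ i, (∑ j, partialDeriv j (partialDeriv j (u i)) x) * (u i x * Ψ x) := fun x => by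
    rw [Finset.sum_mul]; exact Finset.sum_congr rfl fun i _ => by ring
  simp_rw [e2]
  rw [integral_finsetSum, Finset.sum_congr rfl fun i _ => key i, Finset.sum_neg_distrib,
    ← integral_finsetSum]
  · congr 2; ext x
    rw [Finset.sum_mul, ← Finset.sum_add_distrib]
    refine Finset.sum_congr rfl fun i _ => ?_
    rw [Finset.sum_mul, ← Finset.sum_add_distrib]
    refine Finset.sum_congr rfl fun j _ => ?_
    rw [e1]; ring
  · intro i _
    refine integrable_finsetSum _ fun j _ => ?_
    exact ((hD i j).continuous.mul (contDiff_partialDeriv ((hu i).mul hΨ)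
      j).continuous).integrable_of_hasCompactSupport
      (hasCompactSupport_partialDeriv (hc.mul_left (f := u i)) j).mul_left
  · intro i _
    refine Continuous.integrable_of_hasCompactSupport ?_ (hc.mul_left.mul_left)
    exact (continuous_finsetSum _ fun j _ => (hDD i j).continuous).mul
      ((hu i).mul hΨ).continuous

theorem integral_grad_mul {u : Fin d → Space d → ℝ} (hu : ∀ i, ContDiff ℝ ∞ (u i))
    {g Ψ : Space d → ℝ} (hg : ContDiff ℝ ∞ g) (hΨ : ContDiff ℝ ∞ Ψ) (hc : HasCompactSupport Ψ) :
    ∫ x, (∑ i, partialDeriv i g x * u i x) * Ψ x =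
      -∫ x, (g x * (∑ j, partialDeriv j (u j) x) * Ψ x +
        g x * ∑ j, u j x * partialDeriv j Ψ x) := by
  have one : (1 : WithTop ℕ∞) ≤ ((⊤ : ℕ∞) : WithTop ℕ∞) := by simp
  have hD := fun i => contDiff_partialDeriv hg i
  have key := fun i => integral_mul_partialDeriv (hg.of_le one) (((hu i).mul hΨ).of_le one)
    (Or.inr hc.mul_left) i
  have e1 : ∀ i x, partialDeriv i (fun y => u i y * Ψ y) x =
      u i x * partialDeriv i Ψ x + Ψ x * partialDeriv i (u i) x := fun i x =>
    partialDeriv_mul ((hu i).differentiable (by simp) x) (hΨ.differentiable (by simp) x)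
  have e2 : ∀ x, (∑ i, partialDeriv i g x * u i x) * Ψ x =
      ∑ i, partialDeriv i g x * (u i x * Ψ x) := fun x => by
    rw [Finset.sum_mul]; exact Finset.sum_congr rfl fun i _ => by ring
  simp_rw [e2]
  rw [integral_finsetSum, Finset.sum_congr rfl fun i _ => (neg_eq_iff_eq_neg.2 (key i)).symm,
    Finset.sum_neg_distrib, ← integral_finsetSum]
  · congr 2; ext x
    rw [Finset.mul_sum, Finset.mul_sum, Finset.sum_mul, ← Finset.sum_add_distrib]
    refine Finset.sum_congr rfl fun i _ => ?_
    rw [e1]; ring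
  · intro i _
    exact (hg.continuous.mul (contDiff_partialDeriv ((hu i).mul hΨ)
      i).continuous).integrable_of_hasCompactSupport
      (hasCompactSupport_partialDeriv (hc.mul_left (f := u i)) i).mul_left
  · intro i _
    exact ((hD i).continuous.mul ((hu i).mul hΨ).continuous).integrable_of_hasCompactSupport
      hc.mul_left.mul_left

end

/-! ### The local energy identity -/

section

variable {d : ℕ} {γ mu lam : ℝ} {ρ P : Space d → ℝ} {u : Fin d → Space d → ℝ}

/-- The density of viscous dissipation. -/
def dissipation (mu lam : ℝ) (u : Fin d → Space d → ℝ) (x : Space d) : ℝ :=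
  mu * ∑ i, ∑ j, partialDeriv j (u i) x ^ 2 + (mu + lam) * (∑ j, partialDeriv j (u j) x) ^ 2

/-- The work of the pressure `q` and of the viscous stress against the vector field `a`, in the
direction of the velocity. -/
def stressFlux (κ mu lam q : ℝ) (u : Fin d → Space d → ℝ) (a : Fin d → ℝ) (x : Space d) : ℝ :=
  κ * (q * ∑ j, u j x * a j) - mu * ∑ i, ∑ j, partialDeriv j (u i) x * u i x * a j -
    (mu + lam) * ((∑ j, partialDeriv j (u j) x) * ∑ j, u j x * a j)

/-- Linearity in the direction splits the flux against `∇(θφ) = θ∇φ + φ∇θ` into a boundary and an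
interior part. -/
theorem stressFlux_add_mul (κ q : ℝ) (a b : Fin d → ℝ) (s t : ℝ) (x : Space d) :
    stressFlux κ mu lam q u (fun j => s * a j + t * b j) x =
      s * stressFlux κ mu lam q u a x + t * stressFlux κ mu lam q u b x := by
  simp only [stressFlux, mul_add, Finset.sum_add_distrib]
  have e1 : ∀ (s : ℝ) (a : Fin d → ℝ), ∑ j, u j x * (s * a j) = s * ∑ j, u j x * a j := by
    intro s a; rw [Finset.mul_sum]; exact Finset.sum_congr rfl fun j _ => by ring
  have e2 : ∀ (s : ℝ) (a : Fin d → ℝ), ∑ i, ∑ j, partialDeriv j (u i) x * u i x * (s * a j) =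
      s * ∑ i, ∑ j, partialDeriv j (u i) x * u i x * a j := by
    intro s a; simp_rw [Finset.mul_sum]
    exact Finset.sum_congr rfl fun i _ => Finset.sum_congr rfl fun j _ => by ring
  simp only [e1, e2]
  ring

theorem abs_stressFlux_le {κ q : ℝ} (hκ : 0 ≤ κ) (hmu : 0 ≤ mu) {a : Fin d → ℝ} {β w N : ℝ}
    {x : Space d} (ha : ∀ j, |a j| ≤ β) (hw : ∀ j, |u j x| ≤ w)
    (hN : ∀ i j, |partialDeriv j (u i) x| ≤ N) (hw0 : 0 ≤ w) (hN0 : 0 ≤ N) :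
    |stressFlux κ mu lam q u a x| ≤ d * (w * β) * (κ * |q| + d * (mu + |mu + lam|) * N) := by
  have h1 : |∑ j, u j x * a j| ≤ d * (w * β) := by
    refine (Finset.abs_sum_le_sum_abs _ _).trans ((Finset.sum_le_card_nsmul _ _ (w * β) ?_).trans ?_)
    · intro j _; rw [abs_mul]; exact mul_le_mul (hw j) (ha j) (abs_nonneg _) hw0
    · simp
  have hβ : 0 ≤ d * (w * β) := (abs_nonneg _).trans h1
  have h2 : |∑ i, ∑ j, partialDeriv j (u i) x * u i x * a j| ≤ d * (d * (N * (w * β))) := by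
    refine (Finset.abs_sum_le_sum_abs _ _).trans
      ((Finset.sum_le_card_nsmul _ _ (d * (N * (w * β))) ?_).trans (by simp))
    intro i _
    refine (Finset.abs_sum_le_sum_abs _ _).trans
      ((Finset.sum_le_card_nsmul _ _ (N * (w * β)) ?_).trans (by simp))
    intro j _
    rw [mul_assoc, abs_mul, abs_mul]
    exact mul_le_mul (hN i j) (mul_le_mul (hw i) (ha j) (abs_nonneg _) hw0) (by positivity) hN0
  have h3 : |∑ j, partialDeriv j (u j) x| ≤ d * N := by
    refine (Finset.abs_sum_le_sum_abs _ _).trans ((Finset.sum_le_card_nsmul _ _ N ?_).trans (by simp))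
    intro j _; exact hN j j
  have t1 : |κ * (q * ∑ j, u j x * a j)| ≤ κ * (|q| * (d * (w * β))) := by
    rw [abs_mul, abs_mul, abs_of_nonneg hκ]; gcongr
  have t2 : |mu * ∑ i, ∑ j, partialDeriv j (u i) x * u i x * a j| ≤
      mu * (d * (d * (N * (w * β)))) := by
    rw [abs_mul, abs_of_nonneg hmu]; gcongr
  have t3 : |(mu + lam) * ((∑ j, partialDeriv j (u j) x) * ∑ j, u j x * a j)| ≤
      |mu + lam| * ((d * N) * (d * (w * β))) := by
    rw [abs_mul, abs_mul]; gcongr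
  rw [stressFlux]
  calc _ ≤ κ * (|q| * (d * (w * β))) + mu * (d * (d * (N * (w * β)))) +
        |mu + lam| * ((d * N) * (d * (w * β))) :=
        (abs_sub _ _).trans (add_le_add ((abs_sub _ _).trans (add_le_add t1 t2)) t3)
    _ = _ := by ring

theorem abs_dissipation_le (hmu : 0 ≤ mu) {N : ℝ} {x : Space d}
    (hN : ∀ i j, |partialDeriv j (u i) x| ≤ N) :
    |dissipation mu lam u x| ≤ d ^ 2 * (mu + |mu + lam|) * N ^ 2 := by
  have h3 : |∑ j, partialDeriv j (u j) x| ≤ d * N := by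
    refine (Finset.abs_sum_le_sum_abs _ _).trans ((Finset.sum_le_card_nsmul _ _ N ?_).trans (by simp))
    intro j _; exact hN j j
  have h2 : |∑ i, ∑ j, partialDeriv j (u i) x ^ 2| ≤ d * (d * N ^ 2) := by
    refine (Finset.abs_sum_le_sum_abs _ _).trans
      ((Finset.sum_le_card_nsmul _ _ (d * N ^ 2) ?_).trans (by simp))
    intro i _
    refine (Finset.abs_sum_le_sum_abs _ _).trans
      ((Finset.sum_le_card_nsmul _ _ (N ^ 2) ?_).trans (by simp))
    intro j _
    rw [abs_pow]
    exact pow_le_pow_left₀ (abs_nonneg _) (hN i j) 2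
  rw [dissipation]
  calc _ ≤ mu * (d * (d * N ^ 2)) + |mu + lam| * (d * N) ^ 2 := by
        refine (abs_add_le _ _).trans (add_le_add ?_ ?_)
        · rw [abs_mul, abs_of_nonneg hmu]; gcongr
        · rw [abs_mul, abs_pow]; gcongr
    _ = _ := by ring

theorem continuous_dissipation (hu : ∀ i, ContDiff ℝ ∞ (u i)) :
    Continuous (dissipation mu lam u) := by
  have := fun i j => (contDiff_partialDeriv (hu i) j).continuous
  unfold dissipation
  fun_prop

theorem continuous_stressFlux (hu : ∀ i, ContDiff ℝ ∞ (u i)) (κ : ℝ) {q : Space d → ℝ}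
    (hq : Continuous q) {a : Fin d → Space d → ℝ} (ha : ∀ j, Continuous (a j)) :
    Continuous fun x => stressFlux κ mu lam (q x) u (fun j => a j x) x := by
  have := fun i j => (contDiff_partialDeriv (hu i) j).continuous
  have := fun i => (hu i).continuous
  unfold stressFlux
  fun_prop

/-- The momentum equation tested with `θφv`, where `θ` is the speed weight. Each term is replaced by
its integrated form, all integrands being compactly supported. -/
theorem IsComponentSolution.energy_identity (h : IsComponentSolution γ mu lam ρ P u) (hγ : 1 < γ)
    {ε : ℝ} (hε : 0 ≤ ε) (c : ℝ) {φ : Space d → ℝ} (hφ : ContDiff ℝ ∞ φ)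
    (hc : HasCompactSupport φ) :
    ∫ x, dissipation mu lam u x * (speedWeight u ε x * φ x) =
      ∫ x, (2⁻¹ * (ρ x * speedPrimitive u ε x * ∑ j, u j x * partialDeriv j φ x) +
        stressFlux (γ / (γ - 1)) mu lam (P x - c * ρ x) u
          (fun j => partialDeriv j (fun y => speedWeight u ε y * φ y) x) x) := by
  have hu := h.contDiff_velocity
  have hΨ : ContDiff ℝ ∞ fun y => speedWeight u ε y * φ y :=
    (contDiff_speedWeight hu hε).mul hφ
  have hcΨ : HasCompactSupport fun y => speedWeight u ε y * φ y := hc.mul_left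
  set Ψ := fun y => speedWeight u ε y * φ y with hΨdef
  have hdiv : ContDiff ℝ ∞ fun y => ∑ j, partialDeriv j (u j) y :=
    ContDiff.sum fun j _ => contDiff_partialDeriv (hu j) j
  have a1 := h.integral_convection hε hφ hc
  have a2 := h.integral_pressure hγ c hΨ hcΨ
  have a3 := integral_laplacian_mul hu hΨ hcΨ
  have a4 := integral_grad_mul hu hdiv hΨ hcΨ
  have cu := fun i => (hu i).continuous
  have cD := fun i j => (contDiff_partialDeriv (hu i) j).continuous
  have cDD := fun i j => (contDiff_partialDeriv (contDiff_partialDeriv (hu i) j) j).continuous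
  have cP := h.contDiff_pressure.continuous
  have cρ := h.contDiff_density.continuous
  have cdP := fun i => continuous_partialDeriv h.contDiff_pressure i
  have cdd := fun i => (contDiff_partialDeriv hdiv i).continuous
  have cφ := hφ.continuous
  have cΨ := hΨ.continuous
  have cdφ := fun i => (contDiff_partialDeriv hφ i).continuous
  have cdΨ := fun i => (contDiff_partialDeriv hΨ i).continuous
  have cS := (contDiff_speedPrimitive hu hε).continuous
  have scΨ : ∀ g : Space d → ℝ, Continuous g → Integrable fun x => g x * Ψ x := fun g hg =>
    (hg.mul cΨ).integrable_of_hasCompactSupport hcΨ.mul_left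
  have scd : ∀ g : Fin d → Space d → ℝ, (∀ j, Continuous (g j)) → ∀ ξ : Space d → ℝ,
      ContDiff ℝ ∞ ξ → HasCompactSupport ξ → Integrable fun x => ∑ j, g j x * partialDeriv j ξ x :=
    fun g hg ξ hξ hcξ => integrable_finsetSum _ fun j _ =>
      ((hg j).mul (contDiff_partialDeriv hξ j).continuous).integrable_of_hasCompactSupport
        (hasCompactSupport_partialDeriv hcξ j).mul_left
  have hmom : ∫ x, (∑ i, (ρ x * ∑ j, u j x * partialDeriv j (u i) x) * u i x) * Ψ x =
      -(∫ x, (∑ i, partialDeriv i P x * u i x) * Ψ x) +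
      mu * (∫ x, (∑ i, (∑ j, partialDeriv j (partialDeriv j (u i)) x) * u i x) * Ψ x) +
      (mu + lam) * ∫ x, (∑ i, partialDeriv i (fun y => ∑ j, partialDeriv j (u j) y) x * u i x) *
        Ψ x := by
    rw [← integral_neg, ← integral_const_mul, ← integral_const_mul, ← integral_add,
      ← integral_add]
    · congr 1; ext x
      have : ∑ i, (ρ x * ∑ j, u j x * partialDeriv j (u i) x) * u i x =
          -(∑ i, partialDeriv i P x * u i x) +
          mu * (∑ i, (∑ j, partialDeriv j (partialDeriv j (u i)) x) * u i x) +
          (mu + lam) * ∑ i, partialDeriv i (fun y => ∑ j, partialDeriv j (u j) y) x * u i x := by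
        rw [Finset.mul_sum, Finset.mul_sum, ← Finset.sum_neg_distrib, ← Finset.sum_add_distrib,
          ← Finset.sum_add_distrib]
        refine Finset.sum_congr rfl fun i _ => ?_
        rw [h.momentum]; ring
      rw [this]; ring
    · exact (scΨ _ (by fun_prop)).neg.add ((scΨ _ (by fun_prop)).const_mul _)
    · exact (scΨ _ (by fun_prop)).const_mul _
    · exact (scΨ _ (by fun_prop)).neg
    · exact (scΨ _ (by fun_prop)).const_mul _
  rw [a1, a2, a3, a4] at hmom
  have i1 : Integrable fun x => (∑ i, ∑ j, partialDeriv j (u i) x ^ 2) * Ψ x :=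
    scΨ _ (by fun_prop)
  have i2 : Integrable fun x => ∑ i, ∑ j, partialDeriv j (u i) x * u i x * partialDeriv j Ψ x :=
    integrable_finsetSum _ fun i _ => scd (fun j x => partialDeriv j (u i) x * u i x)
      (fun j => (cD i j).mul (cu i)) Ψ hΨ hcΨ
  have i3 : Integrable fun x => (∑ j, partialDeriv j (u j) x) * (∑ j, partialDeriv j (u j) x) * Ψ x :=
    scΨ _ (by fun_prop)
  have hdu : ∀ (q : Space d → ℝ), Continuous q → ∀ ξ : Space d → ℝ, ContDiff ℝ ∞ ξ →
      HasCompactSupport ξ → Integrable fun x => q x * ∑ j, u j x * partialDeriv j ξ x := by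
    intro q hq ξ hξ hcξ
    refine (scd (fun j x => q x * u j x) (fun j => hq.mul (cu j)) ξ hξ hcξ).congr
      (Eventually.of_forall fun x => ?_)
    simp only [Finset.mul_sum, mul_assoc]
  have i4 := hdu (fun x => ∑ j, partialDeriv j (u j) x) (by fun_prop) Ψ hΨ hcΨ
  have i5 := hdu (fun x => P x - c * ρ x) (by fun_prop) Ψ hΨ hcΨ
  have i6 := hdu (fun x => ρ x * speedPrimitive u ε x) (by fun_prop) φ hφ hc
  rw [integral_add i1 i2, integral_add i3 i4, integral_const_mul, integral_const_mul] at hmom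
  have e1 : ∫ x, dissipation mu lam u x * Ψ x =
      mu * (∫ x, (∑ i, ∑ j, partialDeriv j (u i) x ^ 2) * Ψ x) +
      (mu + lam) * ∫ x, (∑ j, partialDeriv j (u j) x) * (∑ j, partialDeriv j (u j) x) * Ψ x := by
    rw [← integral_const_mul, ← integral_const_mul, ← integral_add (i1.const_mul _)
      (i3.const_mul _)]
    congr 1; ext x; rw [dissipation]; ring
  have e2 : ∫ x, (2⁻¹ * (ρ x * speedPrimitive u ε x * ∑ j, u j x * partialDeriv j φ x) +
        stressFlux (γ / (γ - 1)) mu lam (P x - c * ρ x) u (fun j => partialDeriv j Ψ x) x) =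
      2⁻¹ * (∫ x, ρ x * speedPrimitive u ε x * ∑ j, u j x * partialDeriv j φ x) +
      (γ / (γ - 1) * (∫ x, (P x - c * ρ x) * ∑ j, u j x * partialDeriv j Ψ x) -
      mu * (∫ x, ∑ i, ∑ j, partialDeriv j (u i) x * u i x * partialDeriv j Ψ x) -
      (mu + lam) * ∫ x, (∑ j, partialDeriv j (u j) x) * ∑ j, u j x * partialDeriv j Ψ x) := by
    simp only [stressFlux]
    have j1 : Integrable fun x => γ / (γ - 1) * ((P x - c * ρ x) * ∑ j, u j x * partialDeriv j Ψ x) -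
        mu * ∑ i, ∑ j, partialDeriv j (u i) x * u i x * partialDeriv j Ψ x :=
      (i5.const_mul _).sub (i2.const_mul _)
    have j2 : Integrable fun x => γ / (γ - 1) * ((P x - c * ρ x) * ∑ j, u j x * partialDeriv j Ψ x) -
        mu * (∑ i, ∑ j, partialDeriv j (u i) x * u i x * partialDeriv j Ψ x) -
        (mu + lam) * ((∑ j, partialDeriv j (u j) x) * ∑ j, u j x * partialDeriv j Ψ x) :=
      j1.sub (i4.const_mul _)
    rw [integral_add (i6.const_mul _) j2, integral_sub j1 (i4.const_mul _),
      integral_sub (i5.const_mul _) (i2.const_mul _)]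
    simp only [integral_const_mul]
  rw [e1, e2]
  linarith

end

/-! ### Cutoffs and the energy inequality on the whole space -/

section

variable {d : ℕ} {γ mu lam : ℝ} {ρ P : Space d → ℝ} {u : Fin d → Space d → ℝ}

/-- The closed annulus `R ≤ |x| ≤ 2 R`. -/
def annulus (d : ℕ) (R : ℝ) : Set (Space d) := {x | R ≤ ‖x‖ ∧ ‖x‖ ≤ 2 * R}

theorem measurableSet_annulus (R : ℝ) : MeasurableSet (annulus d R) :=
  ((isClosed_le continuous_const continuous_norm).inter
    (isClosed_le continuous_norm continuous_const)).measurableSet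

/-- `φ` is a smooth cutoff between the balls of radius `R` and `2 R`, with derivatives bounded by
`C / R`. -/
structure IsCutoff (C R : ℝ) (φ : Space d → ℝ) : Prop where
  contDiff : ContDiff ℝ ∞ φ
  hasCompactSupport : HasCompactSupport φ
  nonneg : ∀ x, 0 ≤ φ x
  le_one : ∀ x, φ x ≤ 1
  eq_one : ∀ x, ‖x‖ ≤ R → φ x = 1
  abs_partialDeriv_le : ∀ j x, |partialDeriv j φ x| ≤ (annulus d R).indicator (fun _ => C * R⁻¹) x

theorem exists_isCutoff (d : ℕ) :
    ∃ C : ℝ, 0 ≤ C ∧ ∀ R : ℝ, 0 < R → ∃ φ : Space d → ℝ, IsCutoff C R φ := by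
  let b : ContDiffBump (0 : Space d) := ⟨1, 2, by norm_num, by norm_num⟩
  have hb : ContDiff ℝ ∞ b := b.contDiff
  obtain ⟨C, hC⟩ := (b.hasCompactSupport.fderiv (𝕜 := ℝ)).exists_bound_of_continuous
    (hb.continuous_fderiv (by simp))
  have hC0 : 0 ≤ C := (norm_nonneg _).trans (hC 0)
  refine ⟨C, hC0, fun R hR => ⟨fun x => b (0 + R⁻¹ • x), ?_⟩⟩
  have hnorm : ∀ x : Space d, ‖R⁻¹ • x‖ = R⁻¹ * ‖x‖ := fun x => by
    rw [norm_smul, Real.norm_of_nonneg (by positivity)]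
  have hout : ∀ x, 2 * R ≤ ‖x‖ → b (0 + R⁻¹ • x) = 0 := fun x hx => by
    apply b.zero_of_le_dist
    rw [zero_add, dist_zero_right, hnorm, le_inv_mul_iff₀ hR]
    simpa [b, mul_comm] using hx
  have hin : ∀ x, ‖x‖ ≤ R → b (0 + R⁻¹ • x) = 1 := fun x hx => by
    apply b.one_of_mem_closedBall
    rw [zero_add, mem_closedBall_zero_iff, hnorm, inv_mul_le_iff₀ hR]
    simpa [b] using hx
  refine ⟨hb.comp (by fun_prop), hasCompactSupport_of_eq_zero (2 * R) fun x hx => hout x hx.le,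
    fun x => b.nonneg, fun x => b.le_one, hin, fun j x => ?_⟩
  by_cases hx : x ∈ annulus d R
  · rw [Set.indicator_of_mem hx, partialDeriv_comp_affine 0 R⁻¹ (hb.differentiable (by simp) _),
      abs_mul, abs_of_pos (inv_pos.2 hR), mul_comm]
    exact mul_le_mul_of_nonneg_right ((abs_partialDeriv_le _ _ _).trans (hC _)) (by positivity)
  · rw [Set.indicator_of_notMem hx]
    have hcases : ‖x‖ < R ∨ 2 * R < ‖x‖ := by
      by_contra! hcon
      exact hx ⟨hcon.1, hcon.2⟩
    have h0 : partialDeriv j (fun x => b (0 + R⁻¹ • x)) x = 0 := by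
      rcases hcases with hlt | hlt
      · rw [partialDeriv_congr (g := fun _ => 1)]
        · simp [partialDeriv]
        · filter_upwards [(isOpen_lt continuous_norm continuous_const).mem_nhds hlt] with z hz
          exact hin z (le_of_lt hz)
      · rw [partialDeriv_congr (g := fun _ => 0)]
        · simp [partialDeriv]
        · filter_upwards [(isOpen_lt continuous_const continuous_norm).mem_nhds hlt] with z hz
          exact hout z (le_of_lt hz)
    rw [h0, abs_zero]

theorem tendsto_integral_zero_of_enorm_le {f : ℕ → Space d → ℝ} {b : ℕ → ℝ≥0∞}
    (h : ∀ n, ∫⁻ x, ‖f n x‖ₑ ≤ b n) (hb : Tendsto b atTop (𝓝 0)) :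
    Tendsto (fun n => ∫ x, f n x) atTop (𝓝 0) := by
  rw [tendsto_zero_iff_norm_tendsto_zero]
  have h1 : Tendsto (fun n => ‖∫ x, f n x‖ₑ) atTop (𝓝 0) :=
    tendsto_of_tendsto_of_tendsto_of_le_of_le tendsto_const_nhds hb (fun _ => zero_le)
      fun n => (enorm_integral_le_lintegral_enorm _).trans (h n)
  have h2 := (ENNReal.tendsto_toReal (by simp)).comp h1
  simpa [Function.comp_def] using h2

theorem tendsto_integral_mul_cutoff {C : ℝ} {R : ℕ → ℝ} (hR : Tendsto R atTop atTop)
    {φ : ℕ → Space d → ℝ} (hφ : ∀ n, IsCutoff C (R n) (φ n)) {f : Space d → ℝ}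
    (hf : Integrable f) : Tendsto (fun n => ∫ x, f x * φ n x) atTop (𝓝 (∫ x, f x)) := by
  refine tendsto_integral_of_dominated_convergence (fun x => ‖f x‖)
    (fun n => hf.1.mul (hφ n).contDiff.continuous.aestronglyMeasurable) hf.norm
    (fun n => Eventually.of_forall fun x => ?_) (Eventually.of_forall fun x => ?_)
  · rw [norm_mul, Real.norm_of_nonneg ((hφ n).nonneg x)]
    exact mul_le_of_le_one_right (norm_nonneg _) ((hφ n).le_one x)
  · refine tendsto_const_nhds.congr' ?_
    filter_upwards [hR.eventually_ge_atTop ‖x‖] with n hn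
    rw [(hφ n).eq_one x hn, mul_one]

/-- The function controlling the error produced by the derivative of the weight. -/
def weightError (u : Fin d → Space d → ℝ) (ε : ℝ) (x : Space d) : ℝ :=
  ε * sqSpeed u x * ((1 + ε * sqSpeed u x) ^ 3)⁻¹

theorem speedWeight_nonneg {ε : ℝ} (x : Space d) : 0 ≤ speedWeight u ε x := by
  rw [speedWeight]; positivity

theorem speedWeight_le_one {ε : ℝ} (hε : 0 ≤ ε) (x : Space d) : speedWeight u ε x ≤ 1 := by
  have := mul_nonneg hε (sqSpeed_nonneg (u := u) x)
  exact inv_le_one_of_one_le₀ (one_le_pow₀ (by linarith))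

theorem speedPrimitive_nonneg {ε : ℝ} (hε : 0 ≤ ε) (x : Space d) : 0 ≤ speedPrimitive u ε x :=
  mul_nonneg (sqSpeed_nonneg x) (inv_nonneg.2 (one_add_sqSpeed_pos hε x).le)

theorem abs_partialDeriv_sqSpeed_le (hu : ∀ i, ContDiff ℝ ∞ (u i)) {w N : ℝ} {x : Space d}
    (hw : ∀ j, |u j x| ≤ w) (hN : ∀ i j, |partialDeriv j (u i) x| ≤ N) (hw0 : 0 ≤ w) (j : Fin d) :
    |partialDeriv j (sqSpeed u) x| ≤ 2 * (d * (w * N)) := by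
  rw [partialDeriv_sqSpeed hu, abs_mul, abs_two]
  refine mul_le_mul_of_nonneg_left ((Finset.abs_sum_le_sum_abs _ _).trans
      ((Finset.sum_le_card_nsmul _ _ (w * N) ?_).trans (by simp))) zero_le_two
  intro i _
  rw [abs_mul]; exact mul_le_mul (hw i) (hN i j) (abs_nonneg _) hw0

theorem abs_partialDeriv_speedWeight_le (hu : ∀ i, ContDiff ℝ ∞ (u i)) {ε : ℝ} (hε : 0 ≤ ε)
    {w N : ℝ} {x : Space d} (hw : ∀ j, |u j x| ≤ w) (hN : ∀ i j, |partialDeriv j (u i) x| ≤ N)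
    (hw0 : 0 ≤ w) (j : Fin d) :
    |partialDeriv j (speedWeight u ε) x| ≤
      2 * ε * ((1 + ε * sqSpeed u x) ^ 3)⁻¹ * (2 * (d * (w * N))) := by
  have hpos := one_add_sqSpeed_pos (u := u) hε x
  rw [partialDeriv_speedWeight hu hε, abs_mul, abs_neg, abs_of_nonneg (by positivity)]
  exact mul_le_mul_of_nonneg_left (abs_partialDeriv_sqSpeed_le hu hw hN hw0 j) (by positivity)

/-- The energy inequality on the whole space, when the boundary terms vanish at infinity. -/
theorem IsComponentSolution.weighted_energy_le (h : IsComponentSolution γ mu lam ρ P u)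
    (hγ : 1 < γ) (hmu : 0 ≤ mu) {ε : ℝ} (hε : 0 ≤ ε) {w N : Space d → ℝ}
    (hw0 : ∀ x, 0 ≤ w x) (hwS : ∀ x, w x ^ 2 = sqSpeed u x) (hwu : ∀ j x, |u j x| ≤ w x)
    (hwc : Continuous w) (hNc : Continuous N)
    (hN0 : ∀ x, 0 ≤ N x) (hN : ∀ i j x, |partialDeriv j (u i) x| ≤ N x)
    (hN2 : Integrable fun x => N x ^ 2) {M Q : ℝ} (hM : ∀ x, |ρ x| ≤ M)
    {R : ℕ → ℝ} (hR0 : ∀ n, 0 < R n) (hR : Tendsto R atTop atTop) {c : ℕ → ℝ}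
    (hQ : ∀ n x, |P x - c n * ρ x| ≤ Q)
    (hlim1 : Tendsto (fun n => ENNReal.ofReal (R n)⁻¹ *
      ∫⁻ x in annulus d (R n), ENNReal.ofReal (speedPrimitive u ε x * w x)) atTop (𝓝 0))
    (hlim2 : Tendsto (fun n => ENNReal.ofReal (R n)⁻¹ * ∫⁻ x in annulus d (R n),
      ENNReal.ofReal (w x * speedWeight u ε x * |P x - c n * ρ x|)) atTop (𝓝 0))
    (hlim3 : Tendsto (fun n => ENNReal.ofReal (R n)⁻¹ *
      ∫⁻ x in annulus d (R n), ENNReal.ofReal (N x * w x)) atTop (𝓝 0))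
    (hZ : Integrable fun x => N x * weightError u ε x *
      (γ / (γ - 1) * Q + d * (mu + |mu + lam|) * N x)) :
    ∫ x, dissipation mu lam u x * speedWeight u ε x ≤
      4 * d ^ 2 * ∫ x, N x * weightError u ε x *
        (γ / (γ - 1) * Q + d * (mu + |mu + lam|) * N x) := by
  obtain ⟨C, hC0, hC⟩ := exists_isCutoff d
  choose φ hφ using fun n => hC (R n) (hR0 n)
  set κ := γ / (γ - 1) with hκ
  have hκ0 : 0 ≤ κ := div_nonneg (by linarith) (by linarith)
  set M' := mu + |mu + lam| with hM'
  have hM'0 : 0 ≤ M' := by positivity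
  have hM0 : 0 ≤ M := (abs_nonneg _).trans (hM 0)
  have hu := h.contDiff_velocity
  have cth := (contDiff_speedWeight (u := u) hu hε).continuous
  have cTh := (contDiff_speedPrimitive (u := u) hu hε).continuous
  have cdth := fun j => (contDiff_partialDeriv (contDiff_speedWeight (u := u) hu hε) j).continuous
  have cu := fun i => (hu i).continuous
  have cρ := h.contDiff_density.continuous
  have cP := h.contDiff_pressure.continuous
  have cdφ := fun n j => (contDiff_partialDeriv (hφ n).contDiff j).continuous
  have cφ := fun n => (hφ n).contDiff.continuous
  have sdφ := fun n j => hasCompactSupport_partialDeriv (hφ n).hasCompactSupport j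
  -- `B` collects the terms where the derivative falls on the cutoff, supported in the annulus; `I`
  -- collects those where it falls on the weight.
  set B : ℕ → Space d → ℝ := fun n x =>
    2⁻¹ * (ρ x * speedPrimitive u ε x * ∑ j, u j x * partialDeriv j (φ n) x) +
      speedWeight u ε x *
        stressFlux κ mu lam (P x - c n * ρ x) u (fun j => partialDeriv j (φ n) x) x with hB
  set I : ℕ → Space d → ℝ := fun n x => φ n x *
    stressFlux κ mu lam (P x - c n * ρ x) u (fun j => partialDeriv j (speedWeight u ε) x) x with hI
  have hid : ∀ n, ∫ x, dissipation mu lam u x * (speedWeight u ε x * φ n x) =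
      ∫ x, (B n x + I n x) := by
    intro n
    rw [h.energy_identity hγ hε (c n) (hφ n).contDiff (hφ n).hasCompactSupport]
    congr 1; ext x
    have e : (fun j => partialDeriv j (fun y => speedWeight u ε y * φ n y) x) =
        fun j => speedWeight u ε x * partialDeriv j (φ n) x +
          φ n x * partialDeriv j (speedWeight u ε) x := by
      ext j
      exact partialDeriv_mul ((contDiff_speedWeight hu hε).differentiable (by simp) x)
        ((hφ n).contDiff.differentiable (by simp) x)
    rw [e, stressFlux_add_mul, hB, hI]
    ring
  have cB : ∀ n, Continuous (B n) := fun n => by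
    have := continuous_stressFlux (mu := mu) (lam := lam) hu κ (q := fun x => P x - c n * ρ x)
      (by fun_prop) (cdφ n)
    have := cdφ n
    fun_prop
  have cI : ∀ n, Continuous (I n) := fun n => by
    have := continuous_stressFlux (mu := mu) (lam := lam) hu κ (q := fun x => P x - c n * ρ x)
      (by fun_prop) cdth
    have := cφ n
    fun_prop
  have hBle : ∀ n x, |B n x| ≤ (annulus d (R n)).indicator (fun x => C * (R n)⁻¹ *
      (d * M * (speedPrimitive u ε x * w x) +
        d * κ * (w x * speedWeight u ε x * |P x - c n * ρ x|) + d ^ 2 * M' * (N x * w x))) x := by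
    intro n x
    have hRn := hR0 n
    set L := (annulus d (R n)).indicator (fun _ => C * (R n)⁻¹) x with hL
    have hL0 : 0 ≤ L := Set.indicator_nonneg (fun _ _ => by positivity) x
    have hdφ : ∀ j, |partialDeriv j (φ n) x| ≤ L := fun j => (hφ n).abs_partialDeriv_le j x
    have b1 : |∑ j, u j x * partialDeriv j (φ n) x| ≤ d * (w x * L) := by
      refine (Finset.abs_sum_le_sum_abs _ _).trans
        ((Finset.sum_le_card_nsmul _ _ (w x * L) ?_).trans (by simp))
      intro j _; rw [abs_mul]; exact mul_le_mul (hwu j x) (hdφ j) (abs_nonneg _) (hw0 x)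
    have b2 := abs_stressFlux_le (mu := mu) (lam := lam) (q := P x - c n * ρ x)
      (a := fun j => partialDeriv j (φ n) x) hκ0 hmu hdφ
      (fun j => hwu j x) (fun i j => hN i j x) (hw0 x) (hN0 x)
    have hTh := speedPrimitive_nonneg (u := u) hε x
    have hth := speedWeight_nonneg (u := u) (ε := ε) x
    have hth1 := speedWeight_le_one (u := u) hε x
    have hwx := hw0 x
    have hNx := hN0 x
    have t1 : |2⁻¹ * (ρ x * speedPrimitive u ε x * ∑ j, u j x * partialDeriv j (φ n) x)| ≤
        M * speedPrimitive u ε x * (d * (w x * L)) := by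
      rw [abs_mul, abs_mul, abs_mul, abs_of_nonneg hTh]
      refine (mul_le_of_le_one_left (by positivity) (by norm_num)).trans ?_
      gcongr
      exact hM x
    have t2 : |speedWeight u ε x *
        stressFlux κ mu lam (P x - c n * ρ x) u (fun j => partialDeriv j (φ n) x) x| ≤
        d * κ * (w x * speedWeight u ε x * |P x - c n * ρ x|) * L +
          d ^ 2 * M' * (N x * w x) * L := by
      rw [abs_mul, abs_of_nonneg hth]
      calc _ ≤ speedWeight u ε x * (d * (w x * L) * (κ * |P x - c n * ρ x|)) +
            speedWeight u ε x * (d * (w x * L) * (d * M' * N x)) := by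
            rw [← mul_add, ← mul_add]
            exact mul_le_mul_of_nonneg_left b2 hth
        -- The weight is discarded in the viscous term, but it is kept with the pressure, where it
        -- is needed in high dimension.
        _ ≤ speedWeight u ε x * (d * (w x * L) * (κ * |P x - c n * ρ x|)) +
            1 * (d * (w x * L) * (d * M' * N x)) := by gcongr
        _ = _ := by ring
    have : |B n x| ≤ L * (d * M * (speedPrimitive u ε x * w x) +
        d * κ * (w x * speedWeight u ε x * |P x - c n * ρ x|) + d ^ 2 * M' * (N x * w x)) := by
      refine (abs_add_le _ _).trans ((add_le_add t1 t2).trans_eq (by ring))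
    refine this.trans_eq ?_
    by_cases hx : x ∈ annulus d (R n) <;> simp [hL, hx]
  -- The gradient of the weight times `|v|` is at most `4 d ε |v|² (1+ε|v|²)⁻³ N`, that is `4d`
  -- times `weightError` times `N`; the sum over components gives one more `d`.
  have hIle : ∀ n x, |I n x| ≤ 4 * d ^ 2 * (N x * weightError u ε x * (κ * Q + d * M' * N x)) := by
    intro n x
    have hpos := one_add_sqSpeed_pos (u := u) hε x
    have hwx := hw0 x
    have hNx := hN0 x
    have hth' := abs_partialDeriv_speedWeight_le hu hε (fun j => hwu j x) (fun i j => hN i j x) hwx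
    have b2 := abs_stressFlux_le (mu := mu) (lam := lam) (q := P x - c n * ρ x)
      (a := fun j => partialDeriv j (speedWeight u ε) x) hκ0 hmu hth'
      (fun j => hwu j x) (fun i j => hN i j x) hwx hNx
    rw [hI, abs_mul, abs_of_nonneg ((hφ n).nonneg x)]
    refine (mul_le_of_le_one_left (abs_nonneg _) ((hφ n).le_one x)).trans (b2.trans ?_)
    calc _ ≤ d * (w x * (2 * ε * ((1 + ε * sqSpeed u x) ^ 3)⁻¹ * (2 * (d * (w x * N x))))) *
          (κ * Q + d * M' * N x) := by
          gcongr; exact hQ n x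
      _ = _ := by rw [weightError, ← hwS]; ring
  have iB : ∀ n, Integrable (B n) := fun n => by
    refine (cB n).integrable_of_hasCompactSupport (hasCompactSupport_of_eq_zero (2 * R n) ?_)
    intro x hx
    have := hBle n x
    rw [Set.indicator_of_notMem (fun hmem => absurd hmem.2 (not_le.2 hx))] at this
    exact abs_nonpos_iff.1 this
  have iI : ∀ n, Integrable (I n) := fun n =>
    (cI n).integrable_of_hasCompactSupport (hφ n).hasCompactSupport.mul_right
  have limB : Tendsto (fun n => ∫ x, B n x) atTop (𝓝 0) := by
    have hnn : ∀ x, 0 ≤ speedPrimitive u ε x * w x := fun x =>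
      mul_nonneg (speedPrimitive_nonneg hε x) (hw0 x)
    have hnn2 : ∀ n x, 0 ≤ w x * speedWeight u ε x * |P x - c n * ρ x| := fun n x =>
      mul_nonneg (mul_nonneg (hw0 x) (speedWeight_nonneg x)) (abs_nonneg _)
    have hnn3 : ∀ x, 0 ≤ N x * w x := fun x => mul_nonneg (hN0 x) (hw0 x)
    have lim := (((ENNReal.Tendsto.const_mul hlim1 (Or.inr (ENNReal.ofReal_ne_top (r := d * M)))).add
      (ENNReal.Tendsto.const_mul hlim2 (Or.inr (ENNReal.ofReal_ne_top (r := d * κ))))).add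
      (ENNReal.Tendsto.const_mul hlim3 (Or.inr (ENNReal.ofReal_ne_top (r := d ^ 2 * M')))))
    have lim' := ENNReal.Tendsto.const_mul lim (Or.inr (ENNReal.ofReal_ne_top (r := C)))
    simp only [mul_zero, add_zero] at lim'
    refine tendsto_integral_zero_of_enorm_le (fun n => ?_) lim'
    have hRn := hR0 n
    calc ∫⁻ x, ‖B n x‖ₑ ≤ ∫⁻ x in annulus d (R n), ENNReal.ofReal (C * (R n)⁻¹ *
      (d * M * (speedPrimitive u ε x * w x) +
        d * κ * (w x * speedWeight u ε x * |P x - c n * ρ x|) + d ^ 2 * M' * (N x * w x))) := by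
          rw [← lintegral_indicator (measurableSet_annulus _)]
          refine lintegral_mono fun x => ?_
          refine (enorm_le_ofReal (hBle n x)).trans_eq ?_
          by_cases hx : x ∈ annulus d (R n) <;> simp [hx]
      _ = ∫⁻ x in annulus d (R n), ENNReal.ofReal C * (ENNReal.ofReal (R n)⁻¹ *
          (ENNReal.ofReal (d * M) * ENNReal.ofReal (speedPrimitive u ε x * w x) +
          ENNReal.ofReal (d * κ) *
            ENNReal.ofReal (w x * speedWeight u ε x * |P x - c n * ρ x|) +
          ENNReal.ofReal (d ^ 2 * M') * ENNReal.ofReal (N x * w x))) := by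
          refine lintegral_congr fun x => ?_
          have := hnn x
          have := hnn2 n x
          have := hnn3 x
          rw [← ENNReal.ofReal_mul (by positivity), ← ENNReal.ofReal_mul (by positivity),
            ← ENNReal.ofReal_mul (by positivity), ← ENNReal.ofReal_add (by positivity) (by positivity),
            ← ENNReal.ofReal_add (by positivity) (by positivity),
            ← ENNReal.ofReal_mul (by positivity), ← ENNReal.ofReal_mul hC0, mul_assoc]
      _ = _ := by
          have m1 : Measurable fun x => ENNReal.ofReal (speedPrimitive u ε x * w x) :=
            (cTh.mul hwc).measurable.ennreal_ofReal
          have m2 : Measurable fun x => ENNReal.ofReal (w x * speedWeight u ε x * |P x - c n * ρ x|) :=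
            Measurable.ennreal_ofReal (Continuous.measurable (by fun_prop))
          have m3 : Measurable fun x => ENNReal.ofReal (N x * w x) :=
            (hNc.mul hwc).measurable.ennreal_ofReal
          rw [lintegral_const_mul _ (by fun_prop), lintegral_const_mul _ (by fun_prop),
            lintegral_add_right _ (by fun_prop), lintegral_add_right _ (by fun_prop),
            lintegral_const_mul _ m1, lintegral_const_mul _ m2, lintegral_const_mul _ m3]
          ring
  have hDi : Integrable fun x => dissipation mu lam u x * speedWeight u ε x := by
    refine (hN2.const_mul (d ^ 2 * M')).mono'
      ((continuous_dissipation hu).mul cth).aestronglyMeasurable (Eventually.of_forall fun x => ?_)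
    rw [norm_mul, Real.norm_of_nonneg (speedWeight_nonneg x)]
    exact (mul_le_of_le_one_right (norm_nonneg _) (speedWeight_le_one hε x)).trans
      (abs_dissipation_le hmu fun i j => hN i j x)
  have limL := tendsto_integral_mul_cutoff hR hφ hDi
  have hle : ∀ n, ∫ x, dissipation mu lam u x * speedWeight u ε x * φ n x ≤
      (∫ x, B n x) + 4 * d ^ 2 * ∫ x, N x * weightError u ε x * (κ * Q + d * M' * N x) := by
    intro n
    simp_rw [mul_assoc (dissipation mu lam u _)]
    rw [hid, integral_add (iB n) (iI n), ← integral_const_mul]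
    refine add_le_add le_rfl ?_
    exact integral_mono (iI n) (hZ.const_mul _) fun x => (le_abs_self _).trans (hIle n x)
  simpa using le_of_tendsto_of_tendsto' limL (limB.add_const _) hle

end

/-! ### Coercivity of the dissipation and removal of the weight -/

section

variable {d : ℕ} {γ mu lam : ℝ} {ρ P : Space d → ℝ} {u : Fin d → Space d → ℝ}

theorem abs_sum_partialDeriv_le {N : ℝ} {x : Space d}
    (hN : ∀ i j, |partialDeriv j (u i) x| ≤ N) : |∑ j, partialDeriv j (u j) x| ≤ d * N := by
  refine (Finset.abs_sum_le_sum_abs _ _).trans ((Finset.sum_le_card_nsmul _ _ N ?_).trans (by simp))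
  intro j _; exact hN j j

theorem integrable_sq_divergence (hu : ∀ i, ContDiff ℝ ∞ (u i)) {N : Space d → ℝ}
    (hN : ∀ i j x, |partialDeriv j (u i) x| ≤ N x) (hN2 : Integrable fun x => N x ^ 2) :
    Integrable fun x => (∑ j, partialDeriv j (u j) x) ^ 2 := by
  have cD := fun i j => (contDiff_partialDeriv (hu i) j).continuous
  refine (hN2.const_mul (d ^ 2 : ℝ)).mono' (Continuous.aestronglyMeasurable (by fun_prop))
    (Eventually.of_forall fun x => ?_)
  rw [norm_pow, Real.norm_eq_abs, ← mul_pow]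
  exact pow_le_pow_left₀ (abs_nonneg _) (abs_sum_partialDeriv_le fun i j => hN i j x) 2

theorem integrable_partialDeriv_mul_partialDeriv (hu : ∀ i, ContDiff ℝ ∞ (u i)) {N : Space d → ℝ}
    (hN : ∀ i j x, |partialDeriv j (u i) x| ≤ N x) (hN2 : Integrable fun x => N x ^ 2)
    (i j k l : Fin d) :
    Integrable fun x => partialDeriv j (u i) x * partialDeriv l (u k) x := by
  have cD := fun i j => (contDiff_partialDeriv (hu i) j).continuous
  refine hN2.mono' (Continuous.aestronglyMeasurable (by fun_prop))
    (Eventually.of_forall fun x => ?_)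
  rw [norm_mul, Real.norm_eq_abs, Real.norm_eq_abs, sq]
  exact mul_le_mul (hN i j x) (hN k l x) (abs_nonneg _) ((abs_nonneg _).trans (hN i j x))

theorem integrable_sum_sq_partialDeriv (hu : ∀ i, ContDiff ℝ ∞ (u i)) {N : Space d → ℝ}
    (hN : ∀ i j x, |partialDeriv j (u i) x| ≤ N x) (hN2 : Integrable fun x => N x ^ 2) :
    Integrable fun x => ∑ i, ∑ j, partialDeriv j (u i) x ^ 2 := by
  simp_rw [sq]
  exact integrable_finsetSum _ fun i _ => integrable_finsetSum _ fun j _ =>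
    integrable_partialDeriv_mul_partialDeriv hu hN hN2 i j i j

/-- The divergence is controlled by the gradient in `L²`, as soon as the boundary terms vanish
at infinity. -/
theorem integral_sq_divergence_le (hu : ∀ i, ContDiff ℝ ∞ (u i)) {w N : Space d → ℝ}
    (hw0 : ∀ x, 0 ≤ w x) (hwu : ∀ j x, |u j x| ≤ w x) (hN0 : ∀ x, 0 ≤ N x)
    (hwc : Continuous w) (hNc : Continuous N)
    (hN : ∀ i j x, |partialDeriv j (u i) x| ≤ N x) (hN2 : Integrable fun x => N x ^ 2)
    {R : ℕ → ℝ} (hR0 : ∀ n, 0 < R n) (hR : Tendsto R atTop atTop)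
    (hlim : Tendsto (fun n => ENNReal.ofReal (R n)⁻¹ *
      ∫⁻ x in annulus d (R n), ENNReal.ofReal (N x * w x)) atTop (𝓝 0)) :
    ∫ x, (∑ j, partialDeriv j (u j) x) ^ 2 ≤ ∫ x, ∑ i, ∑ j, partialDeriv j (u i) x ^ 2 := by
  obtain ⟨C, hC0, hC⟩ := exists_isCutoff d
  choose φ hφ using fun n => hC (R n) (hR0 n)
  have hD := fun i j => contDiff_partialDeriv (hu i) j
  have cD := fun i j => (hD i j).continuous
  have one : (1 : WithTop ℕ∞) ≤ ((⊤ : ℕ∞) : WithTop ℕ∞) := by simp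
  have hdiv : ContDiff ℝ ∞ fun y => ∑ j, partialDeriv j (u j) y :=
    ContDiff.sum fun j _ => hD j j
  -- For `W = (v·∇)v - v div v` the second derivatives cancel in `div W`, leaving `∑ ∂ᵢvⱼ ∂ⱼvᵢ -
  -- (div v)²`. Its integral vanishes because the flux of `W` through the annuli does.
  set W : Fin d → Space d → ℝ := fun i x =>
    (∑ j, u j x * partialDeriv j (u i) x) - u i x * ∑ j, partialDeriv j (u j) x with hW
  have hWs : ∀ i, ContDiff ℝ ∞ (W i) := fun i =>
    (ContDiff.sum fun j _ => (hu j).mul (hD i j)).sub ((hu i).mul hdiv)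
  set f : Space d → ℝ := fun x =>
    (∑ i, ∑ j, partialDeriv i (u j) x * partialDeriv j (u i) x) -
      (∑ j, partialDeriv j (u j) x) ^ 2 with hf
  have hdivW : ∀ x, ∑ i, partialDeriv i (W i) x = f x := by
    intro x
    have du := fun i => (hu i).differentiable (by simp) x
    have dD := fun i j => (hD i j).differentiable (by simp) x
    have dd := hdiv.differentiable (by simp) x
    have e1 : ∀ i, partialDeriv i (W i) x =
        (∑ j, (u j x * partialDeriv i (partialDeriv j (u i)) x +
          partialDeriv j (u i) x * partialDeriv i (u j) x)) -
        (u i x * partialDeriv i (fun y => ∑ j, partialDeriv j (u j) y) x +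
          (∑ j, partialDeriv j (u j) x) * partialDeriv i (u i) x) := by
      intro i
      rw [hW, partialDeriv_sub (DifferentiableAt.fun_sum fun j _ => (du j).fun_mul (dD i j))
        ((du i).fun_mul dd), partialDeriv_sum _ (fun j _ => (du j).fun_mul (dD i j)),
        partialDeriv_mul (du i) dd]
      congr 1
      exact Finset.sum_congr rfl fun j _ => partialDeriv_mul (du j) (dD i j)
    have e2 : ∀ i, partialDeriv i (fun y => ∑ j, partialDeriv j (u j) y) x =
        ∑ j, partialDeriv i (partialDeriv j (u j)) x := fun i =>
      partialDeriv_sum _ fun j _ => dD j j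
    simp_rw [e1, e2, Finset.sum_sub_distrib, Finset.sum_add_distrib, ← Finset.mul_sum]
    have e3 : ∑ i, ∑ j, u j x * partialDeriv i (partialDeriv j (u i)) x =
        ∑ i, u i x * ∑ j, partialDeriv i (partialDeriv j (u j)) x := by
      rw [Finset.sum_comm]
      refine Finset.sum_congr rfl fun i _ => ?_
      rw [Finset.mul_sum]
      exact Finset.sum_congr rfl fun j _ => by rw [partialDeriv_comm (hu j)]
    have e4 : ∑ i, ∑ j, partialDeriv j (u i) x * partialDeriv i (u j) x =
        ∑ i, ∑ j, partialDeriv i (u j) x * partialDeriv j (u i) x :=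
      Finset.sum_congr rfl fun i _ => Finset.sum_congr rfl fun j _ => mul_comm _ _
    rw [e3, e4, hf]; ring
  have hprod := fun i j k l => integrable_partialDeriv_mul_partialDeriv hu hN hN2 i j k l
  have hfi1 : Integrable fun x => ∑ i, ∑ j, partialDeriv i (u j) x * partialDeriv j (u i) x :=
    integrable_finsetSum _ fun i _ => integrable_finsetSum _ fun j _ => hprod j i i j
  have hfi2 := integrable_sq_divergence hu hN hN2
  have hfi : Integrable f := hfi1.sub hfi2
  have lim1 := tendsto_integral_mul_cutoff hR hφ hfi
  have hkey : ∀ n, ∫ x, f x * φ n x = -∫ x, ∑ i, W i x * partialDeriv i (φ n) x := by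
    intro n
    simp_rw [← hdivW]
    exact integral_sum_partialDeriv_mul (fun i => (hWs i).of_le one)
      ((hφ n).contDiff.of_le one) (hφ n).hasCompactSupport
  have lim2 : Tendsto (fun n => ∫ x, ∑ i, W i x * partialDeriv i (φ n) x) atTop (𝓝 0) := by
    have lim' := ENNReal.Tendsto.const_mul hlim
      (Or.inr (ENNReal.ofReal_ne_top (r := C * (2 * d ^ 2))))
    rw [mul_zero] at lim'
    refine tendsto_integral_zero_of_enorm_le (fun n => ?_) lim'
    have hRn := hR0 n
    have hle : ∀ x, |∑ i, W i x * partialDeriv i (φ n) x| ≤ (annulus d (R n)).indicator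
        (fun x => C * (2 * d ^ 2) * ((R n)⁻¹ * (N x * w x))) x := by
      intro x
      set L := (annulus d (R n)).indicator (fun _ => C * (R n)⁻¹) x with hL
      have hNx := hN0 x
      have hwx := hw0 x
      have hWi : ∀ i, |W i x| ≤ 2 * d * (N x * w x) := by
        intro i
        have a1 : |∑ j, u j x * partialDeriv j (u i) x| ≤ d * (w x * N x) := by
          refine (Finset.abs_sum_le_sum_abs _ _).trans
            ((Finset.sum_le_card_nsmul _ _ (w x * N x) ?_).trans (by simp))
          intro j _; rw [abs_mul]; exact mul_le_mul (hwu j x) (hN i j x) (abs_nonneg _) hwx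
        have a2 : |u i x * ∑ j, partialDeriv j (u j) x| ≤ w x * (d * N x) := by
          rw [abs_mul]
          exact mul_le_mul (hwu i x) (abs_sum_partialDeriv_le fun i j => hN i j x) (abs_nonneg _) hwx
        exact (abs_sub _ _).trans ((add_le_add a1 a2).trans_eq (by ring))
      have : |∑ i, W i x * partialDeriv i (φ n) x| ≤ d * (2 * d * (N x * w x) * L) := by
        refine (Finset.abs_sum_le_sum_abs _ _).trans
          ((Finset.sum_le_card_nsmul _ _ (2 * d * (N x * w x) * L) ?_).trans (by simp))
        intro j _; rw [abs_mul]
        exact mul_le_mul (hWi j) ((hφ n).abs_partialDeriv_le j x) (abs_nonneg _) (by positivity)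
      refine this.trans_eq ?_
      by_cases hx : x ∈ annulus d (R n)
      · simp only [hL, hx, Set.indicator_of_mem]; ring
      · simp [hL, hx]
    calc ∫⁻ x, ‖∑ i, W i x * partialDeriv i (φ n) x‖ₑ ≤ ∫⁻ x in annulus d (R n),
          ENNReal.ofReal (C * (2 * d ^ 2) * ((R n)⁻¹ * (N x * w x))) := by
          rw [← lintegral_indicator (measurableSet_annulus _)]
          refine lintegral_mono fun x => (enorm_le_ofReal (hle x)).trans_eq ?_
          by_cases hx : x ∈ annulus d (R n) <;> simp [hx]
      _ = _ := by
          have m3 : Measurable fun x => ENNReal.ofReal (N x * w x) :=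
            (hNc.mul hwc).measurable.ennreal_ofReal
          rw [← lintegral_const_mul _ m3, ← lintegral_const_mul _ (by fun_prop)]
          refine lintegral_congr fun x => ?_
          rw [ENNReal.ofReal_mul (p := C * (2 * d ^ 2)) (by positivity),
            ENNReal.ofReal_mul (p := (R n)⁻¹) (by positivity)]
  have hzero : ∫ x, f x = 0 := by
    simp_rw [hkey] at lim1
    exact tendsto_nhds_unique lim1 (by simpa using lim2.neg)
  rw [hf, integral_sub hfi1 hfi2, sub_eq_zero] at hzero
  rw [← hzero]
  -- Pointwise, `∂ᵢvⱼ ∂ⱼvᵢ ≤ ((∂ᵢvⱼ)² + (∂ⱼvᵢ)²)/2`; symmetrising the sum gives `|∇v|²`.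
  refine integral_mono hfi1 (integrable_sum_sq_partialDeriv hu hN hN2) fun x => ?_
  have hsum : ∑ i, ∑ j, partialDeriv j (u i) x ^ 2 =
      ∑ i, ∑ j, (partialDeriv j (u i) x ^ 2 + partialDeriv i (u j) x ^ 2) / 2 := by
    simp_rw [add_div, Finset.sum_add_distrib]
    rw [Finset.sum_comm (f := fun i j => partialDeriv i (u j) x ^ 2 / 2)]
    simp_rw [← Finset.sum_div]; ring
  simp only
  rw [hsum]
  refine Finset.sum_le_sum fun i _ => Finset.sum_le_sum fun j _ => ?_
  nlinarith [sq_nonneg (partialDeriv i (u j) x - partialDeriv j (u i) x)]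

/-- With `G = ∫|∇v|²` and `D = ∫(div v)²`, the total dissipation is `μG + (μ+λ)D` and `0 ≤ D ≤ G`.
If `μ+λ ≥ 0` the second term is dropped; otherwise `D ≤ G` bounds the total from below by `(λ+2μ)G`.
Either way `G = 0`. -/
theorem partialDeriv_eq_zero_of_integral_dissipation_le (hu : ∀ i, ContDiff ℝ ∞ (u i))
    (hmu : 0 < mu) (hlam : 0 < lam + 2 * mu) {N : Space d → ℝ}
    (hN : ∀ i j x, |partialDeriv j (u i) x| ≤ N x) (hN2 : Integrable fun x => N x ^ 2)
    (hdiv : ∫ x, (∑ j, partialDeriv j (u j) x) ^ 2 ≤ ∫ x, ∑ i, ∑ j, partialDeriv j (u i) x ^ 2)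
    (hle : ∫ x, dissipation mu lam u x ≤ 0) (i j : Fin d) (x : Space d) :
    partialDeriv j (u i) x = 0 := by
  have cD := fun i j => (contDiff_partialDeriv (hu i) j).continuous
  have i1 := integrable_sum_sq_partialDeriv hu hN hN2
  have i2 := integrable_sq_divergence hu hN hN2
  set G := ∫ x, ∑ i, ∑ j, partialDeriv j (u i) x ^ 2 with hG
  set D := ∫ x, (∑ j, partialDeriv j (u j) x) ^ 2 with hD
  have hD0 : 0 ≤ D := integral_nonneg fun x => sq_nonneg _
  have hnn : ∀ x, 0 ≤ ∑ i, ∑ j, partialDeriv j (u i) x ^ 2 := fun x =>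
    Finset.sum_nonneg fun _ _ => Finset.sum_nonneg fun _ _ => sq_nonneg _
  have hG0 : 0 ≤ G := integral_nonneg hnn
  have e : ∫ x, dissipation mu lam u x = mu * G + (mu + lam) * D := by
    simp only [dissipation]
    rw [integral_add (i1.const_mul _) (i2.const_mul _), integral_const_mul, integral_const_mul]
  rw [e] at hle
  have hGz : G = 0 := by
    rcases le_or_gt 0 (mu + lam) with hs | hs
    · nlinarith [mul_nonneg hs hD0]
    · have : (lam + 2 * mu) * G ≤ 0 := by nlinarith
      nlinarith
  rw [hG, integral_eq_zero_iff_of_nonneg hnn i1] at hGz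
  have hGz' := Continuous.ae_eq_iff_eq volume (by fun_prop) continuous_const |>.1 hGz
  have h1 := congrFun hGz' x
  change ∑ i, ∑ j, partialDeriv j (u i) x ^ 2 = 0 at h1
  rw [Finset.sum_eq_zero_iff_of_nonneg
    (fun _ _ => Finset.sum_nonneg fun _ _ => sq_nonneg _)] at h1
  have h2 := h1 i (Finset.mem_univ i)
  rw [Finset.sum_eq_zero_iff_of_nonneg (fun _ _ => sq_nonneg _)] at h2
  exact pow_eq_zero_iff (two_ne_zero) |>.1 (h2 j (Finset.mem_univ j))

theorem weightError_nonneg {ε : ℝ} (hε : 0 ≤ ε) (x : Space d) : 0 ≤ weightError u ε x :=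
  mul_nonneg (mul_nonneg hε (sqSpeed_nonneg x))
    (inv_nonneg.2 (pow_nonneg (one_add_sqSpeed_pos hε x).le 3))

theorem weightError_le {ε : ℝ} (hε : 0 ≤ ε) (x : Space d) :
    weightError u ε x ≤ 1 ∧ weightError u ε x ≤ ε * sqSpeed u x := by
  have hy : 0 ≤ ε * sqSpeed u x := mul_nonneg hε (sqSpeed_nonneg x)
  have h1 : (1 : ℝ) ≤ (1 + ε * sqSpeed u x) ^ 3 := one_le_pow₀ (by linarith)
  refine ⟨?_, mul_le_of_le_one_right hy (inv_le_one_of_one_le₀ h1)⟩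
  rw [weightError, ← div_eq_mul_inv, div_le_one (by linarith)]
  nlinarith [pow_nonneg hy 2, pow_nonneg hy 3]

/-- The error is at most `min(1, |v|²)`, so its square is at most `min(1, |v|⁴)`, which lies below
`|v|ᵖ` for every `p` in `[0, 4]`. This majorant does not depend on `ε`. -/
theorem weightError_sq_le {ε p : ℝ} (hε : 0 ≤ ε) (hε1 : ε ≤ 1) (hp0 : 0 ≤ p) (hp : p ≤ 4) {w : ℝ}
    {x : Space d} (hw0 : 0 ≤ w) (hwS : w ^ 2 = sqSpeed u x) : weightError u ε x ^ 2 ≤ w ^ p := by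
  obtain ⟨h1, h2⟩ := weightError_le (u := u) hε x
  have h0 := weightError_nonneg (u := u) hε x
  rcases le_total w 1 with hw1 | hw1
  · have h3 : weightError u ε x ≤ w ^ 2 := by
      rw [hwS]; exact h2.trans (mul_le_of_le_one_left (sqSpeed_nonneg x) hε1)
    rcases hw0.eq_or_lt with rfl | hwpos
    · have : weightError u ε x = 0 := le_antisymm (by simpa using h3) h0
      rw [this]; simpa using Real.rpow_nonneg le_rfl p
    calc weightError u ε x ^ 2 ≤ (w ^ 2) ^ 2 := pow_le_pow_left₀ h0 h3 2
      _ = w ^ (4 : ℝ) := by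
        rw [← pow_mul, ← Real.rpow_natCast]; norm_num
      _ ≤ w ^ p := Real.rpow_le_rpow_of_exponent_ge hwpos hw1 hp
  · exact (pow_le_one₀ h0 h1).trans (Real.one_le_rpow hw1 hp0)

/-- Removing the weight: if the weighted energy inequality holds for small `ε > 0`, the total
dissipation is nonpositive. -/
theorem integral_dissipation_le_zero (hu : ∀ i, ContDiff ℝ ∞ (u i)) (hmu : 0 ≤ mu)
    {w N : Space d → ℝ} (hw0 : ∀ x, 0 ≤ w x) (hwS : ∀ x, w x ^ 2 = sqSpeed u x)
    (hNc : Continuous N) (hN0 : ∀ x, 0 ≤ N x) (hN : ∀ i j x, |partialDeriv j (u i) x| ≤ N x)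
    (hN2 : Integrable fun x => N x ^ 2) {p : ℝ} (hp0 : 0 ≤ p) (hp4 : p ≤ 4)
    (hwp : Integrable fun x => w x ^ p) {A B K : ℝ} (hA : 0 ≤ A) (hB : 0 ≤ B)
    (h : ∀ ε : ℝ, 0 < ε → ε ≤ 1 → (Integrable fun x => N x * weightError u ε x * (A + B * N x)) →
      ∫ x, dissipation mu lam u x * speedWeight u ε x ≤
        K * ∫ x, N x * weightError u ε x * (A + B * N x)) :
    ∫ x, dissipation mu lam u x ≤ 0 := by
  set ε : ℕ → ℝ := fun n => 1 / ((n : ℝ) + 1) with hεdef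
  have hε0 : ∀ n, 0 < ε n := fun n => by positivity
  have hε1 : ∀ n, ε n ≤ 1 := fun n => by
    rw [hεdef, div_le_one (by positivity)]; linarith [(Nat.cast_nonneg n : (0 : ℝ) ≤ n)]
  have hεlim : Tendsto ε atTop (𝓝 0) := tendsto_one_div_add_atTop_nhds_zero_nat
  have cS := (contDiff_sqSpeed hu).continuous
  have cE : ∀ n, Continuous (weightError u (ε n)) := fun n => by
    unfold weightError
    refine (continuous_const.mul cS).mul (Continuous.inv₀ (by fun_prop) fun x => ?_)
    exact (pow_pos (one_add_sqSpeed_pos (hε0 n).le x) 3).ne'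
  -- Writing `e` for the error, `N e ≤ N² + e² ≤ N² + wᵖ` and `N² e ≤ N²`: an integrable bound
  -- uniform in `ε`.
  have hbi : Integrable fun x => A * (N x ^ 2 + w x ^ p) + B * N x ^ 2 :=
    ((hN2.add hwp).const_mul A).add (hN2.const_mul B)
  have hbound : ∀ n x, ‖N x * weightError u (ε n) x * (A + B * N x)‖ ≤
      A * (N x ^ 2 + w x ^ p) + B * N x ^ 2 := by
    intro n x
    have e0 := weightError_nonneg (u := u) (hε0 n).le x
    have e1 := (weightError_le (u := u) (hε0 n).le x).1
    have e2 := weightError_sq_le (hε0 n).le (hε1 n) hp0 hp4 (hw0 x) (hwS x)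
    have hNx := hN0 x
    rw [Real.norm_of_nonneg (by positivity)]
    have t1 : N x * weightError u (ε n) x ≤ N x ^ 2 + w x ^ p := by
      nlinarith [sq_nonneg (N x - weightError u (ε n) x), sq_nonneg (N x),
        sq_nonneg (weightError u (ε n) x)]
    have t2 : N x * weightError u (ε n) x * N x ≤ N x ^ 2 := by
      nlinarith [sq_nonneg (N x)]
    nlinarith [mul_le_mul_of_nonneg_left t1 hA, mul_le_mul_of_nonneg_left t2 hB]
  have hmeas : ∀ n, AEStronglyMeasurable (fun x => N x * weightError u (ε n) x * (A + B * N x))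
      volume := fun n => by
    have := cE n
    exact Continuous.aestronglyMeasurable (by fun_prop)
  have hineq := fun n => h (ε n) (hε0 n) (hε1 n)
    (hbi.mono' (hmeas n) (Eventually.of_forall (hbound n)))
  have hElim : ∀ x, Tendsto (fun n => weightError u (ε n) x) atTop (𝓝 0) := by
    intro x
    refine squeeze_zero (fun n => weightError_nonneg (hε0 n).le x)
      (fun n => (weightError_le (hε0 n).le x).2) ?_
    simpa using hεlim.mul_const (sqSpeed u x)
  have limR : Tendsto (fun n => ∫ x, N x * weightError u (ε n) x * (A + B * N x)) atTop (𝓝 0) := by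
    have := tendsto_integral_of_dominated_convergence
      (F := fun n x => N x * weightError u (ε n) x * (A + B * N x)) (f := fun _ => 0)
      (μ := volume) _ hmeas hbi
      (fun n => Eventually.of_forall (hbound n)) (Eventually.of_forall fun x => by
        simpa using ((hElim x).const_mul (N x)).mul_const (A + B * N x))
    simpa using this
  have cD := continuous_dissipation (mu := mu) (lam := lam) hu
  have limL : Tendsto (fun n => ∫ x, dissipation mu lam u x * speedWeight u (ε n) x) atTop
      (𝓝 (∫ x, dissipation mu lam u x)) := by
    refine tendsto_integral_of_dominated_convergence
      (fun x => d ^ 2 * (mu + |mu + lam|) * N x ^ 2)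
      (fun n => (cD.mul (contDiff_speedWeight hu (hε0 n).le).continuous).aestronglyMeasurable)
      (hN2.const_mul _) (fun n => Eventually.of_forall fun x => ?_)
      (Eventually.of_forall fun x => ?_)
    · rw [norm_mul, Real.norm_of_nonneg (speedWeight_nonneg x)]
      exact (mul_le_of_le_one_right (norm_nonneg _) (speedWeight_le_one (hε0 n).le x)).trans
        (abs_dissipation_le hmu fun i j => hN i j x)
    · have : Tendsto (fun n => speedWeight u (ε n) x) atTop (𝓝 (((1 + 0 * sqSpeed u x) ^ 2)⁻¹)) := by
        refine Tendsto.inv₀ (((hεlim.mul_const _).const_add 1).pow 2) (by simp)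
      simpa using this.const_mul (dissipation mu lam u x)
  have := le_of_tendsto_of_tendsto' limL (limR.const_mul K) hineq
  simpa using this

end

/-! ### From the vector system to components -/

section

variable {d : ℕ} {A γ mu lam : ℝ} {ρ : Space d → ℝ} {v : Space d → Space d}

theorem contDiff_coord (hv : ContDiff ℝ ∞ v) (i : Fin d) : ContDiff ℝ ∞ fun y => v y i :=
  (contDiff_euclidean.1 hv) i

theorem gradient_apply_eq_partialDeriv (f : Space d → ℝ) (i : Fin d) (x : Space d) :
    (∇ f x) i = partialDeriv i f x := by
  have : inner ℝ (∇ f x) (EuclideanSpace.single i (1 : ℝ)) = fderiv ℝ f x (EuclideanSpace.single i 1) := by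
    rw [gradient, InnerProductSpace.toDual_symm_apply]
  rw [partialDeriv, ← this, EuclideanSpace.inner_single_right]
  simp

theorem laplacian_apply_eq_sum (hv : ContDiff ℝ ∞ v) (i : Fin d) (x : Space d) :
    (Δ v x) i = ∑ j, partialDeriv j (partialDeriv j fun y => v y i) x := by
  have h1 : (Δ v x) i = Δ (fun y => v y i) x := by
    have := (show ContDiff ℝ 2 v from contDiff_infty.1 hv 2).contDiffAt (x := x)
      |>.laplacian_CLM_comp_left (l := (EuclideanSpace.proj i : Space d →L[ℝ] ℝ))
    simpa [Function.comp_def] using this.symm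
  rw [h1, InnerProductSpace.laplacian_eq_iteratedFDeriv_orthonormalBasis _
    (EuclideanSpace.basisFun (Fin d) ℝ)]
  refine Finset.sum_congr rfl fun j _ => ?_
  have hc := contDiff_coord hv i
  rw [iteratedFDeriv_two_apply]
  have hd : DifferentiableAt ℝ (fderiv ℝ fun y => v y i) x :=
    (contDiff_infty_iff_fderiv.1 hc).2.differentiable (by simp) x
  change _ = fderiv ℝ (fun z => fderiv ℝ (fun y => v y i) z (EuclideanSpace.single j 1)) x
    (EuclideanSpace.single j 1)
  rw [fderiv_clm_apply hd (by fun_prop)]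
  simp

theorem partialDeriv_pressure (hρ : ContDiff ℝ ∞ ρ) (hγ : 1 < γ) (j : Fin d) (x : Space d) :
    partialDeriv j (fun y => A * ρ y ^ γ) x = A * (γ * ρ x ^ (γ - 1)) * partialDeriv j ρ x :=
  partialDeriv_comp (h := fun t => A * t ^ γ)
    ((Real.hasDerivAt_rpow_const (Or.inr hγ.le)).const_mul A) (hρ.differentiable (by simp) x)

theorem IsStationarySolution.isComponentSolution (h : IsStationarySolution A γ mu lam ρ v)
    (hγ : 1 < γ) (hρ : ContDiff ℝ ∞ ρ) (hv : ContDiff ℝ ∞ v) (hρ0 : ∀ x, 0 ≤ ρ x) :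
    IsComponentSolution γ mu lam ρ (fun y => A * ρ y ^ γ) fun i y => v y i := by
  have hu := contDiff_coord hv
  have du := fun i x => (hu i).differentiable (by simp) x
  have dρ := fun x => hρ.differentiable (by simp) x
  have hcont : ∀ x, ∑ j, (ρ x * partialDeriv j (fun y => v y j) x + v x j * partialDeriv j ρ x) = 0 := by
    intro x
    rw [← h.continuity x, divergence]
    exact Finset.sum_congr rfl fun j _ => (partialDeriv_mul (dρ x) (du j x)).symm
  refine ⟨hρ, ?_, hu, hcont, fun x => ?_, fun i x => ?_⟩
  · exact contDiff_const.mul ((Real.contDiff_rpow_const_of_le (n := 1) (by simpa using hγ.le)).comp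
      (hρ.of_le (by simp)))
  · simp_rw [partialDeriv_pressure hρ hγ]
    -- Vacuum is allowed, so `ρ = 0` is treated apart; both sides vanish there since `γ ≠ 0`.
    have hpow : ρ x ^ γ = ρ x ^ (γ - 1) * ρ x := by
      rcases (hρ0 x).eq_or_lt with h0 | h0
      · rw [← h0, Real.zero_rpow (by linarith), mul_zero]
      · rw [← Real.rpow_add_one h0.ne']; simp
    have := hcont x
    rw [Finset.sum_add_distrib, ← Finset.mul_sum] at this
    have e : ∑ j, v x j * (A * (γ * ρ x ^ (γ - 1)) * partialDeriv j ρ x) =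
        A * (γ * ρ x ^ (γ - 1)) * ∑ j, v x j * partialDeriv j ρ x := by
      rw [Finset.mul_sum]; exact Finset.sum_congr rfl fun j _ => by ring
    rw [e, hpow]
    linear_combination (A * (γ * ρ x ^ (γ - 1))) * this
  · have hm := congrArg (fun z : Space d => z i) (h.momentum x)
    simp only [matrixDivergence, PiLp.add_apply, PiLp.neg_apply, PiLp.smul_apply, smul_eq_mul,
      gradient_apply_eq_partialDeriv, laplacian_apply_eq_sum hv] at hm
    simp only [Matrix.smul_apply, Matrix.vecMulVec_apply, smul_eq_mul] at hm
    refine Eq.trans ?_ hm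
    have e : ∀ j, partialDeriv j (fun y => ρ y * (v y i * v y j)) x =
        ρ x * (v x j * partialDeriv j (fun y => v y i) x) +
        v x i * (ρ x * partialDeriv j (fun y => v y j) x + v x j * partialDeriv j ρ x) := by
      intro j
      rw [partialDeriv_mul (dρ x) ((du i x).fun_mul (du j x)), partialDeriv_mul (du i x) (du j x)]
      ring
    simp_rw [e]
    rw [Finset.sum_add_distrib, ← Finset.mul_sum, ← Finset.mul_sum, hcont x]
    ring

end

/-! ### Decay of integrals over annuli -/

section

variable {d : ℕ}

theorem tendsto_setLIntegral_annulus {G : Space d → ℝ≥0∞} (hG : Measurable G)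
    (hfin : ∫⁻ x, G x ≠ ⊤) :
    Tendsto (fun n : ℕ => ∫⁻ x in annulus d (n + 1), G x) atTop (𝓝 0) := by
  simp_rw [← lintegral_indicator (measurableSet_annulus _)]
  have := tendsto_lintegral_of_dominated_convergence (μ := volume)
    (F := fun (n : ℕ) x => (annulus d (n + 1)).indicator G x) (f := fun _ => 0) G
    (fun n => hG.indicator (measurableSet_annulus _))
    (fun n => Eventually.of_forall fun x => Set.indicator_le_self _ _ x) hfin
    (Eventually.of_forall fun x => ?_)
  · simpa using this
  · refine tendsto_const_nhds.congr' ?_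
    filter_upwards [tendsto_natCast_atTop_atTop.eventually_ge_atTop ‖x‖] with n hn
    rw [Set.indicator_of_notMem]
    intro hx
    have := hx.1
    linarith

theorem tendsto_setNorm_annulus {p : ℝ} (hp : 0 < p) {F : Space d → ℝ≥0∞} (hF : Measurable F)
    (hfin : ∫⁻ x, F x ^ p ≠ ⊤) :
    Tendsto (fun n : ℕ => setNorm p (annulus d (n + 1)) F) atTop (𝓝 0) := by
  have := (tendsto_setLIntegral_annulus (hF.pow_const p) hfin).ennrpow_const (1 / p)
  rwa [ENNReal.zero_rpow_of_pos (by positivity)] at this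

theorem setNorm_mul_le {r p q : ℝ} (hr : 0 < r) (hrp : r < p) (h : 1 / r = 1 / p + 1 / q)
    {s : Set (Space d)} {F G : Space d → ℝ≥0∞} (hF : Measurable F) (hG : Measurable G) :
    setNorm r s (fun x => F x * G x) ≤ setNorm p s F * setNorm q s G :=
  ENNReal.lintegral_Lp_mul_le_Lq_mul_Lr hr hrp h _ hF.aemeasurable hG.aemeasurable

theorem setNorm_mono {r : ℝ} (hr : 0 ≤ r) {s t : Set (Space d)} (hst : s ⊆ t)
    {F G : Space d → ℝ≥0∞} (hFG : ∀ x, F x ≤ G x) : setNorm r s F ≤ setNorm r t G :=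
  ENNReal.rpow_le_rpow ((lintegral_mono_set hst).trans
    (lintegral_mono fun x => ENNReal.rpow_le_rpow (hFG x) hr)) (by positivity)

theorem setNorm_le {r : ℝ} (hr : 0 ≤ r) {s : Set (Space d)} {F : Space d → ℝ≥0∞} :
    setNorm r s F ≤ (∫⁻ x, F x ^ r) ^ (1 / r) :=
  ENNReal.rpow_le_rpow (setLIntegral_le_lintegral _ _) (by positivity)

theorem setNorm_rpow {r : ℝ} (hr : 0 < r) {s : Set (Space d)} {F : Space d → ℝ≥0∞} :
    setNorm r s F ^ r = ∫⁻ x in s, F x ^ r := by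
  rw [setNorm, ← ENNReal.rpow_mul, one_div_mul_cancel hr.ne', ENNReal.rpow_one]

/-- Hölder against the constant `1`; the power of `R` is that of the volume. The radius `6R` is the
largest one that occurs. -/
theorem exists_setNorm_le_setNorm {r p : ℝ} (hr : 0 < r) (hrp : r < p) :
    ∃ C : ℝ≥0∞, C ≠ ⊤ ∧ ∀ R : ℝ, 0 < R → ∀ s ⊆ Metric.closedBall (0 : Space d) (6 * R),
      ∀ F : Space d → ℝ≥0∞, Measurable F →
        setNorm r s F ≤ C * ENNReal.ofReal R ^ (d * (1 / r - 1 / p)) * setNorm p s F := by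
  have hpos : 0 < 1 / r - 1 / p := sub_pos.2 (one_div_lt_one_div_of_lt hr hrp)
  set b := volume (Metric.ball (0 : Space d) 1) with hb
  have hbt : b ≠ ⊤ := measure_ball_lt_top.ne
  refine ⟨(ENNReal.ofReal (6 ^ d) * b) ^ (1 / r - 1 / p),
    ENNReal.rpow_ne_top_of_nonneg hpos.le (by finiteness), fun R hR s hs F hF => ?_⟩
  have h1 := setNorm_mul_le (q := 1 / (1 / r - 1 / p)) (s := s) (G := fun _ => 1) hr hrp
    (by rw [one_div_one_div]; ring) hF measurable_const
  simp only [mul_one] at h1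
  refine h1.trans ?_
  rw [mul_comm]
  refine mul_le_mul' ?_ le_rfl
  simp only [setNorm, ENNReal.one_rpow, lintegral_const, one_mul, one_div_one_div,
    Measure.restrict_apply_univ]
  calc volume s ^ (1 / r - 1 / p) ≤
        (ENNReal.ofReal (6 ^ d) * b * ENNReal.ofReal R ^ (d : ℝ)) ^ (1 / r - 1 / p) := by
        refine ENNReal.rpow_le_rpow ((measure_mono hs).trans_eq ?_) hpos.le
        rw [Measure.addHaar_closedBall _ _ (by positivity), finrank_euclideanSpace_fin, mul_pow,
          ENNReal.ofReal_mul (by positivity), ENNReal.ofReal_pow hR.le, ENNReal.rpow_natCast]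
        ring
    _ = _ := by
        rw [ENNReal.mul_rpow_of_nonneg _ _ hpos.le, ← ENNReal.rpow_mul]

theorem ofReal_inv_mul_rpow_le_one {R θ : ℝ} (hR : 1 ≤ R) (hθ : θ ≤ 1) :
    ENNReal.ofReal R⁻¹ * ENNReal.ofReal R ^ θ ≤ 1 := by
  have h1 : (1 : ℝ≥0∞) ≤ ENNReal.ofReal R := by simpa using hR
  calc _ ≤ ENNReal.ofReal R⁻¹ * ENNReal.ofReal R ^ (1 : ℝ) :=
        mul_le_mul' le_rfl (ENNReal.rpow_le_rpow_of_exponent_le h1 hθ)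
    _ = 1 := by
        rw [ENNReal.rpow_one, ← ENNReal.ofReal_mul (by positivity), inv_mul_cancel₀ (by positivity),
          ENNReal.ofReal_one]

theorem annulus_subset_closedBall (R : ℝ) : annulus d R ⊆ Metric.closedBall 0 (2 * R) :=
  fun x hx => by simpa using hx.2

theorem annulus_subset_closedBall_six {R : ℝ} (hR : 0 ≤ R) :
    annulus d R ⊆ Metric.closedBall 0 (6 * R) :=
  (annulus_subset_closedBall R).trans (Metric.closedBall_subset_closedBall (by linarith))

/-- Passing from `Lʳ` to `Lᵖ` costs at most one power of `R`, which `R⁻¹` absorbs, and the `Lᵖ` norm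
over the annulus tends to zero. The radii are `n + 1` because comparing powers of `R` requires `R ≥
1`. -/
theorem tendsto_inv_mul_setNorm_annulus {r p : ℝ} (hr : 0 < r) (hrp : r < p)
    (hθ : d * (1 / r - 1 / p) ≤ 1) {F : Space d → ℝ≥0∞} (hF : Measurable F)
    (hfin : ∫⁻ x, F x ^ p ≠ ⊤) :
    Tendsto (fun n : ℕ => ENNReal.ofReal (n + 1 : ℝ)⁻¹ * setNorm r (annulus d (n + 1)) F)
      atTop (𝓝 0) := by
  obtain ⟨C, hC, hle⟩ := exists_setNorm_le_setNorm (d := d) hr hrp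
  have lim := ENNReal.Tendsto.const_mul (tendsto_setNorm_annulus (hr.trans hrp) hF hfin)
    (Or.inr hC)
  rw [mul_zero] at lim
  refine tendsto_of_tendsto_of_tendsto_of_le_of_le tendsto_const_nhds lim (fun _ => zero_le)
    fun n => ?_
  have hn : (1 : ℝ) ≤ n + 1 := by linarith [(Nat.cast_nonneg n : (0 : ℝ) ≤ n)]
  have h0 : (0 : ℝ) < n + 1 := by linarith
  calc _ ≤ ENNReal.ofReal (n + 1 : ℝ)⁻¹ * (C * ENNReal.ofReal (n + 1) ^ (d * (1 / r - 1 / p)) *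
          setNorm p (annulus d (n + 1)) F) :=
        mul_le_mul' le_rfl (hle _ h0 _ (annulus_subset_closedBall_six h0.le) _ hF)
    _ = (ENNReal.ofReal (n + 1 : ℝ)⁻¹ * ENNReal.ofReal (n + 1) ^ (d * (1 / r - 1 / p))) *
          (C * setNorm p (annulus d (n + 1)) F) := by ring
    _ ≤ 1 * (C * setNorm p (annulus d (n + 1)) F) :=
        mul_le_mul' (ofReal_inv_mul_rpow_le_one hn hθ) le_rfl
    _ = _ := one_mul _

theorem tendsto_inv_mul_setLIntegral_rpow {a p : ℝ} (ha : 0 < a) (hap : a < p)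
    (hθ : d * (1 - a / p) ≤ 1) {F : Space d → ℝ≥0∞} (hF : Measurable F)
    (hfin : ∫⁻ x, F x ^ p ≠ ⊤) :
    Tendsto (fun n : ℕ => ENNReal.ofReal (n + 1 : ℝ)⁻¹ * ∫⁻ x in annulus d (n + 1), F x ^ a)
      atTop (𝓝 0) := by
  obtain ⟨C, hC, hle⟩ := exists_setNorm_le_setNorm (d := d) ha hap
  have hp := ha.trans hap
  have lim := ENNReal.Tendsto.const_mul
    ((tendsto_setNorm_annulus hp hF hfin).ennrpow_const a)
    (Or.inr (ENNReal.rpow_ne_top_of_nonneg ha.le hC))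
  rw [ENNReal.zero_rpow_of_pos ha, mul_zero] at lim
  refine tendsto_of_tendsto_of_tendsto_of_le_of_le tendsto_const_nhds lim (fun _ => zero_le)
    fun n => ?_
  have hn : (1 : ℝ) ≤ n + 1 := by linarith [(Nat.cast_nonneg n : (0 : ℝ) ≤ n)]
  have h0 : (0 : ℝ) < n + 1 := by linarith
  rw [← setNorm_rpow ha]
  calc _ ≤ ENNReal.ofReal (n + 1 : ℝ)⁻¹ * (C * ENNReal.ofReal (n + 1) ^ (d * (1 / a - 1 / p)) *
          setNorm p (annulus d (n + 1)) F) ^ a :=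
        mul_le_mul' le_rfl (ENNReal.rpow_le_rpow
          (hle _ h0 _ (annulus_subset_closedBall_six h0.le) _ hF) ha.le)
    _ = (ENNReal.ofReal (n + 1 : ℝ)⁻¹ * ENNReal.ofReal (n + 1) ^ (d * (1 - a / p))) *
          (C ^ a * setNorm p (annulus d (n + 1)) F ^ a) := by
        rw [ENNReal.mul_rpow_of_nonneg _ _ ha.le, ENNReal.mul_rpow_of_nonneg _ _ ha.le,
          ← ENNReal.rpow_mul, show (d : ℝ) * (1 / a - 1 / p) * a = d * (1 - a / p) by
            field_simp]
        ring
    _ ≤ 1 * (C ^ a * setNorm p (annulus d (n + 1)) F ^ a) :=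
        mul_le_mul' (ofReal_inv_mul_rpow_le_one hn hθ) le_rfl
    _ = _ := one_mul _

theorem setLIntegral_le_mul {s : Set (Space d)} {F G : Space d → ℝ≥0∞} {C : ℝ≥0∞}
    (hG : Measurable G) (h : ∀ x, F x ≤ C * G x) : ∫⁻ x in s, F x ≤ C * ∫⁻ x in s, G x := by
  rw [← lintegral_const_mul _ hG]
  exact lintegral_mono h

/-- The gradient-velocity boundary term. -/
theorem tendsto_inv_mul_setLIntegral_mul {p : ℝ} (hp : 2 < p) (hθ : d * (1 / 2 - 1 / p) ≤ 1)
    {F G : Space d → ℝ≥0∞} (hF : Measurable F) (hG : Measurable G)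
    (hGfin : ∫⁻ x, G x ^ (2 : ℝ) ≠ ⊤) (hfin : ∫⁻ x, F x ^ p ≠ ⊤) :
    Tendsto (fun n : ℕ => ENNReal.ofReal (n + 1 : ℝ)⁻¹ * ∫⁻ x in annulus d (n + 1), G x * F x)
      atTop (𝓝 0) := by
  have lim := ENNReal.Tendsto.const_mul (tendsto_inv_mul_setNorm_annulus two_pos hp hθ hF hfin)
    (Or.inr (ENNReal.rpow_ne_top_of_nonneg (y := 1 / 2) (by norm_num) hGfin))
  rw [mul_zero] at lim
  refine tendsto_of_tendsto_of_tendsto_of_le_of_le tendsto_const_nhds lim (fun _ => zero_le)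
    fun n => ?_
  calc _ ≤ ENNReal.ofReal (n + 1 : ℝ)⁻¹ *
        (setNorm 2 (annulus d (n + 1)) G * setNorm 2 (annulus d (n + 1)) F) :=
        mul_le_mul' le_rfl (setLIntegral_mul_le_setNorm Real.HolderConjugate.two_two hG hF)
    _ ≤ ENNReal.ofReal (n + 1 : ℝ)⁻¹ *
        ((∫⁻ x, G x ^ (2 : ℝ)) ^ (1 / (2 : ℝ)) * setNorm 2 (annulus d (n + 1)) F) :=
        mul_le_mul' le_rfl (mul_le_mul' (setNorm_le (by norm_num)) le_rfl)
    _ = _ := by ring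

end

/-! ### The pressure gradient as a force plus the divergence of a stress -/

section

variable {d : ℕ} {γ mu lam : ℝ} {ρ P : Space d → ℝ} {u : Fin d → Space d → ℝ} {η Φ : Space d → ℝ}

/-- The viscous stress tensor `μ ∇v + (μ + λ) (div v) I`, up to a divergence-free part. -/
def viscousStress (mu lam : ℝ) (u : Fin d → Space d → ℝ) (i j : Fin d) (x : Space d) : ℝ :=
  mu * partialDeriv j (u i) x + (if i = j then mu + lam else 0) * ∑ k, partialDeriv k (u k) x

theorem contDiff_viscousStress (hu : ∀ i, ContDiff ℝ ∞ (u i)) (i j : Fin d) :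
    ContDiff ℝ ∞ (viscousStress mu lam u i j) :=
  (contDiff_const.mul (contDiff_partialDeriv (hu i) j)).add
    (contDiff_const.mul (ContDiff.sum fun k _ => contDiff_partialDeriv (hu k) k))

theorem sum_partialDeriv_viscousStress (hu : ∀ i, ContDiff ℝ ∞ (u i)) (i : Fin d) (x : Space d) :
    ∑ j, partialDeriv j (viscousStress mu lam u i j) x =
      mu * ∑ j, partialDeriv j (partialDeriv j (u i)) x +
        (mu + lam) * partialDeriv i (fun y => ∑ j, partialDeriv j (u j) y) x := by
  have hD := fun i j => (contDiff_partialDeriv (hu i) j).differentiable (by simp) x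
  have hd : DifferentiableAt ℝ (fun y => ∑ k, partialDeriv k (u k) y) x :=
    DifferentiableAt.fun_sum fun k _ => hD k k
  have e : ∀ j, partialDeriv j (viscousStress mu lam u i j) x =
      mu * partialDeriv j (partialDeriv j (u i)) x +
        (if i = j then mu + lam else 0) * partialDeriv j (fun y => ∑ k, partialDeriv k (u k) y) x := by
    intro j
    change partialDeriv j (fun x => mu * partialDeriv j (u i) x +
      (if i = j then mu + lam else 0) * ∑ k, partialDeriv k (u k) x) x = _
    rw [partialDeriv_add ((hD i j).const_mul mu) (hd.const_mul _), partialDeriv_const_mul _ (hD i j),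
      partialDeriv_const_mul _ hd]
  simp_rw [e, Finset.sum_add_distrib, ← Finset.mul_sum, ite_mul, zero_mul]
  simp

theorem abs_viscousStress_le (hmu : 0 ≤ mu) {N : ℝ} {x : Space d}
    (hN : ∀ i j, |partialDeriv j (u i) x| ≤ N) (i j : Fin d) :
    |viscousStress mu lam u i j x| ≤ (mu + |mu + lam| * d) * N := by
  have h1 := abs_sum_partialDeriv_le hN
  have h2 : |if i = j then mu + lam else 0| ≤ |mu + lam| := by
    split_ifs <;> simp
  refine (abs_add_le _ _).trans ?_
  rw [abs_mul, abs_mul, abs_of_nonneg hmu]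
  calc _ ≤ mu * N + |mu + lam| * (d * N) :=
        add_le_add (mul_le_mul_of_nonneg_left (hN i j) hmu)
          (mul_le_mul h2 h1 (abs_nonneg _) (abs_nonneg _))
    _ = _ := by ring

/-- Convection kept as a force. This form serves for `d ≥ 4`, where `ρ v·∇v` has a global
integrability coming from Sobolev. -/
theorem IsComponentSolution.partialDeriv_pressure_eq (h : IsComponentSolution γ mu lam ρ P u)
    (i : Fin d) (x : Space d) :
    partialDeriv i P x = -(ρ x * ∑ j, u j x * partialDeriv j (u i) x) +
      ∑ j, partialDeriv j (viscousStress mu lam u i j) x := by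
  rw [sum_partialDeriv_viscousStress h.contDiff_velocity, h.momentum i x]; ring

/-- Convection moved into the stress by the continuity equation. This form serves for `p > 4`, where
`ρ v⊗v` is locally square integrable. -/
theorem IsComponentSolution.partialDeriv_pressure_eq_divergence
    (h : IsComponentSolution γ mu lam ρ P u) (i : Fin d) (x : Space d) :
    partialDeriv i P x = ∑ j, partialDeriv j
      (fun y => viscousStress mu lam u i j y - ρ y * (u i y * u j y)) x := by
  have hu := h.contDiff_velocity
  have du := fun i => (hu i).differentiable (by simp) x
  have dρ := h.contDiff_density.differentiable (by simp) x
  rw [h.partialDeriv_pressure_eq]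
  have e : ∀ j, partialDeriv j (fun y => viscousStress mu lam u i j y - ρ y * (u i y * u j y)) x =
      partialDeriv j (viscousStress mu lam u i j) x - (ρ x * (u j x * partialDeriv j (u i) x) +
        u i x * (ρ x * partialDeriv j (u j) x + u j x * partialDeriv j ρ x)) := by
    intro j
    rw [partialDeriv_sub ((contDiff_viscousStress hu i j).differentiable (by simp) x)
      (dρ.fun_mul ((du i).fun_mul (du j))), partialDeriv_mul dρ ((du i).fun_mul (du j)),
      partialDeriv_mul (du i) (du j)]
    ring
  simp_rw [e]
  rw [Finset.sum_sub_distrib, Finset.sum_add_distrib, ← Finset.mul_sum, ← Finset.mul_sum,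
    h.continuity x]
  ring

theorem setNorm_indicator {r : ℝ} (hr : 0 < r) {s t : Set (Space d)} (hst : s ⊆ t)
    (hs : MeasurableSet s) (F : Space d → ℝ≥0∞) :
    setNorm r t (s.indicator F) = setNorm r s F := by
  have : (fun x => s.indicator F x ^ r) = s.indicator fun x => F x ^ r := by
    ext x
    by_cases hx : x ∈ s <;> simp [hx, hr]
  rw [setNorm, this, lintegral_indicator hs, Measure.restrict_restrict hs,
    Set.inter_eq_self_of_subset_left hst, setNorm]

theorem setNorm_const_mul {r : ℝ} (hr : 0 < r) {s : Set (Space d)} (C : ℝ≥0∞)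
    {F : Space d → ℝ≥0∞} (hF : Measurable F) :
    setNorm r s (fun x => C * F x) = C * setNorm r s F := by
  simp_rw [setNorm, ENNReal.mul_rpow_of_nonneg _ _ hr.le]
  rw [lintegral_const_mul _ (hF.pow_const r), ENNReal.mul_rpow_of_nonneg _ _ (by positivity),
    ← ENNReal.rpow_mul, mul_one_div_cancel hr.ne', ENNReal.rpow_one]

theorem setNorm_add_le {r : ℝ} (hr : 1 ≤ r) {s : Set (Space d)} {F G : Space d → ℝ≥0∞}
    (hF : Measurable F) (hG : Measurable G) :
    setNorm r s (fun x => F x + G x) ≤ setNorm r s F + setNorm r s G :=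
  ENNReal.lintegral_Lp_add_le hF.aemeasurable hG.aemeasurable hr

theorem setNorm_two_sq {s : Set (Space d)} (F : Space d → ℝ≥0∞) :
    setNorm 2 s (fun x => F x ^ 2) = setNorm 4 s F ^ 2 := by
  have e : ∀ x, (F x ^ 2) ^ (2 : ℝ) = F x ^ (4 : ℝ) := fun x => by
    rw [← ENNReal.rpow_natCast, ← ENNReal.rpow_mul]; norm_num
  simp_rw [setNorm, e]
  rw [← ENNReal.rpow_natCast, ← ENNReal.rpow_mul]; norm_num

/-- The indicator of the annulus is put into the weight `g`, so that the norms of `g` are taken over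
the annulus and can tend to zero. -/
theorem exists_setLIntegral_annulus_mul_sub_mollify_le (h : IsRadialKernel η Φ) {p q : ℝ}
    (hpq : p.HolderConjugate q) :
    ∃ C : ℝ≥0∞, C ≠ ⊤ ∧ ∀ R : ℝ, 0 < R → ∀ P : Space d → ℝ, ContDiff ℝ 1 P →
      ∀ f : Fin d → Space d → ℝ, (∀ i, Continuous (f i)) →
      ∀ T : Fin d → Fin d → Space d → ℝ, (∀ i j, ContDiff ℝ ∞ (T i j)) →
      (∀ i x, partialDeriv i P x = f i x + ∑ j, partialDeriv j (T i j) x) →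
      ∀ g : Space d → ℝ≥0∞, Measurable g → ∀ a b : ℝ≥0∞,
      (∀ i, setNorm q (Metric.closedBall 0 (3 * R)) (fun x => ‖f i x‖ₑ) ≤ a) →
      (∀ i j, setNorm 2 (Metric.closedBall 0 (6 * R)) (fun x => ‖T i j x‖ₑ) ≤ b) →
      ∫⁻ x in annulus d R, g x * ‖P x - mollify η R P 0‖ₑ ≤
        C * (ENNReal.ofReal R * (setNorm p (annulus d R) g * a) + setNorm 2 (annulus d R) g * b) := by
  obtain ⟨C, hC, hle⟩ := exists_setLIntegral_mul_sub_mollify_le h hpq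
  refine ⟨C * d + C * d ^ 2, by finiteness, fun R hR P hP f hf T hT hgrad g hg a b ha hb => ?_⟩
  have hm := measurableSet_annulus (d := d) R
  have hs := annulus_subset_closedBall (d := d) R
  have key := hle R hR P hP f hf T hT hgrad _ (hg.indicator hm)
  rw [setNorm_indicator hpq.pos hs hm, setNorm_indicator two_pos hs hm] at key
  have e : ∫⁻ x in Metric.closedBall 0 (2 * R), (annulus d R).indicator g x *
      ‖P x - mollify η R P 0‖ₑ = ∫⁻ x in annulus d R, g x * ‖P x - mollify η R P 0‖ₑ := by
    have : (fun x => (annulus d R).indicator g x * ‖P x - mollify η R P 0‖ₑ) =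
        (annulus d R).indicator fun x => g x * ‖P x - mollify η R P 0‖ₑ := by
      ext x; by_cases hx : x ∈ annulus d R <;> simp [hx]
    rw [this, lintegral_indicator hm, Measure.restrict_restrict hm,
      Set.inter_eq_self_of_subset_left hs]
  rw [e] at key
  refine key.trans ?_
  set α := setNorm p (annulus d R) g
  set β := setNorm 2 (annulus d R) g
  have s1 : ∑ i, α * setNorm q (Metric.closedBall 0 (3 * R)) (fun x => ‖f i x‖ₑ) ≤ d * (α * a) :=
    (Finset.sum_le_card_nsmul _ _ (α * a) fun i _ => mul_le_mul' le_rfl (ha i)).trans_eq (by simp)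
  have s2 : ∑ i, ∑ j, β * setNorm 2 (Metric.closedBall 0 (6 * R)) (fun x => ‖T i j x‖ₑ) ≤
      d * (d * (β * b)) :=
    (Finset.sum_le_card_nsmul _ _ (d * (β * b)) fun i _ =>
      (Finset.sum_le_card_nsmul _ _ (β * b) fun j _ => mul_le_mul' le_rfl (hb i j)).trans_eq
        (by simp)).trans_eq (by simp)
  calc _ ≤ C * (ENNReal.ofReal R * (d * (α * a)) + d * (d * (β * b))) := by gcongr
    _ = C * d * (ENNReal.ofReal R * (α * a)) + C * d ^ 2 * (β * b) := by ring
    _ ≤ (C * d + C * d ^ 2) * (ENNReal.ofReal R * (α * a)) + (C * d + C * d ^ 2) * (β * b) :=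
        add_le_add (mul_le_mul' le_self_add le_rfl) (mul_le_mul' le_add_self le_rfl)
    _ = _ := by ring

end

/-! ### The pressure boundary term -/

section

variable {d : ℕ} {γ mu lam : ℝ} {ρ P : Space d → ℝ} {u : Fin d → Space d → ℝ} {η Φ : Space d → ℝ}

/-- The pressure boundary term, when the convective stress `ρ v ⊗ v` is in `L²_loc`. -/
theorem IsComponentSolution.tendsto_pressure_of_four_lt (h : IsComponentSolution γ mu lam ρ P u)
    (hη : IsRadialKernel η Φ) (hmu : 0 ≤ mu) {w N : Space d → ℝ}
    (hw0 : ∀ x, 0 ≤ w x) (hwu : ∀ j x, |u j x| ≤ w x) (hwc : Continuous w) (hNc : Continuous N)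
    (hN : ∀ i j x, |partialDeriv j (u i) x| ≤ N x) (hN2 : ∫⁻ x, ENNReal.ofReal (N x) ^ (2 : ℝ) ≠ ⊤)
    {M : ℝ} (hM : ∀ x, |ρ x| ≤ M) {p : ℝ} (hp : 4 < p) (hθ : d * (1 - 3 / p) ≤ 1)
    (hwp : ∫⁻ x, ENNReal.ofReal (w x) ^ p ≠ ⊤) :
    Tendsto (fun n : ℕ => ENNReal.ofReal (n + 1 : ℝ)⁻¹ * ∫⁻ x in annulus d (n + 1),
      ENNReal.ofReal (w x) * ‖P x - mollify η (n + 1) P 0‖ₑ) atTop (𝓝 0) := by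
  have hM0 : 0 ≤ M := (abs_nonneg _).trans (hM 0)
  have hu := h.contDiff_velocity
  set W : Space d → ℝ≥0∞ := fun x => ENNReal.ofReal (w x) with hW
  set G : Space d → ℝ≥0∞ := fun x => ENNReal.ofReal (N x) with hG
  have mW : Measurable W := hwc.measurable.ennreal_ofReal
  have mG : Measurable G := hNc.measurable.ennreal_ofReal
  obtain ⟨C, hC, hle⟩ := exists_setLIntegral_annulus_mul_sub_mollify_le hη
    Real.HolderConjugate.two_two
  obtain ⟨C₂, hC₂, hle₂⟩ := exists_setNorm_le_setNorm (d := d) (r := 2) (p := p) two_pos (by linarith)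
  obtain ⟨C₄, hC₄, hle₄⟩ := exists_setNorm_le_setNorm (d := d) (r := 4) (p := p) four_pos hp
  set I := (∫⁻ x, W x ^ p) ^ (1 / p) with hI
  set J := (∫⁻ x, G x ^ (2 : ℝ)) ^ (1 / (2 : ℝ)) with hJ
  have hIt : I ≠ ⊤ := ENNReal.rpow_ne_top_of_nonneg (by positivity) hwp
  have hJt : J ≠ ⊤ := ENNReal.rpow_ne_top_of_nonneg (by positivity) hN2
  set K := ENNReal.ofReal (mu + |mu + lam| * d) with hK
  -- For `p ≥ 4` one has `1/2 - 1/p ≤ 1 - 3/p`, so the viscous condition follows from the convective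
  -- one.
  have hα1 : d * (1 / 2 - 1 / p) ≤ 1 := by
    refine le_trans (mul_le_mul_of_nonneg_left ?_ (Nat.cast_nonneg d)) hθ
    have : 1 / p ≤ 1 / 4 := one_div_le_one_div_of_le four_pos hp.le
    rw [show 3 / p = 3 * (1 / p) by ring]; linarith
  have lim1 := ENNReal.Tendsto.const_mul (tendsto_setNorm_annulus (by linarith) mW hwp)
    (Or.inr (show C * (C₂ * (ENNReal.ofReal M * (C₄ * I) ^ 2)) ≠ ⊤ by finiteness))
  have lim2 := ENNReal.Tendsto.const_mul
    (tendsto_inv_mul_setNorm_annulus two_pos (by linarith) hα1 mW hwp)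
    (Or.inr (show C * (K * J) ≠ ⊤ by finiteness))
  have lim := lim1.add lim2
  simp only [mul_zero, add_zero] at lim
  refine tendsto_of_tendsto_of_tendsto_of_le_of_le tendsto_const_nhds lim (fun _ => zero_le)
    fun n => ?_
  have hn : (1 : ℝ) ≤ n + 1 := by linarith [(Nat.cast_nonneg n : (0 : ℝ) ≤ n)]
  set R : ℝ := n + 1 with hR
  have h0 : 0 < R := by linarith
  have hT : ∀ i j, setNorm 2 (Metric.closedBall 0 (6 * R))
      (fun x => ‖viscousStress mu lam u i j x - ρ x * (u i x * u j x)‖ₑ) ≤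
      ENNReal.ofReal M * (C₄ * ENNReal.ofReal R ^ (d * (1 / 4 - 1 / p)) * I) ^ 2 + K * J := by
    intro i j
    calc _ ≤ setNorm 2 (Metric.closedBall 0 (6 * R))
          fun x => ENNReal.ofReal M * W x ^ 2 + K * G x := by
          refine setNorm_mono (by norm_num) le_rfl fun x => ?_
          have hwx := hw0 x
          have hNx : 0 ≤ N x := (abs_nonneg _).trans (hN i j x)
          rw [hW, hG, hK, ← ENNReal.ofReal_pow hwx, ← ENNReal.ofReal_mul hM0,
            ← ENNReal.ofReal_mul (by positivity), ← ENNReal.ofReal_add (by positivity) (by positivity)]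
          refine enorm_le_ofReal ?_
          rw [add_comm]
          refine (abs_sub _ _).trans (add_le_add (abs_viscousStress_le hmu (fun i j => hN i j x) i j) ?_)
          rw [abs_mul, abs_mul, sq]
          exact mul_le_mul (hM x) (mul_le_mul (hwu i x) (hwu j x) (abs_nonneg _) hwx)
            (by positivity) hM0
      _ ≤ setNorm 2 (Metric.closedBall 0 (6 * R)) (fun x => ENNReal.ofReal M * W x ^ 2) +
          setNorm 2 (Metric.closedBall 0 (6 * R)) fun x => K * G x :=
          setNorm_add_le (by norm_num) (by fun_prop) (by fun_prop)
      _ ≤ _ := by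
          rw [setNorm_const_mul two_pos _ (by fun_prop), setNorm_const_mul two_pos _ mG, setNorm_two_sq]
          refine add_le_add (mul_le_mul' le_rfl (pow_le_pow_left' ?_ 2))
            (mul_le_mul' le_rfl (setNorm_le (by norm_num)))
          exact (hle₄ R h0 _ le_rfl W mW).trans (mul_le_mul' le_rfl (setNorm_le (by linarith)))
  have key := hle R h0 P h.contDiff_pressure (fun _ _ => 0) (fun _ => continuous_const)
    (fun i j x => viscousStress mu lam u i j x - ρ x * (u i x * u j x))
    (fun i j => (contDiff_viscousStress hu i j).sub
      (h.contDiff_density.mul ((hu i).mul (hu j))))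
    (fun i x => by rw [zero_add]; exact h.partialDeriv_pressure_eq_divergence i x) W mW 0 _
    (fun i => by simp [setNorm]) hT
  rw [mul_zero, mul_zero, zero_add] at key
  -- One factor of `v` in `L²` and two in `L⁴`, all measured in `Lᵖ`, cost the exponent `d(1/2 -
  -- 1/p) + 2d(1/4 - 1/p) = d(1 - 3/p)`.
  have hexp : ENNReal.ofReal R⁻¹ * (ENNReal.ofReal R ^ (d * (1 / 2 - 1 / p)) *
      (ENNReal.ofReal R ^ (d * (1 / 4 - 1 / p))) ^ 2) ≤ 1 := by
    have hRt : ENNReal.ofReal R ≠ 0 := by simpa using h0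
    rw [← ENNReal.rpow_natCast, ← ENNReal.rpow_mul, ← ENNReal.rpow_add _ _ hRt ENNReal.ofReal_ne_top]
    refine ofReal_inv_mul_rpow_le_one hn (le_trans (le_of_eq ?_) hθ)
    push_cast; ring
  have h2 := hle₂ R h0 _ (annulus_subset_closedBall_six h0.le) W mW
  calc _ ≤ ENNReal.ofReal R⁻¹ * (C * (setNorm 2 (annulus d R) W * (ENNReal.ofReal M *
        (C₄ * ENNReal.ofReal R ^ (d * (1 / 4 - 1 / p)) * I) ^ 2 + K * J))) :=
        mul_le_mul' le_rfl key
    _ = C * (ENNReal.ofReal R⁻¹ * (setNorm 2 (annulus d R) W * (ENNReal.ofReal M *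
        (C₄ * ENNReal.ofReal R ^ (d * (1 / 4 - 1 / p)) * I) ^ 2))) +
        C * (K * J) * (ENNReal.ofReal R⁻¹ * setNorm 2 (annulus d R) W) := by ring
    _ ≤ C * (ENNReal.ofReal R⁻¹ * ((C₂ * ENNReal.ofReal R ^ (d * (1 / 2 - 1 / p)) *
          setNorm p (annulus d R) W) * (ENNReal.ofReal M *
        (C₄ * ENNReal.ofReal R ^ (d * (1 / 4 - 1 / p)) * I) ^ 2))) +
        C * (K * J) * (ENNReal.ofReal R⁻¹ * setNorm 2 (annulus d R) W) := by gcongr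
    _ = (ENNReal.ofReal R⁻¹ * (ENNReal.ofReal R ^ (d * (1 / 2 - 1 / p)) *
      (ENNReal.ofReal R ^ (d * (1 / 4 - 1 / p))) ^ 2)) *
        (C * (C₂ * (ENNReal.ofReal M * (C₄ * I) ^ 2)) * setNorm p (annulus d R) W) +
        C * (K * J) * (ENNReal.ofReal R⁻¹ * setNorm 2 (annulus d R) W) := by ring
    _ ≤ 1 * (C * (C₂ * (ENNReal.ofReal M * (C₄ * I) ^ 2)) * setNorm p (annulus d R) W) +
        C * (K * J) * (ENNReal.ofReal R⁻¹ * setNorm 2 (annulus d R) W) :=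
        add_le_add (mul_le_mul' hexp le_rfl) le_rfl
    _ = _ := by rw [one_mul]

/-- The pressure boundary term in dimension `d ≥ 4`, where the convective term `ρ v · ∇v` is in
`L^{d/(d-1)}`. -/
theorem IsComponentSolution.tendsto_pressure_of_four_le (h : IsComponentSolution γ mu lam ρ P u)
    (hd : 4 ≤ d) (hη : IsRadialKernel η Φ) (hmu : 0 ≤ mu) {w N g : Space d → ℝ}
    (hw0 : ∀ x, 0 ≤ w x) (hwu : ∀ j x, |u j x| ≤ w x) (hwc : Continuous w) (hNc : Continuous N)
    (hN : ∀ i j x, |partialDeriv j (u i) x| ≤ N x) (hN2 : ∫⁻ x, ENNReal.ofReal (N x) ^ (2 : ℝ) ≠ ⊤)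
    {M : ℝ} (hM : ∀ x, |ρ x| ≤ M) {p : ℝ} (hp : p = 2 * d / (d - 2))
    (hwp : ∫⁻ x, ENNReal.ofReal (w x) ^ p ≠ ⊤) {B : ℝ} (hgc : Continuous g)
    (hgw : ∀ x, g x ≤ w x) (hB0 : 0 ≤ B) (hgB : ∀ x, g x ≤ B * w x ^ (p / d)) :
    Tendsto (fun n : ℕ => ENNReal.ofReal (n + 1 : ℝ)⁻¹ * ∫⁻ x in annulus d (n + 1),
      ENNReal.ofReal (g x) * ‖P x - mollify η (n + 1) P 0‖ₑ) atTop (𝓝 0) := by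
  have hM0 : 0 ≤ M := (abs_nonneg _).trans (hM 0)
  have hu := h.contDiff_velocity
  have hd' : (4 : ℝ) ≤ d := by exact_mod_cast hd
  have hp2 : 2 < p := by rw [hp, lt_div_iff₀ (by linarith)]; linarith
  -- Since `1/q = 1/p + 1/2`, Hölder puts `v·∇v` in `L^q`. The conjugate exponent is `d`, and the
  -- factor `R` of the oscillation estimate cancels `R⁻¹` exactly; decay comes from the `L^d` norm
  -- of `g` over the annulus.
  set q : ℝ := d / (d - 1) with hq
  have hq0 : 0 < q := div_pos (by linarith) (by linarith)
  have hdq : (d : ℝ).HolderConjugate q := by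
    rw [Real.holderConjugate_iff]
    refine ⟨by linarith, ?_⟩
    rw [hq]; field_simp; ring
  have hpq : 1 / q = 1 / p + 1 / 2 := by
    have : (d : ℝ) - 1 ≠ 0 := by linarith
    have : (d : ℝ) - 2 ≠ 0 := by linarith
    rw [hp, hq]; field_simp; ring
  have hqp : q < p := by
    have : 1 / p < 1 / q := by rw [hpq]; linarith
    exact lt_of_one_div_lt_one_div (by linarith) this
  set W : Space d → ℝ≥0∞ := fun x => ENNReal.ofReal (w x) with hW
  set G : Space d → ℝ≥0∞ := fun x => ENNReal.ofReal (N x) with hG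
  set H : Space d → ℝ≥0∞ := fun x => ENNReal.ofReal (g x) with hH
  have mW : Measurable W := hwc.measurable.ennreal_ofReal
  have mG : Measurable G := hNc.measurable.ennreal_ofReal
  have mH : Measurable H := hgc.measurable.ennreal_ofReal
  obtain ⟨C, hC, hle⟩ := exists_setLIntegral_annulus_mul_sub_mollify_le hη hdq
  set I := (∫⁻ x, W x ^ p) ^ (1 / p) with hI
  set J := (∫⁻ x, G x ^ (2 : ℝ)) ^ (1 / (2 : ℝ)) with hJ
  have hIt : I ≠ ⊤ := ENNReal.rpow_ne_top_of_nonneg (by positivity) hwp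
  have hJt : J ≠ ⊤ := ENNReal.rpow_ne_top_of_nonneg (by positivity) hN2
  set K := ENNReal.ofReal (mu + |mu + lam| * d) with hK
  set L := ENNReal.ofReal (M * d) with hL
  have hα : d * (1 / 2 - 1 / p) ≤ 1 := by
    have : (d : ℝ) - 2 ≠ 0 := by linarith
    rw [hp]; apply le_of_eq; field_simp; ring
  have hHd : ∀ x, H x ≤ ENNReal.ofReal B * W x ^ (p / d) := fun x => by
    rw [hH, hW, ENNReal.ofReal_rpow_of_nonneg (hw0 x) (by positivity), ← ENNReal.ofReal_mul hB0]
    exact ENNReal.ofReal_le_ofReal (hgB x)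
  -- The exponent `p/d` is chosen so that the `L^d` norm of the majorant of `g` is a power of `∫
  -- wᵖ`, which vanishes over far annuli.
  have hnorm : ∀ s, setNorm d s (fun x => W x ^ (p / d)) = (∫⁻ x in s, W x ^ p) ^ (1 / (d : ℝ)) := by
    intro s
    simp_rw [setNorm, ← ENNReal.rpow_mul, div_mul_cancel₀ p (show (d : ℝ) ≠ 0 by linarith)]
  have limd := (tendsto_setLIntegral_annulus (mW.pow_const p) hwp).ennrpow_const (1 / (d : ℝ))
  rw [ENNReal.zero_rpow_of_pos (by positivity)] at limd
  have lim1 := ENNReal.Tendsto.const_mul limd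
    (Or.inr (show C * ENNReal.ofReal B * (L * (I * J)) ≠ ⊤ by finiteness))
  have lim2 := ENNReal.Tendsto.const_mul
    (tendsto_inv_mul_setNorm_annulus two_pos hp2 hα mW hwp)
    (Or.inr (show C * (K * J) ≠ ⊤ by finiteness))
  have lim := lim1.add lim2
  simp only [mul_zero, add_zero] at lim
  refine tendsto_of_tendsto_of_tendsto_of_le_of_le tendsto_const_nhds lim (fun _ => zero_le)
    fun n => ?_
  have h0 : (0 : ℝ) < n + 1 := by positivity
  set R : ℝ := n + 1 with hR
  have hf : ∀ i, setNorm q (Metric.closedBall 0 (3 * R))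
      (fun x => ‖-(ρ x * ∑ j, u j x * partialDeriv j (u i) x)‖ₑ) ≤ L * (I * J) := by
    intro i
    calc _ ≤ setNorm q (Metric.closedBall 0 (3 * R)) fun x => L * (W x * G x) := by
          refine setNorm_mono hq0.le le_rfl fun x => ?_
          have hwx := hw0 x
          rw [hW, hG, hL, ← ENNReal.ofReal_mul hwx, ← ENNReal.ofReal_mul (by positivity)]
          refine enorm_le_ofReal ?_
          rw [abs_neg, abs_mul, mul_assoc]
          refine mul_le_mul (hM x) ?_ (abs_nonneg _) hM0
          refine (Finset.abs_sum_le_sum_abs _ _).trans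
            ((Finset.sum_le_card_nsmul _ _ (w x * N x) ?_).trans (by simp))
          intro j _; rw [abs_mul]; exact mul_le_mul (hwu j x) (hN i j x) (abs_nonneg _) hwx
      _ ≤ L * (setNorm p (Metric.closedBall 0 (3 * R)) W *
          setNorm 2 (Metric.closedBall 0 (3 * R)) G) := by
          rw [setNorm_const_mul hq0 _ (by fun_prop)]
          exact mul_le_mul' le_rfl (setNorm_mul_le hq0 hqp hpq mW mG)
      _ ≤ _ := mul_le_mul' le_rfl
          (mul_le_mul' (setNorm_le (by linarith)) (setNorm_le (by norm_num)))
  have hT : ∀ i j, setNorm 2 (Metric.closedBall 0 (6 * R))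
      (fun x => ‖viscousStress mu lam u i j x‖ₑ) ≤ K * J := by
    intro i j
    calc _ ≤ setNorm 2 (Metric.closedBall 0 (6 * R)) fun x => K * G x := by
          refine setNorm_mono (by norm_num) le_rfl fun x => ?_
          rw [hG, hK, ← ENNReal.ofReal_mul (by positivity)]
          exact enorm_le_ofReal (abs_viscousStress_le hmu (fun i j => hN i j x) i j)
      _ ≤ _ := by
          rw [setNorm_const_mul two_pos _ mG]
          exact mul_le_mul' le_rfl (setNorm_le (by norm_num))
  have cD := fun i j => (contDiff_partialDeriv (hu i) j).continuous
  have cu := fun i => (hu i).continuous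
  have cρ := h.contDiff_density.continuous
  have key := hle R h0 P h.contDiff_pressure
    (fun i x => -(ρ x * ∑ j, u j x * partialDeriv j (u i) x)) (fun i => by fun_prop)
    (viscousStress mu lam u) (contDiff_viscousStress hu) h.partialDeriv_pressure_eq H mH _ _ hf hT
  have hR1 : ENNReal.ofReal R⁻¹ * ENNReal.ofReal R = 1 := by
    rw [← ENNReal.ofReal_mul (by positivity), inv_mul_cancel₀ h0.ne', ENNReal.ofReal_one]
  have hH1 : setNorm d (annulus d R) H ≤
      ENNReal.ofReal B * (∫⁻ x in annulus d R, W x ^ p) ^ (1 / (d : ℝ)) := by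
    rw [← hnorm, ← setNorm_const_mul (by linarith) _ (by fun_prop)]
    exact setNorm_mono (by linarith) le_rfl hHd
  have hH2 : setNorm 2 (annulus d R) H ≤ setNorm 2 (annulus d R) W :=
    setNorm_mono (by norm_num) le_rfl fun x => ENNReal.ofReal_le_ofReal (hgw x)
  calc _ ≤ ENNReal.ofReal R⁻¹ * (C * (ENNReal.ofReal R * (setNorm d (annulus d R) H * (L * (I * J))) +
          setNorm 2 (annulus d R) H * (K * J))) := mul_le_mul' le_rfl key
    _ = (ENNReal.ofReal R⁻¹ * ENNReal.ofReal R) * (C * (setNorm d (annulus d R) H * (L * (I * J)))) +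
          C * (K * J) * (ENNReal.ofReal R⁻¹ * setNorm 2 (annulus d R) H) := by ring
    _ ≤ (ENNReal.ofReal R⁻¹ * ENNReal.ofReal R) * (C * ((ENNReal.ofReal B *
          (∫⁻ x in annulus d R, W x ^ p) ^ (1 / (d : ℝ))) * (L * (I * J)))) +
          C * (K * J) * (ENNReal.ofReal R⁻¹ * setNorm 2 (annulus d R) W) := by gcongr
    _ = _ := by rw [hR1]; ring

end

/-! ### The multiple of the density, and vanishing of the velocity gradient -/

section

variable {d : ℕ} {A γ mu lam : ℝ} {ρ : Space d → ℝ} {u : Fin d → Space d → ℝ} {η Φ : Space d → ℝ}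

theorem mollify_mem_Icc (h : IsRadialKernel η Φ) {f : Space d → ℝ} (hf : Continuous f) {K : ℝ}
    (h0 : ∀ x, 0 ≤ f x) (hK : ∀ x, f x ≤ K) (R : ℝ) (x : Space d) :
    mollify η R f x ∈ Set.Icc 0 K := by
  have hc := h.continuous
  have hi : Integrable fun y => η y * f (x - R • y) :=
    Continuous.integrable_of_hasCompactSupport (by fun_prop) h.hasCompactSupport.mul_right
  refine ⟨integral_nonneg fun y => mul_nonneg (h.nonneg y) (h0 _), ?_⟩
  calc mollify η R f x ≤ ∫ y, η y * K :=
        integral_mono hi ((hc.integrable_of_hasCompactSupport h.hasCompactSupport).mul_const K)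
          fun y => mul_le_mul_of_nonneg_left (hK _) (h.nonneg y)
    _ = K := by rw [integral_mul_const, h.integral_eq_one, one_mul]

/-- As `r ↦ r^(γ-1)` is increasing, `t^(γ-1) s` lies between `s^γ` and `t^γ`. -/
theorem abs_rpow_sub_mul_le {s t : ℝ} (hγ : 1 < γ) (hs : 0 ≤ s) (ht : 0 ≤ t) :
    |s ^ γ - t ^ (γ - 1) * s| ≤ |s ^ γ - t ^ γ| := by
  have hpow : ∀ r : ℝ, 0 ≤ r → r ^ γ = r ^ (γ - 1) * r := by
    intro r hr
    rcases hr.eq_or_lt with rfl | h0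
    · rw [Real.zero_rpow (by linarith), mul_zero]
    · rw [← Real.rpow_add_one h0.ne']; simp
  rw [hpow s hs, hpow t ht]
  have hs' := Real.rpow_nonneg hs (γ - 1)
  have ht' := Real.rpow_nonneg ht (γ - 1)
  rcases le_total s t with hst | hst
  · have := Real.rpow_le_rpow hs hst (z := γ - 1) (by linarith)
    rw [abs_of_nonpos (by nlinarith), abs_of_nonpos (by nlinarith)]
    nlinarith
  · have := Real.rpow_le_rpow ht hst (z := γ - 1) (by linarith)
    rw [abs_of_nonneg (by nlinarith), abs_of_nonneg (by nlinarith)]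
    nlinarith

/-- The pressure is compared with its average through a multiple of the density. -/
theorem exists_abs_pressure_sub_mul_le (hA : 0 < A) (hγ : 1 < γ) (hρ0 : ∀ x, 0 ≤ ρ x) {M : ℝ}
    (hM : ∀ x, ρ x ≤ M) {m : ℝ} (hm : m ∈ Set.Icc 0 (A * M ^ γ)) :
    ∃ c : ℝ, ∀ x, |A * ρ x ^ γ - c * ρ x| ≤ |A * ρ x ^ γ - m| ∧
      |A * ρ x ^ γ - c * ρ x| ≤ A * M ^ γ := by
  -- `t` is the density at which the pressure equals `m`; there `cρ` with `c = A t^(γ-1)` also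
  -- equals `m`.
  set t := (m / A) ^ (1 / γ) with ht
  have hmA : 0 ≤ m / A := div_nonneg hm.1 hA.le
  have htγ : A * t ^ γ = m := by
    rw [ht, ← Real.rpow_mul hmA, one_div_mul_cancel (by linarith), Real.rpow_one]; field_simp
  have h1 : ∀ x, |A * ρ x ^ γ - A * t ^ (γ - 1) * ρ x| ≤ |A * ρ x ^ γ - m| := by
    intro x
    rw [← htγ, mul_assoc, ← mul_sub, ← mul_sub, abs_mul, abs_mul]
    exact mul_le_mul_of_nonneg_left (abs_rpow_sub_mul_le hγ (hρ0 x) (Real.rpow_nonneg hmA _))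
      (abs_nonneg _)
  refine ⟨A * t ^ (γ - 1), fun x => ⟨h1 x, (h1 x).trans ?_⟩⟩
  have h2 := mul_nonneg hA.le (Real.rpow_nonneg (hρ0 x) γ)
  have h3 := mul_le_mul_of_nonneg_left
    (Real.rpow_le_rpow (hρ0 x) (hM x) (by linarith : 0 ≤ γ)) hA.le
  rw [abs_le]
  exact ⟨by linarith [hm.2], by linarith [hm.1]⟩

theorem lintegral_ofReal_rpow_ne_top {f : Space d → ℝ} {r : ℝ} (hf : ∀ x, 0 ≤ f x) (hr : 0 ≤ r)
    (hi : Integrable fun x => f x ^ r) : ∫⁻ x, ENNReal.ofReal (f x) ^ r ≠ ⊤ := by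
  simp_rw [fun x => ENNReal.ofReal_rpow_of_nonneg (hf x) hr]
  exact hi.lintegral_lt_top.ne

/-- Liouville theorem for velocities in `Lᵖ` with `p > 4` and `d (1 - 3 / p) ≤ 1`. -/
theorem IsComponentSolution.partialDeriv_eq_zero_of_four_lt
    (h : IsComponentSolution γ mu lam ρ (fun y => A * ρ y ^ γ) u) (hd : 0 < d)
    (hA : 0 < A) (hγ : 1 < γ) (hmu : 0 < mu) (hlam : 0 < lam + 2 * mu) (hρ0 : ∀ x, 0 ≤ ρ x)
    {w N : Space d → ℝ} (hw0 : ∀ x, 0 ≤ w x) (hwS : ∀ x, w x ^ 2 = sqSpeed u x)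
    (hwu : ∀ j x, |u j x| ≤ w x) (hwc : Continuous w) (hNc : Continuous N) (hN0 : ∀ x, 0 ≤ N x)
    (hN : ∀ i j x, |partialDeriv j (u i) x| ≤ N x) (hN2 : Integrable fun x => N x ^ 2)
    {M : ℝ} (hM : ∀ x, ρ x ≤ M) {p : ℝ} (hp : 4 < p) (hθ : d * (1 - 3 / p) ≤ 1)
    (hwp : Integrable fun x => w x ^ p) (i j : Fin d) (x : Space d) :
    partialDeriv j (u i) x = 0 := by
  obtain ⟨η, Φ, hη⟩ := exists_isRadialKernel hd
  have hM' : ∀ x, |ρ x| ≤ M := fun x => by rw [abs_of_nonneg (hρ0 x)]; exact hM x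
  have hP0 : ∀ x, 0 ≤ A * ρ x ^ γ := fun x => mul_nonneg hA.le (Real.rpow_nonneg (hρ0 x) γ)
  have hPM : ∀ x, A * ρ x ^ γ ≤ A * M ^ γ := fun x =>
    mul_le_mul_of_nonneg_left (Real.rpow_le_rpow (hρ0 x) (hM x) (by linarith)) hA.le
  have hR0 : ∀ n : ℕ, (0 : ℝ) < n + 1 := fun n => by positivity
  have hR : Tendsto (fun n : ℕ => (n + 1 : ℝ)) atTop atTop :=
    tendsto_natCast_atTop_atTop.atTop_add tendsto_const_nhds
  choose c hc using fun n : ℕ => exists_abs_pressure_sub_mul_le hA hγ hρ0 hM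
    (mollify_mem_Icc hη h.contDiff_pressure.continuous hP0 hPM (n + 1) 0)
  have iw := lintegral_ofReal_rpow_ne_top hw0 (by linarith) hwp
  have iN : ∫⁻ x, ENNReal.ofReal (N x) ^ (2 : ℝ) ≠ ⊤ :=
    lintegral_ofReal_rpow_ne_top hN0 (by norm_num) (by simpa using hN2)
  have mW : Measurable fun x => ENNReal.ofReal (w x) := hwc.measurable.ennreal_ofReal
  have mN : Measurable fun x => ENNReal.ofReal (N x) := hNc.measurable.ennreal_ofReal
  have hα1 : d * (1 / 2 - 1 / p) ≤ 1 := by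
    refine le_trans (mul_le_mul_of_nonneg_left ?_ (Nat.cast_nonneg d)) hθ
    have : 1 / p ≤ 1 / 4 := one_div_le_one_div_of_le four_pos hp.le
    rw [show 3 / p = 3 * (1 / p) by ring]; linarith
  have lim3 := tendsto_inv_mul_setLIntegral_mul (by linarith) hα1 mW mN iN iw
  simp_rw [← ENNReal.ofReal_mul (hN0 _)] at lim3
  have lim1 := tendsto_inv_mul_setLIntegral_rpow three_pos (by linarith) hθ mW iw
  have e1 : ∀ x, speedPrimitive u 0 x * w x = w x ^ 3 := fun x => by
    rw [speedPrimitive, ← hwS]; ring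
  have lim2 := h.tendsto_pressure_of_four_lt hη hmu.le hw0 hwu hwc hNc hN iN hM' hp hθ iw
  -- No truncation is needed here: with `ε = 0` the weight is `1` and the right-hand side of the
  -- energy inequality is zero.
  have hweight : ∀ x, weightError u 0 x = 0 := fun x => by simp [weightError]
  have key := h.weighted_energy_le hγ hmu.le le_rfl hw0 hwS hwu hwc hNc hN0 hN hN2 hM' hR0 hR
    (c := c) (fun n x => (hc n x).2) ?_ ?_ lim3 ?_
  · have hdiv := integral_sq_divergence_le h.contDiff_velocity hw0 hwu hN0 hwc hNc hN hN2 hR0 hR lim3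
    refine partialDeriv_eq_zero_of_integral_dissipation_le h.contDiff_velocity hmu hlam hN hN2 hdiv
      ?_ i j x
    simpa [hweight, speedWeight] using key
  · refine lim1.congr fun n => ?_
    congr 1
    refine lintegral_congr fun x => ?_
    rw [e1, ENNReal.ofReal_pow (hw0 x)]
    exact ENNReal.rpow_natCast _ 3
  · refine tendsto_of_tendsto_of_tendsto_of_le_of_le tendsto_const_nhds lim2 (fun _ => zero_le)
      fun n => mul_le_mul' le_rfl (lintegral_mono fun x => ?_)
    rw [ENNReal.ofReal_mul (mul_nonneg (hw0 x) (speedWeight_nonneg x)), Real.enorm_eq_ofReal_abs]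
    refine mul_le_mul' ?_ (ENNReal.ofReal_le_ofReal (hc n x).1)
    simp [speedWeight]
  · simp [hweight]

/-- A truncated quantity is compared with `w^s` separately for slow and fast speeds. Only the fast
regime loses a factor `ε⁻¹`, harmless because `R → ∞` is taken at fixed `ε`. -/
theorem le_rpow_div_of_mul_le {b w ε s : ℝ} (hw : 0 ≤ w) (hε0 : 0 < ε) (hε1 : ε ≤ 1)
    (h1 : w ≤ 1 → b ≤ w ^ s) (h2 : 1 ≤ w → ε * b ≤ w ^ s) :
    b ≤ ε⁻¹ * w ^ s := by
  rw [← div_eq_inv_mul, le_div_iff₀ hε0]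
  rcases le_total w 1 with h | h
  · have := h1 h
    have := Real.rpow_nonneg hw s
    nlinarith
  · linarith [h2 h]

/-- The left side is at most `w³` for small speeds and `ε⁻¹ w` for large ones, so every exponent
between `1` and `3` is available. -/
theorem speedPrimitive_mul_le {ε a w : ℝ} {x : Space d} (hε0 : 0 < ε) (hε1 : ε ≤ 1) (hw : 0 ≤ w)
    (hwS : w ^ 2 = sqSpeed u x) (ha1 : 1 ≤ a) (ha3 : a ≤ 3) :
    speedPrimitive u ε x * w ≤ ε⁻¹ * w ^ a := by
  have hpos := one_add_sqSpeed_pos (u := u) hε0.le x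
  have hS := sqSpeed_nonneg (u := u) x
  have hεS := mul_nonneg hε0.le hS
  refine le_rpow_div_of_mul_le hw hε0 hε1 (fun h => ?_) (fun h => ?_)
  · rcases hw.eq_or_lt with rfl | hw'
    · rw [mul_zero]; exact Real.rpow_nonneg le_rfl a
    calc speedPrimitive u ε x * w ≤ w ^ 2 * w := by
          rw [hwS]
          exact mul_le_mul_of_nonneg_right
            (mul_le_of_le_one_right hS (inv_le_one_of_one_le₀ (by linarith))) hw
      _ = w ^ (3 : ℝ) := by rw [← pow_succ]; exact (Real.rpow_natCast w 3).symm
      _ ≤ w ^ a := Real.rpow_le_rpow_of_exponent_ge hw' h ha3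
  · calc ε * (speedPrimitive u ε x * w) = (ε * sqSpeed u x * (1 + ε * sqSpeed u x)⁻¹) * w := by
          rw [speedPrimitive]; ring
      _ ≤ 1 * w := by
          refine mul_le_mul_of_nonneg_right ?_ hw
          rw [← div_eq_mul_inv, div_le_one hpos]; linarith
      _ = w ^ (1 : ℝ) := by simp
      _ ≤ w ^ a := Real.rpow_le_rpow_of_exponent_le h ha1

/-- The weighted speed is at most `w` for small speeds and `ε⁻¹` for large ones, so every exponent
between `0` and `1` is available; `p/d` is the one needed. -/
theorem mul_speedWeight_le {ε a w : ℝ} {x : Space d} (hε0 : 0 < ε) (hε1 : ε ≤ 1) (hw : 0 ≤ w)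
    (hwS : w ^ 2 = sqSpeed u x) (ha0 : 0 ≤ a) (ha1 : a ≤ 1) :
    w * speedWeight u ε x ≤ ε⁻¹ * w ^ a := by
  have hpos := one_add_sqSpeed_pos (u := u) hε0.le x
  have hth := speedWeight_nonneg (u := u) (ε := ε) x
  have hle := speedWeight_le_one (u := u) hε0.le x
  refine le_rpow_div_of_mul_le hw hε0 hε1 (fun h => ?_) (fun h => ?_)
  · rcases hw.eq_or_lt with rfl | hw'
    · rw [zero_mul]; exact Real.rpow_nonneg le_rfl a
    calc w * speedWeight u ε x ≤ w ^ (1 : ℝ) := by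
          rw [Real.rpow_one]; exact mul_le_of_le_one_right hw hle
      _ ≤ w ^ a := Real.rpow_le_rpow_of_exponent_ge hw' h ha1
  · refine le_trans ?_ (Real.one_le_rpow h ha0)
    rw [speedWeight, ← mul_assoc, ← div_eq_mul_inv, div_le_one (by positivity), ← hwS]
    have : w ≤ w ^ 2 := by nlinarith
    nlinarith [sq_nonneg (ε * w ^ 2), mul_le_mul_of_nonneg_left this hε0.le,
      mul_nonneg hε0.le (sq_nonneg w)]

/-- Liouville theorem in dimension `d ≥ 4`, for velocities in `L^{2d/(d-2)}`. -/
theorem IsComponentSolution.partialDeriv_eq_zero_of_four_le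
    (h : IsComponentSolution γ mu lam ρ (fun y => A * ρ y ^ γ) u) (hd : 4 ≤ d)
    (hA : 0 < A) (hγ : 1 < γ) (hmu : 0 < mu) (hlam : 0 < lam + 2 * mu) (hρ0 : ∀ x, 0 ≤ ρ x)
    {w N : Space d → ℝ} (hw0 : ∀ x, 0 ≤ w x) (hwS : ∀ x, w x ^ 2 = sqSpeed u x)
    (hwu : ∀ j x, |u j x| ≤ w x) (hwc : Continuous w) (hNc : Continuous N) (hN0 : ∀ x, 0 ≤ N x)
    (hN : ∀ i j x, |partialDeriv j (u i) x| ≤ N x) (hN2 : Integrable fun x => N x ^ 2)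
    {M : ℝ} (hM : ∀ x, ρ x ≤ M) {p : ℝ} (hp : p = 2 * d / (d - 2))
    (hwp : Integrable fun x => w x ^ p) (i j : Fin d) (x : Space d) :
    partialDeriv j (u i) x = 0 := by
  obtain ⟨η, Φ, hη⟩ := exists_isRadialKernel (d := d) (by lia)
  have hd' : (4 : ℝ) ≤ d := by exact_mod_cast hd
  have hd2 : (d : ℝ) - 2 ≠ 0 := by linarith
  have hp2 : 2 < p := by rw [hp, lt_div_iff₀ (by linarith)]; linarith
  have hp4 : p ≤ 4 := by rw [hp, div_le_iff₀ (by linarith)]; linarith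
  have hM' : ∀ x, |ρ x| ≤ M := fun x => by rw [abs_of_nonneg (hρ0 x)]; exact hM x
  have hM0 : 0 ≤ M := (hρ0 0).trans (hM 0)
  have hP0 : ∀ x, 0 ≤ A * ρ x ^ γ := fun x => mul_nonneg hA.le (Real.rpow_nonneg (hρ0 x) γ)
  have hPM : ∀ x, A * ρ x ^ γ ≤ A * M ^ γ := fun x =>
    mul_le_mul_of_nonneg_left (Real.rpow_le_rpow (hρ0 x) (hM x) (by linarith)) hA.le
  have hR0 : ∀ n : ℕ, (0 : ℝ) < n + 1 := fun n => by positivity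
  have hR : Tendsto (fun n : ℕ => (n + 1 : ℝ)) atTop atTop :=
    tendsto_natCast_atTop_atTop.atTop_add tendsto_const_nhds
  choose c hc using fun n : ℕ => exists_abs_pressure_sub_mul_le hA hγ hρ0 hM
    (mollify_mem_Icc hη h.contDiff_pressure.continuous hP0 hPM (n + 1) 0)
  have iw := lintegral_ofReal_rpow_ne_top hw0 (by linarith) hwp
  have iN : ∫⁻ x, ENNReal.ofReal (N x) ^ (2 : ℝ) ≠ ⊤ :=
    lintegral_ofReal_rpow_ne_top hN0 (by norm_num) (by simpa using hN2)
  have mW : Measurable fun x => ENNReal.ofReal (w x) := hwc.measurable.ennreal_ofReal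
  have mN : Measurable fun x => ENNReal.ofReal (N x) := hNc.measurable.ennreal_ofReal
  have hα1 : d * (1 / 2 - 1 / p) ≤ 1 := by
    rw [hp]; apply le_of_eq; field_simp; ring
  have lim3 := tendsto_inv_mul_setLIntegral_mul hp2 hα1 mW mN iN iw
  simp_rw [← ENNReal.ofReal_mul (hN0 _)] at lim3
  -- This exponent makes `d(1 - a/p) = 1`, the critical scaling on the annulus. It equals
  -- `2(d-1)/(d-2)`, which lies in `[1, 3]` precisely because `d ≥ 4`.
  set a : ℝ := p * (d - 1) / d with ha
  have hap : a < p := by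
    rw [ha, div_lt_iff₀ (by linarith)]; nlinarith
  have ha1 : 1 ≤ a := by
    rw [ha, le_div_iff₀ (by linarith)]; nlinarith
  have ha3 : a ≤ 3 := by
    have : a = 2 * (d - 1) / (d - 2) := by rw [ha, hp]; field_simp
    rw [this, div_le_iff₀ (by linarith)]; linarith
  have hθ : d * (1 - a / p) ≤ 1 := by
    have : p ≠ 0 := by linarith
    rw [ha]; apply le_of_eq; field_simp; ring
  have lim1 := tendsto_inv_mul_setLIntegral_rpow (by linarith) hap hθ mW iw
  have hdiv := integral_sq_divergence_le h.contDiff_velocity hw0 hwu hN0 hwc hNc hN hN2 hR0 hR lim3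
  refine partialDeriv_eq_zero_of_integral_dissipation_le h.contDiff_velocity hmu hlam hN hN2 hdiv
    ?_ i j x
  refine integral_dissipation_le_zero h.contDiff_velocity hmu.le hw0 hwS hNc hN0 hN hN2
    (by linarith) hp4 hwp (A := γ / (γ - 1) * (A * M ^ γ)) (B := d * (mu + |mu + lam|))
    (K := 4 * d ^ 2) ?_ (by positivity) fun ε hε0 hε1 hZ => ?_
  · exact mul_nonneg (div_nonneg (by linarith) (by linarith)) (by positivity)
  refine h.weighted_energy_le hγ hmu.le hε0.le hw0 hwS hwu hwc hNc hN0 hN hN2 hM' hR0 hR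
    (c := c) (fun n x => (hc n x).2) ?_ ?_ lim3 hZ
  · have lim1' := ENNReal.Tendsto.const_mul lim1 (Or.inr (ENNReal.ofReal_ne_top (r := ε⁻¹)))
    rw [mul_zero] at lim1'
    refine tendsto_of_tendsto_of_tendsto_of_le_of_le tendsto_const_nhds lim1' (fun _ => zero_le)
      fun n => ?_
    rw [mul_left_comm]
    refine mul_le_mul' le_rfl (setLIntegral_le_mul (by fun_prop) fun x => ?_)
    rw [ENNReal.ofReal_rpow_of_nonneg (hw0 x) (by linarith), ← ENNReal.ofReal_mul (by positivity)]
    exact ENNReal.ofReal_le_ofReal (speedPrimitive_mul_le hε0 hε1 (hw0 x) (hwS x) ha1 ha3)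
  · have cth := (contDiff_speedWeight h.contDiff_velocity hε0.le).continuous
    have hpd0 : 0 ≤ p / d := by positivity
    have hpd1 : p / d ≤ 1 := by rw [div_le_one (by linarith)]; linarith
    have lim2 := h.tendsto_pressure_of_four_le hd hη hmu.le hw0 hwu hwc hNc hN iN hM' hp iw
      (g := fun x => w x * speedWeight u ε x) (B := ε⁻¹) (by fun_prop)
      (fun x => mul_le_of_le_one_right (hw0 x) (speedWeight_le_one hε0.le x)) (by positivity)
      (fun x => mul_speedWeight_le hε0 hε1 (hw0 x) (hwS x) hpd0 hpd1)
    refine tendsto_of_tendsto_of_tendsto_of_le_of_le tendsto_const_nhds lim2 (fun _ => zero_le)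
      fun n => mul_le_mul' le_rfl (lintegral_mono fun x => ?_)
    rw [ENNReal.ofReal_mul (mul_nonneg (hw0 x) (speedWeight_nonneg x)), Real.enorm_eq_ofReal_abs]
    exact mul_le_mul' le_rfl (ENNReal.ofReal_le_ofReal (hc n x).1)

end

/-! ### Smooth vector fields in `Ḣ¹` -/

section

variable {d : ℕ} {v : Space d → Space d}

theorem partialDeriv_coord (hv : Differentiable ℝ v) (i j : Fin d) (x : Space d) :
    partialDeriv j (fun y => v y i) x = (fderiv ℝ v x (EuclideanSpace.single j 1)) i := by
  have := ((EuclideanSpace.proj i : Space d →L[ℝ] ℝ).hasFDerivAt.comp x (hv x).hasFDerivAt).fderiv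
  simp only [Function.comp_def] at this
  rw [partialDeriv]
  exact congrArg (fun L : Space d →L[ℝ] ℝ => L (EuclideanSpace.single j 1)) this

theorem abs_partialDeriv_coord_le (hv : Differentiable ℝ v) (i j : Fin d) (x : Space d) :
    |partialDeriv j (fun y => v y i) x| ≤ ‖fderiv ℝ v x‖ := by
  rw [partialDeriv_coord hv]
  refine (abs_coord_le _ i).trans ?_
  simpa using (fderiv ℝ v x).le_opNorm (EuclideanSpace.single j 1)

theorem lintegral_le_of_closedBall {F : Space d → ℝ≥0∞} {C : ℝ≥0∞}
    (h : ∀ k : ℕ, ∫⁻ x in Metric.closedBall 0 (k : ℝ), F x ≤ C) : ∫⁻ x, F x ≤ C := by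
  rw [← setLIntegral_univ, ← Metric.iUnion_closedBall_nat (0 : Space d),
    setLIntegral_iUnion_of_directed]
  · exact iSup_le h
  · exact Monotone.directed_le fun m n hmn =>
      Metric.closedBall_subset_closedBall (by exact_mod_cast hmn)

/-- On each ball, convergence in `L¹` yields an almost everywhere convergent subsequence, and
Fatou's lemma applies. The bound is the same for all balls, which exhaust the space. -/
theorem lintegral_rpow_le_of_tendsto_setLIntegral {φ : ℕ → Space d → Space d}
    (hφ : ∀ n, Continuous (φ n)) (hv : Continuous v)
    (hlim : ∀ K : Set (Space d), IsCompact K →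
      Tendsto (fun n => ∫⁻ x in K, ‖φ n x - v x‖ₑ) atTop (𝓝 0)) {p : ℝ≥0∞} {C : ℝ≥0∞}
    (hp0 : p ≠ 0) (hpt : p ≠ ⊤) {N : ℕ} (hC : ∀ n ≥ N, eLpNorm (φ n) p volume ≤ C) :
    ∫⁻ x, ‖v x‖ₑ ^ p.toReal ≤ C ^ p.toReal := by
  refine lintegral_le_of_closedBall fun k => ?_
  have hp := ENNReal.toReal_pos hp0 hpt
  set μ := volume.restrict (Metric.closedBall (0 : Space d) (k : ℝ)) with hμ
  have hmeas : TendstoInMeasure μ φ atTop v := by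
    refine tendstoInMeasure_of_tendsto_eLpNorm (p := 1) one_ne_zero
      (fun n => (hφ n).aestronglyMeasurable) hv.aestronglyMeasurable ?_
    simpa [eLpNorm_one_eq_lintegral_enorm] using hlim _ (isCompact_closedBall 0 (k : ℝ))
  obtain ⟨ns, hns, hae⟩ := hmeas.exists_seq_tendsto_ae
  have h1 : eLpNorm v p μ ≤ C := by
    refine (Lp.eLpNorm_lim_le_liminf_eLpNorm (fun n => (hφ (ns n)).aestronglyMeasurable) v hae).trans ?_
    refine liminf_le_of_frequently_le' (Eventually.frequently ?_)
    filter_upwards [eventually_ge_atTop N] with n hn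
    exact (eLpNorm_mono_measure _ Measure.restrict_le_self).trans (hC _ (hn.trans (hns.id_le n)))
  rw [eLpNorm_eq_lintegral_rpow_enorm_toReal hp0 hpt] at h1
  calc _ = ((∫⁻ x, ‖v x‖ₑ ^ p.toReal ∂μ) ^ (1 / p.toReal)) ^ p.toReal := by
        rw [← ENNReal.rpow_mul, one_div_mul_cancel hp.ne', ENNReal.rpow_one]
    _ ≤ _ := ENNReal.rpow_le_rpow h1 hp.le

/-- A gradient bound for approximations passes to the limit, in the weak sense. -/
theorem enorm_integral_partialDeriv_mul_le {φ : ℕ → Space d → Space d}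
    (hφ : ∀ n, ContDiff ℝ ∞ (φ n)) (hv : ContDiff ℝ ∞ v)
    (hlim : ∀ K : Set (Space d), IsCompact K →
      Tendsto (fun n => ∫⁻ x in K, ‖φ n x - v x‖ₑ) atTop (𝓝 0)) {C : ℝ≥0∞}
    {N : ℕ} (hC : ∀ n ≥ N, eLpNorm (fderiv ℝ (φ n)) 2 volume ≤ C) {g : Space d → ℝ}
    (hg : ContDiff ℝ 1 g) (hc : HasCompactSupport g) (i j : Fin d) :
    ‖∫ x, partialDeriv j (fun y => v y i) x * g x‖ₑ ≤
      C * (∫⁻ x, ‖g x‖ₑ ^ (2 : ℝ)) ^ (1 / (2 : ℝ)) := by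
  have one : (1 : WithTop ℕ∞) ≤ ((⊤ : ℕ∞) : WithTop ℕ∞) := by simp
  have cg := continuous_partialDeriv hg j
  have sg := hasCompactSupport_partialDeriv hc j
  have hvi := contDiff_coord hv i
  have hφi := fun n => contDiff_coord (hφ n) i
  obtain ⟨B, hB⟩ := sg.exists_bound_of_continuous cg
  have int : ∀ {f : Space d → ℝ}, Continuous f → Integrable fun x => f x * partialDeriv j g x :=
    fun hf => (hf.mul cg).integrable_of_hasCompactSupport sg.mul_left
  have lim0 : Tendsto (fun n => ∫ x, (φ n x i * partialDeriv j g x - v x i * partialDeriv j g x))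
      atTop (𝓝 0) := by
    have lim := ENNReal.Tendsto.const_mul (hlim _ sg.isCompact)
      (Or.inr (ENNReal.ofReal_ne_top (r := B)))
    rw [mul_zero] at lim
    refine tendsto_integral_zero_of_enorm_le (fun n => ?_) lim
    have mD : Measurable fun x => ‖φ n x - v x‖ₑ :=
      ((hφ n).continuous.sub hv.continuous).measurable.enorm
    rw [← lintegral_const_mul _ mD, ← lintegral_indicator (isClosed_tsupport _).measurableSet]
    refine lintegral_mono fun x => ?_
    rw [← sub_mul, enorm_mul]
    by_cases hx : x ∈ tsupport (partialDeriv j g)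
    · rw [Set.indicator_of_mem hx, mul_comm]
      refine mul_le_mul' (enorm_le_ofReal (hB x)) ?_
      rw [← ofReal_norm (φ n x - v x)]
      exact enorm_le_ofReal (abs_coord_le (φ n x - v x) i)
    · simp [image_eq_zero_of_notMem_tsupport hx]
  have lim1 : Tendsto (fun n => ∫ x, partialDeriv j (fun y => φ n y i) x * g x) atTop
      (𝓝 (∫ x, partialDeriv j (fun y => v y i) x * g x)) := by
    have e : ∀ f : Space d → ℝ, ContDiff ℝ ∞ f →
        ∫ x, partialDeriv j f x * g x = -∫ x, f x * partialDeriv j g x := fun f hf => by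
      rw [integral_mul_partialDeriv (hf.of_le one) hg (Or.inr hc), neg_neg]
    rw [e _ hvi]
    simp_rw [fun n => e _ (hφi n)]
    refine Tendsto.neg ?_
    simp_rw [fun n => integral_sub (int (hφi n).continuous) (int hvi.continuous)] at lim0
    simpa using lim0.add_const (∫ x, v x i * partialDeriv j g x)
  refine le_of_tendsto (continuous_enorm.tendsto _ |>.comp lim1) ?_
  filter_upwards [eventually_ge_atTop N] with n hn
  have mF : Measurable fun x => ‖fderiv ℝ (φ n) x‖ₑ :=
    ((hφ n).continuous_fderiv (by simp)).measurable.enorm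
  have mg : Measurable fun x => ‖g x‖ₑ := hg.continuous.measurable.enorm
  calc ‖∫ x, partialDeriv j (fun y => φ n y i) x * g x‖ₑ
      ≤ ∫⁻ x, ‖fderiv ℝ (φ n) x‖ₑ * ‖g x‖ₑ := by
        refine (enorm_integral_le_lintegral_enorm _).trans (lintegral_mono fun x => ?_)
        rw [enorm_mul]
        refine mul_le_mul' ?_ le_rfl
        rw [← ofReal_norm (fderiv ℝ (φ n) x)]
        exact enorm_le_ofReal (abs_partialDeriv_coord_le ((hφ n).differentiable (by simp)) i j x)
    _ ≤ (∫⁻ x, ‖fderiv ℝ (φ n) x‖ₑ ^ (2 : ℝ)) ^ (1 / (2 : ℝ)) *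
          (∫⁻ x, ‖g x‖ₑ ^ (2 : ℝ)) ^ (1 / (2 : ℝ)) :=
        ENNReal.lintegral_mul_le_Lp_mul_Lq _ Real.HolderConjugate.two_two mF.aemeasurable
          mg.aemeasurable
    _ ≤ _ := by
        refine mul_le_mul' ?_ le_rfl
        have := hC n hn
        rwa [eLpNorm_eq_lintegral_rpow_enorm_toReal two_ne_zero ENNReal.ofNat_ne_top,
          ENNReal.toReal_ofNat] at this

/-- Duality with `g = χf`, `χ` a cutoff. Since `χ² ≤ χ`, the finite quantity `X = ∫χf²` satisfies `X
≤ C√X`, hence `X ≤ C²` uniformly in the cutoff. -/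
theorem lintegral_sq_partialDeriv_le {f : Space d → ℝ} (hf : ContDiff ℝ 1 f) {C : ℝ≥0∞}
    (h : ∀ g : Space d → ℝ, ContDiff ℝ 1 g → HasCompactSupport g →
      ‖∫ x, f x * g x‖ₑ ≤ C * (∫⁻ x, ‖g x‖ₑ ^ (2 : ℝ)) ^ (1 / (2 : ℝ))) :
    ∫⁻ x, ENNReal.ofReal (f x ^ 2) ≤ C ^ 2 := by
  obtain ⟨B, -, hB⟩ := exists_isCutoff d
  refine lintegral_le_of_closedBall fun k => ?_
  obtain ⟨χ, hχ⟩ := hB (k + 1) (by positivity)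
  have cf := hf.continuous
  have cχ := hχ.contDiff.continuous
  have hc : HasCompactSupport fun x => χ x * f x := hχ.hasCompactSupport.mul_right
  set X := ∫⁻ x, ENNReal.ofReal (χ x * f x ^ 2) with hX
  have hnn : ∀ x, 0 ≤ χ x * f x ^ 2 := fun x => mul_nonneg (hχ.nonneg x) (sq_nonneg _)
  have hi : Integrable fun x => χ x * f x ^ 2 :=
    Continuous.integrable_of_hasCompactSupport (by fun_prop) hχ.hasCompactSupport.mul_right
  have hXt : X ≠ ⊤ := hi.lintegral_lt_top.ne
  have h1 : X ≤ C * X ^ (1 / (2 : ℝ)) := by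
    calc X = ‖∫ x, f x * (χ x * f x)‖ₑ := by
          have e : ∀ x, f x * (χ x * f x) = χ x * f x ^ 2 := fun x => by ring
          simp_rw [e]
          rw [Real.enorm_of_nonneg (integral_nonneg hnn), hX,
            ofReal_integral_eq_lintegral_ofReal hi (Eventually.of_forall hnn)]
      _ ≤ _ := h _ ((hχ.contDiff.of_le (by simp)).mul hf) hc
      _ ≤ _ := by
          refine mul_le_mul' le_rfl (ENNReal.rpow_le_rpow (lintegral_mono fun x => ?_) (by norm_num))
          rw [Real.enorm_eq_ofReal_abs, ENNReal.rpow_ofNat, ← ENNReal.ofReal_pow (abs_nonneg _), sq_abs]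
          refine ENNReal.ofReal_le_ofReal ?_
          nlinarith [mul_nonneg (sub_nonneg.2 (hχ.le_one x)) (hnn x)]
  have h2 : X ≤ C ^ 2 := by
    rcases eq_or_ne X 0 with h0 | h0
    · rw [h0]; exact zero_le
    have hs0 : X ^ (1 / (2 : ℝ)) ≠ 0 := by
      rw [Ne, ENNReal.rpow_eq_zero_iff_of_pos (by norm_num)]; exact h0
    have hst : X ^ (1 / (2 : ℝ)) ≠ ⊤ := ENNReal.rpow_ne_top_of_nonneg (by norm_num) hXt
    have hsq : X ^ (1 / (2 : ℝ)) * X ^ (1 / (2 : ℝ)) = X := by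
      rw [← ENNReal.rpow_add _ _ h0 hXt]; norm_num
    have h3 : X ^ (1 / (2 : ℝ)) ≤ C := by
      rw [← ENNReal.mul_le_mul_iff_left hs0 hst, hsq]
      exact h1
    calc X = X ^ (1 / (2 : ℝ)) * X ^ (1 / (2 : ℝ)) := hsq.symm
      _ ≤ C * C := mul_le_mul' h3 h3
      _ = _ := (sq C).symm
  refine le_trans ?_ h2
  rw [hX, ← lintegral_indicator measurableSet_closedBall]
  refine lintegral_mono fun x => ?_
  by_cases hx : ‖x‖ ≤ k
  · rw [Set.indicator_of_mem (by simpa using hx), hχ.eq_one x (by linarith), one_mul]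
  · rw [Set.indicator_of_notMem (by simpa using hx)]; exact zero_le

/-- The Sobolev inequality and the gradient bound for smooth fields in `Ḣ¹`. -/
theorem MemHomogeneousH1.integrable (h : MemHomogeneousH1 v) (hd : 4 ≤ d) (hv : ContDiff ℝ ∞ v) :
    (Integrable fun x => ‖v x‖ ^ (2 * d / (d - 2) : ℝ)) ∧
      ∀ i j, Integrable fun x => partialDeriv j (fun y => v y i) x ^ 2 := by
  obtain ⟨φ, hφ, hcauchy, hlim⟩ := h
  have hd' : (4 : ℝ) ≤ d := by exact_mod_cast hd
  have hd2 : (d : ℝ) - 2 ≠ 0 := by linarith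
  obtain ⟨N, hN⟩ := hcauchy 1 one_pos
  -- The Cauchy condition with tolerance `1` bounds all gradients from index `N` on by this
  -- constant.
  set K := 1 + eLpNorm (fderiv ℝ (φ N)) 2 volume with hK
  have cφ := fun n => (hφ n).1.continuous_fderiv (by simp)
  have hKt : K ≠ ⊤ := by
    have := ((cφ N).memLp_of_hasCompactSupport (p := 2) (μ := volume)
      ((hφ N).2.fderiv (𝕜 := ℝ))).eLpNorm_ne_top
    finiteness
  have hgrad : ∀ n ≥ N, eLpNorm (fderiv ℝ (φ n)) 2 volume ≤ K := by
    intro n hn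
    have h1 := eLpNorm_add_le (p := 2) (μ := (volume : Measure (Space d)))
      ((cφ n).sub (cφ N)).aestronglyMeasurable (cφ N).aestronglyMeasurable one_le_two
    rw [sub_add_cancel] at h1
    exact h1.trans (add_le_add (hN n hn N le_rfl).le le_rfl)
  constructor
  · obtain ⟨p, hpr⟩ : ∃ p : NNReal, (p : ℝ) = 2 * d / (d - 2) :=
      ⟨⟨2 * d / (d - 2), div_nonneg (by positivity) (by linarith)⟩, rfl⟩
    have hp0 : p ≠ 0 := by
      rw [← NNReal.coe_ne_zero, hpr]; exact (div_pos (by linarith) (by linarith)).ne'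
    have hS : ∀ n ≥ N, eLpNorm (φ n) p volume ≤
        eLpNormLESNormFDerivOfEqInnerConst (volume : Measure (Space d)) 2 * K := by
      intro n hn
      refine (eLpNorm_le_eLpNorm_fderiv_of_eq_inner volume ((hφ n).1.of_le (by simp)) (hφ n).2
        (p := 2) (p' := p) one_le_two (by simp; lia) ?_).trans
        (mul_le_mul' le_rfl (hgrad n hn))
      rw [hpr, finrank_euclideanSpace_fin]; push_cast; field_simp
    have := lintegral_rpow_le_of_tendsto_setLIntegral (fun n => (hφ n).1.continuous) hv.continuous
      hlim (by exact_mod_cast hp0) ENNReal.coe_ne_top hS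
    rw [ENNReal.coe_toReal, hpr] at this
    have hpnn : (0 : ℝ) ≤ 2 * d / (d - 2) := hpr ▸ p.2
    refine ⟨(hv.continuous.norm.rpow_const fun x => Or.inr hpnn).aestronglyMeasurable, ?_⟩
    rw [HasFiniteIntegral]
    simp_rw [Real.enorm_rpow_of_nonneg (norm_nonneg _) hpnn, enorm_norm]
    refine this.trans_lt (lt_top_iff_ne_top.2 (ENNReal.rpow_ne_top_of_nonneg hpnn (by finiteness)))
  · intro i j
    have hD := contDiff_partialDeriv (contDiff_coord hv i) j
    refine ⟨(hD.continuous.pow 2).aestronglyMeasurable, ?_⟩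
    rw [hasFiniteIntegral_iff_ofReal (Eventually.of_forall fun x => sq_nonneg _)]
    refine (lintegral_sq_partialDeriv_le (hD.of_le (by simp)) fun g hg hc =>
      enorm_integral_partialDeriv_mul_le (fun n => (hφ n).1) hv hlim hgrad hg hc i j).trans_lt ?_
    finiteness

end

/-! ### Conclusion: vanishing velocity and constant density -/

section

variable {d : ℕ} {A γ mu lam : ℝ} {ρ : Space d → ℝ} {v : Space d → Space d}

theorem eq_of_partialDeriv_eq_zero {f : Space d → ℝ} (hf : Differentiable ℝ f)
    (h : ∀ j x, partialDeriv j f x = 0) (x y : Space d) : f x = f y := by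
  refine is_const_of_fderiv_eq_zero hf (fun z => ?_) x y
  ext w
  rw [fderiv_eq_sum_partialDeriv]; simp [h]

/-- A nonzero constant is not integrable on a space of infinite measure; `d > 0` ensures that the
measure is infinite. -/
theorem eq_zero_of_integrable_norm_rpow (hd : 0 < d) {p : ℝ} (hp : 0 < p)
    (hv : ∀ x y, v x = v y) (hi : Integrable fun x => ‖v x‖ ^ p) (x : Space d) : v x = 0 := by
  have : Nonempty (Fin d) := ⟨⟨0, hd⟩⟩
  have : Nontrivial (Space d) := inferInstance
  have e : (fun x => ‖v x‖ ^ p) = fun _ => ‖v x‖ ^ p := by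
    ext y; rw [hv y x]
  rw [e, integrable_const_iff, or_comm] at hi
  rcases hi with hi | hi
  · have h1 := hi.measure_univ_lt_top
    have : NoncompactSpace (Space d) := NormedSpace.noncompactSpace ℝ _
    rw [measure_univ_of_isAddLeftInvariant] at h1
    exact absurd h1 (lt_irrefl _)
  · rw [Real.rpow_eq_zero (norm_nonneg _) hp.ne'] at hi
    exact norm_eq_zero.1 hi

/-- The essential bound holds on a closed set of full measure; such a set is dense, hence
everything. -/
theorem exists_forall_le_of_memLp_top (hc : Continuous ρ) (h : MemLp ρ ∞ volume) :
    ∃ M : ℝ, ∀ x, ρ x ≤ M := by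
  refine ⟨(eLpNorm ρ ∞ volume).toReal, fun x => ?_⟩
  have hae : ∀ᵐ y ∂(volume : Measure (Space d)), ρ y ≤ (eLpNorm ρ ∞ volume).toReal := by
    filter_upwards [ae_le_eLpNormEssSup (f := ρ) (μ := volume)] with y hy
    rw [← eLpNorm_exponent_top] at hy
    refine (le_abs_self _).trans ?_
    have := ENNReal.toReal_mono h.eLpNorm_ne_top hy
    simpa using this
  exact (isClosed_le hc continuous_const).closure_subset_iff.2 le_rfl
    ((Measure.dense_of_ae hae).closure_eq ▸ Set.mem_univ x)

/-- Without velocity gradient both convection and viscous stress vanish, so `∇P = 0`, and `s ↦ A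
s^γ` is injective on `[0, ∞)`. -/
theorem IsComponentSolution.density_eq {u : Fin d → Space d → ℝ}
    (h : IsComponentSolution γ mu lam ρ (fun y => A * ρ y ^ γ) u) (hA : 0 < A) (hγ : 1 < γ)
    (hρ0 : ∀ x, 0 ≤ ρ x) (hu : ∀ i j x, partialDeriv j (u i) x = 0) (x y : Space d) :
    ρ x = ρ y := by
  have hvs : ∀ i j, viscousStress mu lam u i j = fun _ => 0 := fun i j => by
    ext z; simp [viscousStress, hu]
  have hP : ∀ i z, partialDeriv i (fun y => A * ρ y ^ γ) z = 0 := fun i z => by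
    rw [h.partialDeriv_pressure_eq]
    simp only [hu, hvs]
    simp [partialDeriv]
  have := eq_of_partialDeriv_eq_zero (h.contDiff_pressure.differentiable (by simp)) hP x y
  exact Real.rpow_left_injOn (by linarith) (hρ0 x) (hρ0 y) (mul_left_cancel₀ hA.ne' this)

theorem IsComponentSolution.eq_zero_and_const
    (h : IsComponentSolution γ mu lam ρ (fun y => A * ρ y ^ γ) fun i y => v y i) (hd : 0 < d)
    (hA : 0 < A) (hγ : 1 < γ) (hρ0 : ∀ x, 0 ≤ ρ x) {p : ℝ} (hp : 0 < p)
    (hi : Integrable fun x => ‖v x‖ ^ p)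
    (hu : ∀ i j x, partialDeriv j (fun y => v y i) x = 0) :
    (∀ x, v x = 0) ∧ ∃ c : ℝ, ∀ x, ρ x = c := by
  refine ⟨eq_zero_of_integrable_norm_rpow hd hp (fun x y => ?_) hi, ρ 0, fun x =>
    h.density_eq hA hγ hρ0 hu x 0⟩
  ext i
  exact eq_of_partialDeriv_eq_zero ((h.contDiff_velocity i).differentiable (by simp)) (hu i) x y

theorem norm_sq_eq_sqSpeed (x : Space d) : ‖v x‖ ^ 2 = sqSpeed (fun i y => v y i) x := by
  rw [EuclideanSpace.norm_sq_eq]; simp [sqSpeed]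

theorem IsComponentSolution.eq_zero_and_const_of_memLp
    (h : IsComponentSolution γ mu lam ρ (fun y => A * ρ y ^ γ) fun i y => v y i) (hd : 0 < d)
    (hA : 0 < A) (hγ : 1 < γ) (hmu : 0 < mu) (hlam : 0 < lam + 2 * mu) (hv : ContDiff ℝ ∞ v)
    (hρ0 : ∀ x, 0 ≤ ρ x) (hρb : MemLp ρ ∞ volume) (hgrad : MemLp (fderiv ℝ v) 2 volume)
    {p : ℝ≥0∞} (hvp : MemLp v p volume) (hpt : p ≠ ⊤) (hp : 4 < p.toReal)
    (hθ : d * (1 - 3 / p.toReal) ≤ 1) :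
    (∀ x, v x = 0) ∧ ∃ c : ℝ, ∀ x, ρ x = c := by
  obtain ⟨M, hM⟩ := exists_forall_le_of_memLp_top h.contDiff_density.continuous hρb
  have hp0 : p ≠ 0 := by rintro rfl; norm_num at hp
  have hi := hvp.integrable_norm_rpow hp0 hpt
  have cF := hv.continuous_fderiv (by simp)
  exact h.eq_zero_and_const hd hA hγ hρ0 (by linarith) hi
    (h.partialDeriv_eq_zero_of_four_lt hd hA hγ hmu hlam hρ0 (fun x => norm_nonneg (v x))
      norm_sq_eq_sqSpeed (fun j x => abs_coord_le (v x) j) hv.continuous.norm cF.norm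
      (fun x => norm_nonneg _) (abs_partialDeriv_coord_le (hv.differentiable (by simp)))
      ((memLp_two_iff_integrable_sq_norm cF.aestronglyMeasurable).1 hgrad) hM hp hθ hi)

theorem IsComponentSolution.eq_zero_and_const_of_memHomogeneousH1
    (h : IsComponentSolution γ mu lam ρ (fun y => A * ρ y ^ γ) fun i y => v y i) (hd : 4 ≤ d)
    (hA : 0 < A) (hγ : 1 < γ) (hmu : 0 < mu) (hlam : 0 < lam + 2 * mu) (hv : ContDiff ℝ ∞ v)
    (hρ0 : ∀ x, 0 ≤ ρ x) (hρb : MemLp ρ ∞ volume) (hH : MemHomogeneousH1 v) :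
    (∀ x, v x = 0) ∧ ∃ c : ℝ, ∀ x, ρ x = c := by
  obtain ⟨M, hM⟩ := exists_forall_le_of_memLp_top h.contDiff_density.continuous hρb
  obtain ⟨hi, hD⟩ := hH.integrable hd hv
  have hd' : (4 : ℝ) ≤ d := by exact_mod_cast hd
  -- `√S`, the Frobenius norm of the gradient, serves as `N`, because membership in `Ḣ¹` was shown
  -- to give square integrability entry by entry.
  set S : Space d → ℝ := fun x => ∑ i, ∑ j, partialDeriv j (fun y => v y i) x ^ 2 with hS
  have hS0 : ∀ x, 0 ≤ S x := fun x =>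
    Finset.sum_nonneg fun _ _ => Finset.sum_nonneg fun _ _ => sq_nonneg _
  have cD := fun i j => (contDiff_partialDeriv (contDiff_coord hv i) j).continuous
  have cS : Continuous S := by fun_prop
  refine h.eq_zero_and_const (by lia) hA hγ hρ0 (div_pos (by linarith) (by linarith)) hi
    (h.partialDeriv_eq_zero_of_four_le hd hA hγ hmu hlam hρ0 (fun x => norm_nonneg (v x))
      norm_sq_eq_sqSpeed (fun j x => abs_coord_le (v x) j) hv.continuous.norm cS.sqrt
      (fun x => Real.sqrt_nonneg _) (fun i j x => Real.abs_le_sqrt ?_) ?_ hM rfl hi)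
  · exact (Finset.single_le_sum (f := fun j => partialDeriv j (fun y => v y i) x ^ 2)
        (fun _ _ => sq_nonneg _) (Finset.mem_univ j)).trans
      (Finset.single_le_sum (f := fun i => ∑ j, partialDeriv j (fun y => v y i) x ^ 2)
        (fun _ _ => Finset.sum_nonneg fun _ _ => sq_nonneg _) (Finset.mem_univ i))
  · simp_rw [Real.sq_sqrt (hS0 _)]
    exact integrable_finsetSum _ fun i _ => integrable_finsetSum _ fun j _ => hD i j

end

end CompressibleNS

end

theorem theorem1 (d : ℕ) (hd : 2 ≤ d) (A γ mu lam : ℝ)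
    (hA : 0 < A) (hγ : 1 < γ) (hmu : 0 < mu) (hlam : 0 < lam + 2 * mu)
    (ρ : CompressibleNS.Space d → ℝ) (v : CompressibleNS.Space d → CompressibleNS.Space d)
    (hρ_smooth : ContDiff ℝ ∞ ρ) (hv_smooth : ContDiff ℝ ∞ v) (hρ_nonneg : ∀ x, 0 ≤ ρ x)
    (hsol : CompressibleNS.IsStationarySolution A γ mu lam ρ v)
    (hρ_bdd : MemLp ρ ∞ volume)
    (h_four : 4 ≤ d → CompressibleNS.MemHomogeneousH1 v)
    (h_three : d = 3 → MemLp (fderiv ℝ v) 2 volume ∧ MemLp v (9 / 2) volume)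
    (h_two : d = 2 → MemLp (fderiv ℝ v) 2 volume ∧ MemLp v 6 volume) :
    (∀ x, v x = 0) ∧ ∃ c : ℝ, ∀ x, ρ x = c := by
  have h := hsol.isComponentSolution hγ hρ_smooth hv_smooth hρ_nonneg
  have hcases : d = 2 ∨ d = 3 ∨ 4 ≤ d := by lia
  rcases hcases with rfl | rfl | h4
  -- In dimensions `2` and `3` the exponents are the critical `3d/(d-1)`, for which `d(1 - 3/p) =
  -- 1`.
  · obtain ⟨hg, hv⟩ := h_two rfl
    exact h.eq_zero_and_const_of_memLp two_pos hA hγ hmu hlam hv_smooth hρ_nonneg hρ_bdd hg hv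
      (by norm_num) (by norm_num) (by norm_num)
  · obtain ⟨hg, hv⟩ := h_three rfl
    have e : ((9 / 2 : ℝ≥0∞)).toReal = 9 / 2 := by simp
    exact h.eq_zero_and_const_of_memLp three_pos hA hγ hmu hlam hv_smooth hρ_nonneg hρ_bdd hg hv
      (by finiteness) (by rw [e]; norm_num) (by rw [e]; norm_num)
  · exact h.eq_zero_and_const_of_memHomogeneousH1 h4 hA hγ hmu hlam hv_smooth hρ_nonneg hρ_bdd
      (h_four h4)
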